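/- Let $d\ge 1$, let $\mathbb{T}^d=\mathbb{R}^d/\mathbb{Z}^d$, and let $\mathbb{E}$ be either $(0,\infty)$ or $[0,\infty)$. Let $\mathcal{M}_{ac}(\mathbb{T}^d)$ be the set of finite positive measures $\mathbf{m}$ on $\mathbb{T}^d$ that are absolutely continuous with respect to Lebesgue measure, with density $m\in L^1(\mathbb{T}^d)$. Let $h:\mathcal{M}_{ac}(\mathbb{T}^d)\to C(\mathbb{T}^d)$, $H=H(x,p,M,m,\theta):\mathbb{T}^d\times\mathbb{R}^d\times\mathbb{R}^{d\times d}\times\mathbb{E}\times\mathbb{R}\to\mathbb{R}$, let $g:\mathbb{T}^d\times\mathbb{E}\times\mathbb{R}\to\mathbb{R}$ be continuous and $\gamma>1$. Assume the following, where in (g), (g-ei) and (H1) the measures $\mathbf m$ are those elements of $\mathcal{M}_{ac}(\mathbb{T}^d)$ whose density takes its values in $\mathbb{E}$ a.e., and the integrals in (g) and (g-ei) take values in $[-\infty,\infty]$. (h) For every integer $\kappa>\frac d2+1$, the map $m\mapsto h(\mathbf m)$, defined on the nonnegative elements of $W^{\kappa,2}(\mathbb{T}^d)$, takes values in $W^{\kappa,2}(\mathbb{T}^d)$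 and is Fréchet differentiable (relative to this cone) from $W^{\kappa,2}(\mathbb{T}^d)$ to $W^{\kappa,2}(\mathbb{T}^d)$. (g) $g=g_1+g_2$ with Borel functions $g_1,g_2$ on $\mathbb{T}^d\times\mathbb{E}\times\mathbb{R}$ such that, for all $\mathbf m$, $g_2(x,m(x),h(\mathbf m)(x))\ge 0$ for a.e. $x$; there is $c>0$ with $\int_{\mathbb{T}^d} g_2(x,m,h(\mathbf m))\,dx\le c\,(1+\int_{\mathbb{T}^d} m\,dx)$ for all $\mathbf m$; for every $\delta>0$ there is $C_\delta>0$ with $$\max\Big\{\int_{\mathbb{T}^d} g_1(x,m,h(\mathbf m))\,dx,\ \int_{\mathbb{T}^d} m\,dx\Big\}\le\delta\int_{\mathbb{T}^d} m\,g_1(x,m,h(\mathbf m))\,dx+C_\delta\quad\text{for all }\mathbf m;$$ and there is $R\ge 0$ with $\int_{\mathbb{T}^d} m\,g_1(x,m,h(\mathbf m))\,dx\ge -R$ for all $\mathbf m$. (g-ei) If $\sup_j\int_{\mathbb{T}^d} m_j\,g_1(x,m_j,h(\mathbf m_j))\,dx<\infty$ for a sequence $(\mathbf m_j)$, then a subsequence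 of $(m_j)$ converges weakly in $L^1(\mathbb{T}^d)$. (H1) There are $0\le\tau<1$ and $C_1,C_2,C_3,C_4>0$ such that, for all $(x,p,M,m,\theta)\in\mathbb{T}^d\times\mathbb{R}^d\times\mathbb{R}^{d\times d}\times\mathbb{E}\times\mathbb{R}$, $$-H+D_pH\cdot p+D_MH:M\ \ge\ \tfrac1{C_1}m^{-\tau}|p|^\gamma+C_2\,g(x,m,\theta)-C_1,$$ and, for all $\mathbf m$ and all $u\in W^{1,\gamma}(\mathbb{T}^d)$ whose weak second derivative $D^2u$ is an integrable function, whenever the functions integrated below are integrable, $$-C_3\int_{\mathbb{T}^d} g(x,m,h(\mathbf m))\,dx+\tfrac1{C_1}\int_{\mathbb{T}^d}|Du|^\gamma m^{-\tau}\,dx-C_1\le\int_{\mathbb{T}^d} H(x,Du,D^2u,m,h(\mathbf m))\,dx$$ $$\le -C_4\int_{\mathbb{T}^d} g(x,m,h(\mathbf m))\,dx+C_1\Big(1+\int_{\mathbb{T}^d}|Du|^\gamma m^{-\tau}\,dx\Big).$$ (H2) $H$ is of class $C^\infty$ on $\mathbb{T}^d\times\mathbb{R}^d\times\mathbb{R}^{d\times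 d}\times\mathbb{E}\times\mathbb{R}$. (H3) The operator $$A\begin{bmatrix}\eta\\v\end{bmatrix}=\begin{bmatrix}-v-H(x,Dv,D^2v,\eta,h(\boldsymbol\eta))\\ \eta-\operatorname{div}\big(\eta D_pH(x,Dv,D^2v,\eta,h(\boldsymbol\eta))\big)+\sum_{i,j}\big(\eta D_{M_{ij}}H(x,Dv,D^2v,\eta,h(\boldsymbol\eta))\big)_{x_ix_j}-1\end{bmatrix}$$ is monotone on $C^\infty(\mathbb{T}^d;\mathbb{E})\times C^\infty(\mathbb{T}^d)$ with respect to the inner product of $L^2(\mathbb{T}^d)\times L^2(\mathbb{T}^d)$. Then the stationary mean-field game $$-u-H(x,Du,D^2u,m,h(\mathbf m))=0,\qquad m-\operatorname{div}(mD_pH)+\sum_{i,j}(mD_{M_{ij}}H)_{x_ix_j}=1\quad\text{on }\mathbb{T}^d$$ has a weak solution, that is, there is $(m,u)\in\mathcal{D}'(\mathbb{T}^d)\times\mathcal{D}'(\mathbb{T}^d)$ with $m\ge0$ and $$\left\langle\begin{bmatrix}\eta\\v\end{bmatrix}-\begin{bmatrix}m\\u\end{bmatrix},A\begin{bmatrix}\eta\\v\end{bmatrix}\right\rangle\ge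 0\qquad\text{for all }(\eta,v)\in C^\infty(\mathbb{T}^d;\mathbb{E})\times C^\infty(\mathbb{T}^d),$$ the pairing being that of $\mathcal{D}'(\mathbb{T}^d)^2$ with $C^\infty(\mathbb{T}^d)^2$. Moreover, $m$ is the density of a measure in $\mathcal{M}_{ac}(\mathbb{T}^d)$, $\int_{\mathbb{T}^d}m\,dx=1$, and $u\in W^{1,\gamma}(\mathbb{T}^d)$. -/

import Mathlib

open MeasureTheory Set Filter Topology
open scoped ContDiff ENNReal

noncomputable section

namespace MFG

/-- The torus `ℝ^d / ℤ^d`; its `volume` is Lebesgue measure, of total mass one. -/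
abbrev Torus (d : ℕ) : Type := UnitAddTorus (Fin d)

/-- The quotient map `ℝ^d → ℝ^d / ℤ^d`. -/
def proj {d : ℕ} (y : Fin d → ℝ) : Torus d := fun i => (y i : UnitAddCircle)

/-- `d × d` matrices, as a normed space (finite-dimensional, so the choice of norm is immaterial
for smoothness). -/
abbrev Mat (d : ℕ) : Type := Fin d → Fin d → ℝ

/-! ### Smooth functions and partial derivatives on the torus -/

/-- The partial derivative `∂f/∂x_i` at a point of the torus. -/
def pderiv {d : ℕ} (i : Fin d) (f : Torus d → ℝ) (x : Torus d) : ℝ :=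
  deriv (fun t : ℝ => f (x + Pi.single i (t : UnitAddCircle))) 0

/-- `C^∞(𝕋^d)`: functions whose periodic lift to `ℝ^d` is smooth. -/
def SmoothFun (d : ℕ) : Submodule ℝ C(Torus d, ℝ) where
  carrier := {f | ContDiff ℝ ∞ (fun y : Fin d → ℝ => f (proj y))}
  zero_mem' := by simpa using contDiff_const
  add_mem' := by
    intro f g hf hg
    simp only [Set.mem_ofPred_eq] at hf hg
    exact hf.add hg
  smul_mem' := by
    intro c f hf
    simp only [Set.mem_ofPred_eq] at hf
    exact contDiff_const.smul hf

instance (d : ℕ) : CoeFun (SmoothFun d) (fun _ => Torus d → ℝ) := ⟨fun f => f.1⟩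

lemma isOpenQuotientMap_proj (d : ℕ) : IsOpenQuotientMap (proj (d := d)) :=
  IsOpenQuotientMap.piMap (f := fun (_ : Fin d) (t : ℝ) => (t : UnitAddCircle))
    (fun _ => QuotientAddGroup.isOpenQuotientMap_mk)

lemma pderiv_proj {d : ℕ} (i : Fin d) (f : SmoothFun d) (y : Fin d → ℝ) :
    pderiv i f (proj y) = fderiv ℝ (fun z : Fin d → ℝ => f (proj z)) y (Pi.single i 1) := by
  have hf' : ContDiff ℝ ∞ (fun z : Fin d → ℝ => f (proj z)) := f.2
  have hf : Differentiable ℝ (fun z : Fin d → ℝ => f (proj z)) := hf'.differentiable (by simp)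
  have h1 : (fun t : ℝ => f (proj y + Pi.single i (t : UnitAddCircle)))
      = fun t : ℝ => (fun z : Fin d → ℝ => f (proj z)) (y + t • Pi.single i (1 : ℝ)) := by
    funext t
    congr 1
    funext j
    by_cases hj : j = i
    · subst hj; simp [proj]
    · simp [proj, hj]
  unfold pderiv
  rw [h1]
  exact ((hf y).hasFDerivAt.hasLineDerivAt _).deriv

lemma contDiff_pderiv {d : ℕ} (i : Fin d) (f : SmoothFun d) :
    ContDiff ℝ ∞ (fun y : Fin d → ℝ => pderiv i f (proj y)) := by
  simp_rw [pderiv_proj]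
  have hf : ContDiff ℝ ∞ (fun z : Fin d → ℝ => f (proj z)) := f.2
  exact (hf.fderiv_right (m := ∞) (by simp)).clm_apply contDiff_const

/-- The partial derivative as an operator on `C^∞(𝕋^d)`. -/
def dpartial {d : ℕ} (i : Fin d) (f : SmoothFun d) : SmoothFun d :=
  ⟨⟨pderiv i f, (isOpenQuotientMap_proj d).continuous_comp_iff.1 (contDiff_pderiv i f).continuous⟩,
    contDiff_pderiv i f⟩

/-- The iterated derivative `∂_{i₁} ⋯ ∂_{i_k} f` along a list `[i₁, …, i_k]` of directions. -/
def iterPartial {d : ℕ} (l : List (Fin d)) (f : SmoothFun d) : SmoothFun d :=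
  l.foldr dpartial f

lemma integrable_smooth {d : ℕ} (f : SmoothFun d) : Integrable (f : Torus d → ℝ) :=
  f.1.continuous.integrable_of_hasCompactSupport (HasCompactSupport.of_compactSpace _)

/-! ### Distributions on the torus -/

/-- `𝒟'(𝕋^d)`: linear functionals on `C^∞(𝕋^d)` with
`|T φ| ≤ C max_{|l| ≤ N} ‖∂^l φ‖_∞` for some `N` and `C`. -/
structure TorusDistribution (d : ℕ) where
  toFun : SmoothFun d →ₗ[ℝ] ℝ
  cont : ∃ (N : ℕ) (C : ℝ), ∀ (φ : SmoothFun d) (B : ℝ),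
    (∀ l : List (Fin d), l.length ≤ N → ∀ x, |iterPartial l φ x| ≤ B) → |toFun φ| ≤ C * B

/-- The distribution `T` is nonnegative. -/
def TorusDistribution.Nonneg {d : ℕ} (T : TorusDistribution d) : Prop :=
  ∀ φ : SmoothFun d, (∀ x, 0 ≤ φ x) → 0 ≤ T.toFun φ

/-- The distribution `T` is the integrable function `f`. -/
def TorusDistribution.IsFun {d : ℕ} (T : TorusDistribution d) (f : Torus d → ℝ) : Prop :=
  Integrable f ∧ ∀ φ : SmoothFun d, T.toFun φ = ∫ x, f x * φ x

/-! ### Weak derivatives and Sobolev spaces -/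

/-- `w` is the weak derivative `∂_{i₁} ⋯ ∂_{i_k} f`, `l = [i₁, …, i_k]`. -/
def IsWeakDeriv {d : ℕ} (l : List (Fin d)) (f w : Torus d → ℝ) : Prop :=
  ∀ φ : SmoothFun d, ∫ x, f x * iterPartial l φ x = (-1) ^ l.length * ∫ x, w x * φ x

/-- `u ∈ W^{1,γ}(𝕋^d)` with weak gradient `Du`. -/
structure IsSobolevOne {d : ℕ} (γ : ℝ) (u : Torus d → ℝ)
    (Du : Torus d → EuclideanSpace ℝ (Fin d)) : Prop where
  memLp : MemLp u (ENNReal.ofReal γ)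
  memLp_grad : ∀ i, MemLp (fun x => Du x i) (ENNReal.ofReal γ)
  weak : ∀ i, IsWeakDeriv [i] u (fun x => Du x i)

/-- Sequences of at most `κ` directions, indexing the partial derivatives of order at most `κ`. -/
abbrev SobolevIndex (d κ : ℕ) : Type := Σ k : Fin (κ + 1), (Fin k → Fin d)

/-- The index of the derivative of order zero. -/
def SobolevIndex.zero (d κ : ℕ) : SobolevIndex d κ := ⟨0, fun j => j.elim0⟩

lemma integrable_mul_smooth {d : ℕ} (f : Lp ℝ 2 (volume : Measure (Torus d))) (φ : SmoothFun d) :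
    Integrable (fun x => f x * φ x) := by
  have hφ : MemLp (φ : Torus d → ℝ) 2 := by
    exact φ.1.continuous.memLp_of_hasCompactSupport (HasCompactSupport.of_compactSpace _)
  exact (Lp.memLp f).integrable_mul hφ

/-- `W^{κ,2}(𝕋^d)`: a function in `L²` together with its weak derivatives of order at most `κ`
(which it determines), all of them in `L²`. The norm inherited from the `ℓ²` sum is
`(∑_{k ≤ κ} ∫ |D^k f|²)^{1/2}`. -/
def Sobolev (d κ : ℕ) :
    Submodule ℝ (PiLp 2 (fun _ : SobolevIndex d κ => Lp ℝ 2 (volume : Measure (Torus d)))) where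
  carrier := {F | ∀ a : SobolevIndex d κ,
    IsWeakDeriv (List.ofFn a.2) (F (SobolevIndex.zero d κ)) (F a)}
  zero_mem' := by
    intro a φ
    have h : ∀ ψ : SmoothFun d,
        ∫ x, (0 : Lp ℝ 2 (volume : Measure (Torus d))) x * ψ x = 0 := by
      intro ψ
      rw [integral_eq_zero_of_ae]
      filter_upwards [Lp.coeFn_zero ℝ 2 (volume : Measure (Torus d))] with x hx
      rw [hx]; simp
    simp only [PiLp.zero_apply]
    rw [h, h, mul_zero]
  add_mem' := by
    intro F G hF hG a φ
    have h : ∀ (f g : Lp ℝ 2 (volume : Measure (Torus d))) (ψ : SmoothFun d),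
        ∫ x, (f + g) x * ψ x = (∫ x, f x * ψ x) + ∫ x, g x * ψ x := by
      intro f g ψ
      rw [← integral_add (integrable_mul_smooth f ψ) (integrable_mul_smooth g ψ)]
      refine integral_congr_ae ?_
      filter_upwards [Lp.coeFn_add f g] with x hx
      rw [hx, Pi.add_apply, add_mul]
    simp only [PiLp.add_apply]
    rw [h, h, hF a φ, hG a φ, mul_add]
  smul_mem' := by
    intro c F hF a φ
    have h : ∀ (f : Lp ℝ 2 (volume : Measure (Torus d))) (ψ : SmoothFun d),
        ∫ x, (c • f) x * ψ x = c * ∫ x, f x * ψ x := by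
      intro f ψ
      rw [← integral_const_mul]
      refine integral_congr_ae ?_
      filter_upwards [Lp.coeFn_smul c f] with x hx
      rw [hx, Pi.smul_apply, smul_eq_mul, mul_assoc]
    simp only [PiLp.smul_apply]
    rw [h, h, hF a φ]
    ring

/-- The function underlying an element of `W^{κ,2}(𝕋^d)`. -/
def sobolevFn {d κ : ℕ} (F : Sobolev d κ) : Torus d → ℝ := F.1 (SobolevIndex.zero d κ)

lemma integrable_sobolevFn {d κ : ℕ} (F : Sobolev d κ) : Integrable (sobolevFn F) :=
  (Lp.memLp (F.1 (SobolevIndex.zero d κ))).integrable (by norm_num)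

/-! ### Absolutely continuous measures -/

/-- `ℳ_ac(𝕋^d)`: finite positive measures, absolutely continuous with respect to Lebesgue
measure. -/
def Mac (d : ℕ) : Type :=
  {μ : Measure (Torus d) // IsFiniteMeasure μ ∧ μ ≪ (volume : Measure (Torus d))}

/-- The density of an absolutely continuous measure. -/
def Mac.dens {d : ℕ} (μ : Mac d) (x : Torus d) : ℝ :=
  (μ.1.rnDeriv (volume : Measure (Torus d)) x).toReal

/-- The measure with density `f` (used for `f ≥ 0`). -/
def Mac.ofDensity {d : ℕ} (f : Torus d → ℝ) (hf : Integrable f) : Mac d :=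
  ⟨volume.withDensity (fun x => ENNReal.ofReal (f x)),
    isFiniteMeasure_withDensity_ofReal hf.2, withDensity_absolutelyContinuous _ _⟩

/-- The density of `μ` takes its values in `E` (almost everywhere). -/
def Mac.ValuedIn {d : ℕ} (μ : Mac d) (E : Set ℝ) : Prop := ∀ᵐ x, μ.dens x ∈ E

/-- The Lebesgue integral over the torus with values in `[-∞, ∞]`; it is `-∞` when the positive
and the negative part both have infinite integral. -/
def extIntegral {d : ℕ} (f : Torus d → ℝ) : EReal :=
  ((∫⁻ x, ENNReal.ofReal (f x) : ℝ≥0∞) : EReal) - ((∫⁻ x, ENNReal.ofReal (-f x) : ℝ≥0∞) : EReal)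

/-! ### The Hamiltonian and the operator `A` -/

/-- A Hamiltonian `H(x, p, M, m, θ)`. Only its values for `m ∈ E` matter. -/
abbrev Hamiltonian (d : ℕ) : Type :=
  Torus d → EuclideanSpace ℝ (Fin d) → Mat d → ℝ → ℝ → ℝ

/-- `∂H/∂p_i`. -/
def DpH {d : ℕ} (H : Hamiltonian d) (i : Fin d) (x : Torus d) (p : EuclideanSpace ℝ (Fin d))
    (M : Mat d) (m θ : ℝ) : ℝ :=
  fderiv ℝ (fun q => H x q M m θ) p (EuclideanSpace.single i 1)

/-- `∂H/∂M_{ij}`. -/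
def DMH {d : ℕ} (H : Hamiltonian d) (i j : Fin d) (x : Torus d) (p : EuclideanSpace ℝ (Fin d))
    (M : Mat d) (m θ : ℝ) : ℝ :=
  fderiv ℝ (fun N : Mat d => H x p N m θ) M (Pi.single i (Pi.single j 1))

/-- The gradient of a smooth function. -/
def grad {d : ℕ} (v : SmoothFun d) (x : Torus d) : EuclideanSpace ℝ (Fin d) :=
  WithLp.toLp 2 (fun i => pderiv i v x)

/-- The Hessian of a smooth function. -/
def hess {d : ℕ} (v : SmoothFun d) (x : Torus d) : Mat d :=
  fun i j => pderiv i (pderiv j v) x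

/-- The measure `η dx`, for smooth `η ≥ 0`. -/
def smoothMeasure {d : ℕ} (η : SmoothFun d) : Mac d := Mac.ofDensity η (integrable_smooth η)

/-- First component of `A(η, v)`: `-v - H(x, Dv, D²v, η, h(η))`. -/
def A₁ {d : ℕ} (H : Hamiltonian d) (h : Mac d → C(Torus d, ℝ)) (η v : SmoothFun d)
    (x : Torus d) : ℝ :=
  -v x - H x (grad v x) (hess v x) (η x) (h (smoothMeasure η) x)

/-- Second component of `A(η, v)`: `η - div(η D_pH) + (η D_{M_ij}H)_{x_i x_j} - 1`. -/
def A₂ {d : ℕ} (H : Hamiltonian d) (h : Mac d → C(Torus d, ℝ)) (η v : SmoothFun d)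
    (x : Torus d) : ℝ :=
  η x
    - ∑ i, pderiv i
        (fun y => η y * DpH H i y (grad v y) (hess v y) (η y) (h (smoothMeasure η) y)) x
    + ∑ i, ∑ j, pderiv i (pderiv j
        (fun y => η y * DMH H i j y (grad v y) (hess v y) (η y) (h (smoothMeasure η) y))) x
    - 1

/-- `(m, u) ∈ 𝒟' × 𝒟'` is a weak solution: `m ≥ 0` and, for all smooth `(η, v)` with `η` valued
in `E`, `A(η, v)` is smooth and `⟨(η, v) - (m, u), A(η, v)⟩ ≥ 0`. -/
def IsWeakSolution {d : ℕ} (E : Set ℝ) (H : Hamiltonian d) (h : Mac d → C(Torus d, ℝ))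
    (m u : TorusDistribution d) : Prop :=
  m.Nonneg ∧
  ∀ η v : SmoothFun d, (∀ x, η x ∈ E) →
    ∃ a b : SmoothFun d, (∀ x, a x = A₁ H h η v x) ∧ (∀ x, b x = A₂ H h η v x) ∧
      0 ≤ ((∫ x, η x * a x) - m.toFun a) + ((∫ x, v x * b x) - u.toFun b)

/-! ### Assumptions -/

/-- Assumption on the nonlocal operator `h`: for every integer `κ > d/2 + 1`, it maps nonnegative
elements of `W^{κ,2}` to `W^{κ,2}`, in a Fréchet differentiable way. -/
def HypNonlocal {d : ℕ} (h : Mac d → C(Torus d, ℝ)) : Prop :=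
  ∀ κ : ℕ, (d : ℝ) / 2 + 1 < κ →
    ∃ hκ : Sobolev d κ → Sobolev d κ,
      (∀ F : Sobolev d κ, 0 ≤ᵐ[volume] sobolevFn F →
        sobolevFn (hκ F) =ᵐ[volume] h (Mac.ofDensity (sobolevFn F) (integrable_sobolevFn F))) ∧
      DifferentiableOn ℝ hκ {F | 0 ≤ᵐ[volume] sobolevFn F}

/-- Assumptions on `g = g₁ + g₂`. -/
structure HypG {d : ℕ} (E : Set ℝ) (h : Mac d → C(Torus d, ℝ))
    (g g₁ g₂ : Torus d → ℝ → ℝ → ℝ) : Prop where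
  continuousOn : ContinuousOn (fun z : Torus d × ℝ × ℝ => g z.1 z.2.1 z.2.2) {z | z.2.1 ∈ E}
  measurable₁ : Measurable (fun z : Torus d × E × ℝ => g₁ z.1 z.2.1 z.2.2)
  measurable₂ : Measurable (fun z : Torus d × E × ℝ => g₂ z.1 z.2.1 z.2.2)
  sum : ∀ x, ∀ m ∈ E, ∀ θ, g x m θ = g₁ x m θ + g₂ x m θ
  nonneg : ∀ μ : Mac d, μ.ValuedIn E → ∀ᵐ x, 0 ≤ g₂ x (μ.dens x) (h μ x)
  bound₂ : ∃ c : ℝ, 0 < c ∧ ∀ μ : Mac d, μ.ValuedIn E →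
    ∫⁻ x, ENNReal.ofReal (g₂ x (μ.dens x) (h μ x)) ≤ ENNReal.ofReal (c * (1 + ∫ x, μ.dens x))
  upper : ∀ δ : ℝ, 0 < δ → ∃ C : ℝ, 0 < C ∧ ∀ μ : Mac d, μ.ValuedIn E →
    max (extIntegral fun x => g₁ x (μ.dens x) (h μ x)) ((∫ x, μ.dens x : ℝ) : EReal) ≤
      (δ : EReal) * (extIntegral fun x => μ.dens x * g₁ x (μ.dens x) (h μ x)) + (C : EReal)
  lower : ∃ R : ℝ, 0 ≤ R ∧ ∀ μ : Mac d, μ.ValuedIn E →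
    ((-R : ℝ) : EReal) ≤ extIntegral fun x => μ.dens x * g₁ x (μ.dens x) (h μ x)

/-- A bound on `∫ m_j g₁(x, m_j, h(m_j))` gives a subsequence of `(m_j)` converging weakly
in `L¹`. -/
def HypCompact {d : ℕ} (E : Set ℝ) (h : Mac d → C(Torus d, ℝ))
    (g₁ : Torus d → ℝ → ℝ → ℝ) : Prop :=
  ∀ μ : ℕ → Mac d, (∀ j, (μ j).ValuedIn E) →
    (∃ B : ℝ, ∀ j,
      (extIntegral fun x => (μ j).dens x * g₁ x ((μ j).dens x) (h (μ j) x)) ≤ (B : EReal)) →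
    ∃ s : ℕ → ℕ, StrictMono s ∧ ∃ m : Torus d → ℝ, Integrable m ∧
      ∀ f : Torus d → ℝ, Measurable f → (∃ K : ℝ, ∀ x, |f x| ≤ K) →
        Tendsto (fun j => ∫ x, (μ (s j)).dens x * f x) atTop (𝓝 (∫ x, m x * f x))

/-- Growth of the Hamiltonian, with exponent `γ`. The second pair of bounds is required for those
`(m, u)` for which its integrals are finite. -/
def HypGrowth {d : ℕ} (E : Set ℝ) (H : Hamiltonian d) (h : Mac d → C(Torus d, ℝ))
    (g : Torus d → ℝ → ℝ → ℝ) (γ : ℝ) : Prop :=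
  1 < γ ∧ ∃ τ C₁ C₂ C₃ C₄ : ℝ, 0 ≤ τ ∧ τ < 1 ∧ 0 < C₁ ∧ 0 < C₂ ∧ 0 < C₃ ∧ 0 < C₄ ∧
    (∀ x p M, ∀ m ∈ E, ∀ θ,
      1 / C₁ * (m ^ (-τ) * ‖p‖ ^ γ) + C₂ * g x m θ - C₁ ≤
        -H x p M m θ + ∑ i, DpH H i x p M m θ * p i + ∑ i, ∑ j, DMH H i j x p M m θ * M i j) ∧
    (∀ (μ : Mac d) (u : Torus d → ℝ) (Du : Torus d → EuclideanSpace ℝ (Fin d))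
      (D2u : Torus d → Mat d), μ.ValuedIn E → IsSobolevOne γ u Du →
      (∀ i j, Integrable (fun x => D2u x i j) ∧
        IsWeakDeriv [i] (fun x => Du x j) (fun x => D2u x i j)) →
      Integrable (fun x => g x (μ.dens x) (h μ x)) →
      Integrable (fun x => ‖Du x‖ ^ γ * μ.dens x ^ (-τ)) →
      Integrable (fun x => H x (Du x) (D2u x) (μ.dens x) (h μ x)) →
      -C₃ * (∫ x, g x (μ.dens x) (h μ x)) + 1 / C₁ * (∫ x, ‖Du x‖ ^ γ * μ.dens x ^ (-τ)) - C₁ ≤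
          ∫ x, H x (Du x) (D2u x) (μ.dens x) (h μ x) ∧
        ∫ x, H x (Du x) (D2u x) (μ.dens x) (h μ x) ≤
          -C₄ * (∫ x, g x (μ.dens x) (h μ x))
            + C₁ * (1 + ∫ x, ‖Du x‖ ^ γ * μ.dens x ^ (-τ)))

/-- `H` is of class `C^∞` on `𝕋^d × ℝ^d × ℝ^{d×d} × E × ℝ`. -/
def HypSmooth {d : ℕ} (E : Set ℝ) (H : Hamiltonian d) : Prop :=
  ContDiffOn ℝ ∞
    (fun z : (Fin d → ℝ) × EuclideanSpace ℝ (Fin d) × Mat d × ℝ × ℝ =>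
      H (proj z.1) z.2.1 z.2.2.1 z.2.2.2.1 z.2.2.2.2)
    {z | z.2.2.2.1 ∈ E}

/-- `A` is monotone with respect to the inner product of `L² × L²`. -/
def HypMonotone {d : ℕ} (E : Set ℝ) (H : Hamiltonian d) (h : Mac d → C(Torus d, ℝ)) : Prop :=
  ∀ η v η' v' : SmoothFun d, (∀ x, η x ∈ E) → (∀ x, η' x ∈ E) →
    0 ≤ (∫ x, (A₁ H h η v x - A₁ H h η' v' x) * (η x - η' x))
      + ∫ x, (A₂ H h η v x - A₂ H h η' v' x) * (v x - v' x)

end MFG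

end

/-!
If `η ≥ 0` is smooth then `h(η)` lies in every `W^{κ,2}`, hence is smooth by the decay of its
Fourier coefficients; so `A` acts on smooth pairs, and as `W^{κ,2}` embeds in `C⁰` it is continuous
along segments. On the convex hull of finitely many pairs, Minty's lemma turns the monotonicity
of `A` into solvability of the variational inequality. Taking among these pairs `(1, 0)`, `(2, 0)`
and `(1/2, 0)`, the growth conditions on `H` and `g` bound the energy `∫ m g₁`, the norm of `Du` in
`L^γ` and the mean of `u`.

The pairs are then taken from a countable family of smooth pairs, dense for the graph of `A` in
`C⁰`. The bounds give a weak `L¹` limit of the densities `m`, and a limit in `W^{1,γ}` of convex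
combinations of the `u`, which converge strongly in `L¹` by strict convexity of `∫ √(1 + f²)`.
The inequality `⟨z - (m, u), A z⟩ ≥ 0` is affine in `(m, u)` and survives the passage to the
limit; tested with `z = (1, c)` for arbitrary constants `c`, it forces `∫ m = 1`.
-/

noncomputable section

namespace MFG

/-! ### Calculus on the torus -/

instance : IsProbabilityMeasure (volume : Measure UnitAddCircle) :=
  ⟨by simp⟩

variable {d : ℕ} {γ : ℝ}

lemma proj_add (y z : Fin d → ℝ) : proj (y + z) = proj y + proj z := rfl

lemma proj_zero : proj (0 : Fin d → ℝ) = 0 := rfl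

lemma proj_single_one (i : Fin d) : proj (Pi.single i (1 : ℝ)) = 0 := by
  funext j
  obtain rfl | hj := eq_or_ne j i
  · simp [proj]
  · simp [proj, hj]

lemma continuous_proj : Continuous (proj (d := d)) := (isOpenQuotientMap_proj d).continuous

lemma proj_surjective : Function.Surjective (proj (d := d)) := (isOpenQuotientMap_proj d).surjective

lemma exists_proj_eq (x : Torus d) : ∃ t : Fin d → ℝ, (∀ i, |t i| ≤ 1) ∧ proj t = x := by
  refine ⟨fun i => (AddCircle.equivIco 1 0 (x i) : ℝ), fun i => ?_,
    funext fun i => AddCircle.coe_equivIco⟩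
  obtain ⟨h_nonneg, h_lt⟩ := (AddCircle.equivIco (1 : ℝ) 0 (x i)).2
  exact abs_le.2 ⟨by linarith, by linarith⟩

lemma integrable_of_continuous {X : Type*} [TopologicalSpace X] [CompactSpace X]
    [MeasurableSpace X] [OpensMeasurableSpace X] {μ : Measure X} [IsFiniteMeasureOnCompacts μ]
    {f : X → ℝ} (hf : Continuous f) : Integrable f μ :=
  hf.integrable_of_hasCompactSupport (HasCompactSupport.of_compactSpace _)

namespace SmoothFun

lemma continuous (f : SmoothFun d) : Continuous (f : Torus d → ℝ) := f.1.continuous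

lemma contDiff_lift (f : SmoothFun d) : ContDiff ℝ ∞ (fun y : Fin d → ℝ => f (proj y)) := f.2

lemma differentiable_lift (f : SmoothFun d) :
    Differentiable ℝ (fun y : Fin d → ℝ => f (proj y)) :=
  (contDiff_lift f).differentiable (by simp)

@[ext] lemma ext {f g : SmoothFun d} (h : ∀ x, f x = g x) : f = g :=
  Subtype.ext (ContinuousMap.ext h)

/-- The element of `C^∞(𝕋^d)` given by a function with smooth periodic lift. -/
def ofLift (f : Torus d → ℝ) (hf : ContDiff ℝ ∞ (fun y : Fin d → ℝ => f (proj y))) :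
    SmoothFun d :=
  ⟨⟨f, (isOpenQuotientMap_proj d).continuous_comp_iff.1 hf.continuous⟩, hf⟩

/-- Constants as elements of `C^∞(𝕋^d)`. -/
def const (d : ℕ) (c : ℝ) : SmoothFun d := ofLift (fun _ => c) contDiff_const

/-- Pointwise products in `C^∞(𝕋^d)`. -/
def mul (f g : SmoothFun d) : SmoothFun d :=
  ofLift (fun x => f x * g x) ((contDiff_lift f).mul (contDiff_lift g))

@[simp] lemma const_apply (c : ℝ) (x : Torus d) : const d c x = c := rfl

@[simp] lemma mul_apply (f g : SmoothFun d) (x : Torus d) : mul f g x = f x * g x := rfl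

@[simp] lemma add_apply (f g : SmoothFun d) (x : Torus d) : (f + g) x = f x + g x := rfl

@[simp] lemma sub_apply (f g : SmoothFun d) (x : Torus d) : (f - g) x = f x - g x := rfl

@[simp] lemma smul_apply (c : ℝ) (f : SmoothFun d) (x : Torus d) : (c • f) x = c * f x := rfl

lemma sum_apply {ι : Type*} (s : Finset ι) (f : ι → SmoothFun d) (x : Torus d) :
    (∑ i ∈ s, f i) x = ∑ i ∈ s, f i x := by
  change (∑ i ∈ s, f i).1 x = _
  simp

end SmoothFun

open SmoothFun

@[simp] lemma dpartial_apply (i : Fin d) (f : SmoothFun d) (x : Torus d) :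
    dpartial i f x = pderiv i f x := rfl

lemma dpartial_add (i : Fin d) (f g : SmoothFun d) :
    dpartial i (f + g) = dpartial i f + dpartial i g := by
  ext x
  obtain ⟨y, rfl⟩ := proj_surjective x
  simp only [add_apply, dpartial_apply, pderiv_proj]
  rw [fderiv_fun_add (differentiable_lift f y) (differentiable_lift g y)]
  rfl

lemma dpartial_smul (i : Fin d) (c : ℝ) (f : SmoothFun d) :
    dpartial i (c • f) = c • dpartial i f := by
  ext x
  obtain ⟨y, rfl⟩ := proj_surjective x
  simp only [smul_apply, dpartial_apply, pderiv_proj]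
  rw [fderiv_const_mul (differentiable_lift f y)]
  rfl

/-- The operator `dpartial i` as a linear map. -/
def dpartialₗ (i : Fin d) : SmoothFun d →ₗ[ℝ] SmoothFun d where
  toFun := dpartial i
  map_add' := dpartial_add i
  map_smul' := dpartial_smul i

lemma dpartial_mul (i : Fin d) (f g : SmoothFun d) :
    dpartial i (mul f g) = mul f (dpartial i g) + mul (dpartial i f) g := by
  ext x
  obtain ⟨y, rfl⟩ := proj_surjective x
  simp only [add_apply, mul_apply, dpartial_apply, pderiv_proj]
  rw [fderiv_fun_mul (differentiable_lift f y) (differentiable_lift g y)]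
  simp [mul_comm]

lemma dpartial_const (i : Fin d) (c : ℝ) : dpartial i (const d c) = 0 := by
  ext x
  simp [pderiv]

lemma dpartial_comm (i j : Fin d) (f : SmoothFun d) :
    dpartial i (dpartial j f) = dpartial j (dpartial i f) := by
  ext x
  obtain ⟨y, rfl⟩ := proj_surjective x
  have hf := contDiff_lift f
  have hdd : Differentiable ℝ (fderiv ℝ fun z : Fin d → ℝ => f (proj z)) :=
    (hf.fderiv_right (m := ∞) (by simp)).differentiable (by simp)
  have pderiv_pderiv : ∀ i j : Fin d, pderiv i (dpartial j f) (proj y) =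
      fderiv ℝ (fderiv ℝ fun z : Fin d → ℝ => f (proj z)) y (Pi.single i 1) (Pi.single j 1) := by
    intro i j
    rw [pderiv_proj]
    simp_rw [dpartial_apply, pderiv_proj]
    rw [fderiv_clm_apply (hdd y) (differentiableAt_const _)]
    simp
  have hsymm : IsSymmSndFDerivAt ℝ (fun z : Fin d → ℝ => f (proj z)) y :=
    hf.contDiffAt.isSymmSndFDerivAt
      (by simpa using WithTop.coe_le_coe.2 (le_top : (2 : ℕ∞) ≤ ⊤))
  rw [dpartial_apply, dpartial_apply, pderiv_pderiv, pderiv_pderiv]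
  exact hsymm _ _

lemma iterPartial_cons (i : Fin d) (l : List (Fin d)) (f : SmoothFun d) :
    iterPartial (i :: l) f = dpartial i (iterPartial l f) := rfl

lemma iterPartial_add (l : List (Fin d)) (f g : SmoothFun d) :
    iterPartial l (f + g) = iterPartial l f + iterPartial l g := by
  induction l with
  | nil => rfl
  | cons i l ih => simp only [iterPartial_cons, ih, dpartial_add]

lemma iterPartial_smul (l : List (Fin d)) (c : ℝ) (f : SmoothFun d) :
    iterPartial l (c • f) = c • iterPartial l f := by
  induction l with
  | nil => rfl
  | cons i l ih => simp only [iterPartial_cons, ih, dpartial_smul]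

lemma hasDerivAt_along (f : SmoothFun d) (x : Torus d) (t : Fin d → ℝ) (s : ℝ) :
    HasDerivAt (fun s : ℝ => f (x + proj (s • t)))
      (∑ i, t i * pderiv i f (x + proj (s • t))) s := by
  obtain ⟨y, rfl⟩ := proj_surjective x
  simp_rw [← proj_add, pderiv_proj]
  have hline : HasDerivAt (fun s : ℝ => y + s • t) t s := by
    simpa using ((hasDerivAt_id s).smul_const t).const_add y
  have apply_eq_sum (L : (Fin d → ℝ) →L[ℝ] ℝ) : L t = ∑ i, t i * L (Pi.single i 1) := by
    conv_lhs => rw [pi_eq_sum_univ' t]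
    simp [map_sum]
  rw [← apply_eq_sum]
  exact (differentiable_lift f (y + s • t)).hasFDerivAt.comp_hasDerivAt s hline

lemma continuous_comp_translate {f : Torus d → ℝ} (hf : Continuous f) (t : Fin d → ℝ) :
    Continuous (fun p : Torus d × ℝ => f (p.1 + proj (p.2 • t))) :=
  hf.comp (continuous_fst.add (continuous_proj.comp (continuous_snd.smul continuous_const)))

lemma continuous_comp_line {f : Torus d → ℝ} (hf : Continuous f) (x : Torus d) (t : Fin d → ℝ) :
    Continuous (fun s : ℝ => f (x + proj (s • t))) :=
  (continuous_comp_translate hf t).comp (Continuous.prodMk_right x)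

lemma continuous_sum_mul_pderiv (f : SmoothFun d) (t : Fin d → ℝ) :
    Continuous fun x => ∑ i, t i * pderiv i f x :=
  continuous_finsetSum _ fun i _ => continuous_const.mul (SmoothFun.continuous (dpartial i f))

lemma sub_eq_integral_along (f : SmoothFun d) (x : Torus d) (t : Fin d → ℝ) :
    f (x + proj t) - f x = ∫ s in (0 : ℝ)..1, ∑ i, t i * pderiv i f (x + proj (s • t)) := by
  rw [intervalIntegral.integral_eq_sub_of_hasDerivAt (fun s _ => hasDerivAt_along f x t s)
    ((continuous_comp_line (continuous_sum_mul_pderiv f t) x t).intervalIntegrable _ _)]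
  simp [proj_zero]

lemma integral_intervalIntegral_translate {G : Torus d → ℝ} (hG : Continuous G) (t : Fin d → ℝ) :
    ∫ x, ∫ s in (0 : ℝ)..1, G (x + proj (s • t)) = ∫ x, G x := by
  have : IsFiniteMeasure ((volume : Measure ℝ).restrict (uIoc 0 1)) := ⟨by simp [uIoc_of_le]⟩
  obtain ⟨K, hK⟩ := isCompact_univ.exists_bound_of_continuousOn hG.continuousOn
  have hint : Integrable (fun p : ℝ × Torus d => G (p.2 + proj (p.1 • t)))
      ((volume.restrict (uIoc 0 1)).prod volume) :=
    .of_bound ((continuous_comp_translate hG t).comp continuous_swap).aestronglyMeasurable K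
      (.of_forall fun _ => hK _ (mem_univ _))
  rw [← intervalIntegral_integral_swap hint]
  simp_rw [integral_add_right_eq_self]
  simp

lemma integral_pderiv (i : Fin d) (f : SmoothFun d) : ∫ x, pderiv i f x = 0 := by
  have hloop : ∀ x, ∫ s in (0 : ℝ)..1, pderiv i f (x + proj (s • Pi.single i 1)) = 0 := by
    intro x
    have h := sub_eq_integral_along f x (Pi.single i 1)
    rw [proj_single_one, add_zero, sub_self] at h
    simpa [Pi.single_apply] using h.symm
  have htranslate := integral_intervalIntegral_translate (SmoothFun.continuous (dpartial i f))
    (Pi.single i 1)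
  simp only [dpartial_apply, hloop, integral_zero] at htranslate
  exact htranslate.symm

lemma integral_mul_pderiv (i : Fin d) (f g : SmoothFun d) :
    ∫ x, f x * pderiv i g x = - ∫ x, pderiv i f x * g x := by
  have h : ∫ x, dpartial i (mul f g) x = 0 := integral_pderiv i (mul f g)
  rw [dpartial_mul] at h
  exact eq_neg_of_add_eq_zero_left ((integral_add (integrable_smooth (mul f (dpartial i g)))
    (integrable_smooth (mul (dpartial i f) g))).symm.trans h)

lemma isWeakDeriv_smooth (l : List (Fin d)) (f : SmoothFun d) :
    IsWeakDeriv l f (iterPartial l.reverse f) := by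
  induction l generalizing f with
  | nil => intro φ; simp [iterPartial]
  | cons i l ih =>
    intro φ
    have hrev : iterPartial (i :: l).reverse f = iterPartial l.reverse (dpartial i f) := by
      simp [iterPartial, List.foldr_append]
    calc ∫ x, f x * iterPartial (i :: l) φ x
        = -∫ x, dpartial i f x * iterPartial l φ x := integral_mul_pderiv i f (iterPartial l φ)
      _ = _ := by rw [ih (dpartial i f) φ, hrev, List.length_cons, pow_succ]; ring

lemma continuous_grad (u : SmoothFun d) : Continuous (grad u) :=
  (PiLp.continuous_toLp 2 _).comp (continuous_pi fun i => SmoothFun.continuous (dpartial i u))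

lemma continuous_norm_grad_rpow (hγ : 0 ≤ γ) (u : SmoothFun d) :
    Continuous fun x => ‖grad u x‖ ^ γ :=
  (continuous_grad u).norm.rpow_const fun _ => Or.inr hγ

lemma continuous_hess (v : SmoothFun d) : Continuous (hess v) :=
  continuous_pi fun i => continuous_pi fun j =>
    SmoothFun.continuous (dpartial i (dpartial j v))

lemma abs_pderiv_le_norm_grad (i : Fin d) (u : SmoothFun d) (x : Torus d) :
    |pderiv i u x| ≤ ‖grad u x‖ :=
  PiLp.norm_apply_le (grad u x) i

lemma grad_add_smul (v δ : SmoothFun d) (t : ℝ) (x : Torus d) :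
    grad (v + t • δ) x = grad v x + t • grad δ x := by
  ext i
  exact congrArg (fun k : SmoothFun d => k x) ((dpartial_add i v (t • δ)).trans
    (congrArg (dpartial i v + ·) (dpartial_smul i t δ)))

lemma hess_add_smul (v δ : SmoothFun d) (t : ℝ) (x : Torus d) :
    hess (v + t • δ) x = hess v x + t • hess δ x := by
  funext i j
  have h : dpartial i (dpartial j (v + t • δ)) =
      dpartial i (dpartial j v) + t • dpartial i (dpartial j δ) := by
    simp only [dpartial_add, dpartial_smul]
  exact congrArg (fun k : SmoothFun d => k x) h

lemma grad_const (c : ℝ) : grad (const d c) = fun _ => 0 := by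
  funext x
  ext i
  exact congrArg (fun k : SmoothFun d => k x) (dpartial_const i c)

lemma hess_const (c : ℝ) : hess (const d c) = fun _ => 0 := by
  funext x i j
  have h : dpartial i (dpartial j (const d c)) = 0 := by
    rw [dpartial_const, show (0 : SmoothFun d) = const d 0 from rfl, dpartial_const]
    rfl
  exact congrArg (fun k : SmoothFun d => k x) h

/-! ### The Poincaré inequality -/

lemma convexOn_norm_rpow {F : Type*} [SeminormedAddCommGroup F] [NormedSpace ℝ F] (hγ : 1 ≤ γ) :
    ConvexOn ℝ univ (fun x : F => ‖x‖ ^ γ) := by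
  refine ⟨convex_univ, fun x _ y _ a b ha hb hab => ?_⟩
  have hnorm : ‖a • x + b • y‖ ≤ a • ‖x‖ + b • ‖y‖ :=
    (convexOn_norm convex_univ).2 (mem_univ x) (mem_univ y) ha hb hab
  exact (Real.rpow_le_rpow (norm_nonneg _) hnorm (by linarith)).trans
    ((convexOn_rpow hγ).2 (norm_nonneg x) (norm_nonneg y) ha hb hab)

lemma rpow_norm_integral_le {Ω F : Type*} [MeasurableSpace Ω] {μ : Measure Ω}
    [IsProbabilityMeasure μ] [NormedAddCommGroup F] [NormedSpace ℝ F] [CompleteSpace F]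
    (hγ : 1 ≤ γ) {f : Ω → F} (hf : Integrable f μ) (hf' : Integrable (fun x => ‖f x‖ ^ γ) μ) :
    ‖∫ x, f x ∂μ‖ ^ γ ≤ ∫ x, ‖f x‖ ^ γ ∂μ :=
  (convexOn_norm_rpow hγ).map_integral_le (g := fun x : F => ‖x‖ ^ γ)
    (continuous_norm.rpow_const fun _ => Or.inr (by linarith)).continuousOn isClosed_univ
    (Eventually.of_forall fun _ => mem_univ _) hf hf'

lemma abs_sum_mul_pderiv_le {t : Fin d → ℝ} (ht : ∀ i, |t i| ≤ 1) (u : SmoothFun d)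
    (x : Torus d) : |∑ i, t i * pderiv i u x| ≤ d * ‖grad u x‖ := by
  refine (Finset.abs_sum_le_sum_abs _ _).trans ?_
  have h : ∀ i ∈ Finset.univ, |t i * pderiv i u x| ≤ ‖grad u x‖ := fun i _ => by
    rw [abs_mul]
    exact (mul_le_of_le_one_left (abs_nonneg _) (ht i)).trans (abs_pderiv_le_norm_grad i u x)
  simpa using Finset.sum_le_card_nsmul _ _ _ h

lemma rpow_abs_translate_sub_le (hγ : 1 ≤ γ) {t : Fin d → ℝ} (ht : ∀ i, |t i| ≤ 1)
    (u : SmoothFun d) (x : Torus d) :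
    |u (x + proj t) - u x| ^ γ ≤
      ∫ s in (0 : ℝ)..1, (d : ℝ) ^ γ * ‖grad u (x + proj (s • t))‖ ^ γ := by
  have hγ0 : 0 ≤ γ := by linarith
  have : IsProbabilityMeasure ((volume : Measure ℝ).restrict (Ioc 0 1)) := ⟨by simp⟩
  have hc : Continuous fun s : ℝ => ∑ i, t i * pderiv i u (x + proj (s • t)) :=
    continuous_comp_line (continuous_sum_mul_pderiv u t) x t
  have hcγ : Continuous fun s : ℝ => |∑ i, t i * pderiv i u (x + proj (s • t))| ^ γ :=
    hc.abs.rpow_const fun _ => Or.inr hγ0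
  have hgrad : Continuous fun s : ℝ => (d : ℝ) ^ γ * ‖grad u (x + proj (s • t))‖ ^ γ :=
    continuous_const.mul (continuous_comp_line (continuous_norm_grad_rpow hγ0 u) x t)
  rw [sub_eq_integral_along]
  simp only [intervalIntegral.integral_of_le zero_le_one]
  refine (rpow_norm_integral_le hγ hc.integrableOn_Ioc hcγ.integrableOn_Ioc).trans
    (integral_mono hcγ.integrableOn_Ioc hgrad.integrableOn_Ioc fun s => ?_)
  rw [← Real.mul_rpow (Nat.cast_nonneg d) (norm_nonneg _)]
  exact Real.rpow_le_rpow (abs_nonneg _) (abs_sum_mul_pderiv_le ht u _) hγ0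

lemma integral_rpow_translate_sub_le (hγ : 1 ≤ γ) (u : SmoothFun d) (y : Torus d) :
    ∫ x, |u (x + y) - u x| ^ γ ≤ (d : ℝ) ^ γ * ∫ x, ‖grad u x‖ ^ γ := by
  obtain ⟨t, ht, rfl⟩ := exists_proj_eq y
  have hγ0 : 0 ≤ γ := by linarith
  have hG : Continuous (fun x => (d : ℝ) ^ γ * ‖grad u x‖ ^ γ) :=
    continuous_const.mul (continuous_norm_grad_rpow hγ0 u)
  have hu : Continuous fun x => |u (x + proj t) - u x| ^ γ :=
    (((u.1.continuous.comp (continuous_id.add continuous_const)).sub u.1.continuous).abs).rpow_const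
      fun _ => Or.inr hγ0
  calc ∫ x, |u (x + proj t) - u x| ^ γ
      ≤ ∫ x, ∫ s in (0 : ℝ)..1, (d : ℝ) ^ γ * ‖grad u (x + proj (s • t))‖ ^ γ :=
        integral_mono (integrable_of_continuous hu) (integrable_of_continuous
          (intervalIntegral.continuous_parametric_intervalIntegral_of_continuous'
            (continuous_comp_translate hG t) 0 1)) (rpow_abs_translate_sub_le hγ ht u)
    _ = (d : ℝ) ^ γ * ∫ x, ‖grad u x‖ ^ γ := by
        rw [integral_intervalIntegral_translate hG, integral_const_mul]

lemma rpow_abs_sub_mean_le (hγ : 1 ≤ γ) {u : Torus d → ℝ} (hu : Continuous u) (x : Torus d) :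
    |u x - ∫ y, u y| ^ γ ≤ ∫ y, |u (x + y) - u x| ^ γ := by
  have hshift : Continuous fun y => u (x + y) := hu.comp (continuous_const.add continuous_id)
  have hdiff : Continuous fun y => u (x + y) - u x := hshift.sub continuous_const
  have hmean : ∫ y, (u (x + y) - u x) = (∫ y, u y) - u x := by
    rw [integral_sub (integrable_of_continuous hshift) (integrable_const _),
      integral_add_left_eq_self u x, integral_const, probReal_univ, one_smul]
  rw [abs_sub_comm, ← hmean]
  exact rpow_norm_integral_le hγ (integrable_of_continuous hdiff)
    (integrable_of_continuous (hdiff.abs.rpow_const fun _ => Or.inr (by linarith)))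

lemma integral_rpow_sub_mean_le (hγ : 1 ≤ γ) (u : SmoothFun d) :
    ∫ x, |u x - ∫ y, u y| ^ γ ≤ (d : ℝ) ^ γ * ∫ x, ‖grad u x‖ ^ γ := by
  have hγ' : ∀ a : ℝ, a ≠ 0 ∨ 0 ≤ γ := fun _ => Or.inr (by linarith)
  have hu := u.1.continuous
  have hcont : Continuous (fun p : Torus d × Torus d => |u (p.1 + p.2) - u p.1| ^ γ) :=
    (((hu.comp (continuous_fst.add continuous_snd)).sub (hu.comp continuous_fst)).abs).rpow_const
      fun _ => hγ' _
  have hint : Integrable (fun p : Torus d × Torus d => |u (p.1 + p.2) - u p.1| ^ γ)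
      (volume.prod volume) :=
    hcont.integrable_of_hasCompactSupport (HasCompactSupport.of_compactSpace _)
  calc ∫ x, |u x - ∫ y, u y| ^ γ
      ≤ ∫ x, ∫ y, |u (x + y) - u x| ^ γ :=
        integral_mono (integrable_of_continuous ((hu.sub continuous_const).abs.rpow_const
          fun _ => hγ' _)) hint.integral_prod_left (rpow_abs_sub_mean_le hγ hu)
    _ = ∫ y, ∫ x, |u (x + y) - u x| ^ γ := integral_integral_swap hint
    _ ≤ ∫ _y : Torus d, (d : ℝ) ^ γ * ∫ x, ‖grad u x‖ ^ γ :=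
        integral_mono hint.integral_prod_right (integrable_const _)
          fun y => integral_rpow_translate_sub_le hγ u y
    _ = (d : ℝ) ^ γ * ∫ x, ‖grad u x‖ ^ γ := by simp

/-! ### Fourier series and the Sobolev embedding -/

open UnitAddTorus (mFourier mFourierCoeff)

/-- The linear form `y ↦ n · y` on `ℝ^d`, so that `mFourier n` lifts to `exp (2πi n · y)`. -/
def phase (n : Fin d → ℤ) : (Fin d → ℝ) →L[ℝ] ℝ :=
  ∑ i, (n i : ℝ) • ContinuousLinearMap.proj i

lemma phase_apply (n : Fin d → ℤ) (y : Fin d → ℝ) : phase n y = ∑ i, n i * y i := by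
  simp [phase]

lemma phase_single_one (n : Fin d → ℤ) (i : Fin d) : phase n (Pi.single i 1) = n i := by
  simp [phase_apply, Pi.single_apply]

lemma norm_phase_le (n : Fin d → ℤ) : ‖phase n‖ ≤ d * ‖n‖ := by
  refine ContinuousLinearMap.opNorm_le_bound _ (by positivity) fun y => ?_
  have hterm : ∀ i ∈ Finset.univ, ‖(n i : ℝ) * y i‖ ≤ ‖n‖ * ‖y‖ := fun i _ => by
    rw [norm_mul]
    exact mul_le_mul (norm_le_pi_norm n i) (norm_le_pi_norm y i) (norm_nonneg _) (norm_nonneg _)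
  rw [phase_apply]
  refine (norm_sum_le_of_le _ hterm).trans_eq ?_
  simp [mul_assoc]

lemma mFourier_proj (n : Fin d → ℤ) (y : Fin d → ℝ) :
    mFourier n (proj y) = Complex.exp (2 * Real.pi * Complex.I * phase n y) := by
  simp only [mFourier, ContinuousMap.coe_mk, proj, fourier_coe_apply, phase_apply]
  rw [← Complex.exp_sum]
  push_cast
  rw [Finset.mul_sum]
  exact congrArg _ (Finset.sum_congr rfl fun i _ => by ring)

lemma norm_mFourier_apply (n : Fin d → ℤ) (x : Torus d) : ‖mFourier n x‖ = 1 := by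
  obtain ⟨y, rfl⟩ := proj_surjective x
  simp [mFourier_proj, Complex.norm_exp]

lemma contDiff_mFourier_proj (n : Fin d → ℤ) :
    ContDiff ℝ ∞ (fun y : Fin d → ℝ => mFourier n (proj y)) := by
  simp_rw [mFourier_proj]
  exact (contDiff_const.mul (Complex.ofRealCLM.contDiff.comp (phase n).contDiff)).cexp

lemma fderiv_mFourier_proj_single (n : Fin d → ℤ) (y : Fin d → ℝ) (i : Fin d) :
    fderiv ℝ (fun y : Fin d → ℝ => mFourier n (proj y)) y (Pi.single i 1) =
      2 * Real.pi * n i * Complex.I * mFourier n (proj y) := by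
  have h : HasFDerivAt (fun y : Fin d → ℝ => 2 * Real.pi * Complex.I * (phase n y : ℂ))
      ((2 * Real.pi * Complex.I) • Complex.ofRealCLM.comp (phase n)) y :=
    (Complex.ofRealCLM.hasFDerivAt.comp y (phase n).hasFDerivAt).const_mul _
  simp_rw [mFourier_proj]
  rw [h.cexp.fderiv]
  simp [phase_single_one]
  ring

/-- The real trigonometric monomials of frequency `n`: the functions `Re (c exp (2πi n · x))`. -/
def wave (n : Fin d → ℤ) (c : ℂ) : SmoothFun d :=
  ofLift (fun x => (c * mFourier n x).re)
    (Complex.reCLM.contDiff.comp (contDiff_const.mul (contDiff_mFourier_proj n)))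

lemma wave_apply (n : Fin d → ℤ) (c : ℂ) (x : Torus d) : wave n c x = (c * mFourier n x).re := rfl

lemma dpartial_wave (n : Fin d → ℤ) (c : ℂ) (i : Fin d) :
    dpartial i (wave n c) = wave n (2 * Real.pi * n i * Complex.I * c) := by
  ext x
  obtain ⟨y, rfl⟩ := proj_surjective x
  have hdiff : DifferentiableAt ℝ (fun y : Fin d → ℝ => mFourier n (proj y)) y :=
    (contDiff_mFourier_proj n).differentiable (by simp) y
  rw [dpartial_apply, pderiv_proj, wave_apply]
  simp_rw [wave_apply]
  have h := (Complex.reCLM.hasFDerivAt.comp y (hdiff.hasFDerivAt.const_mul c)).fderiv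
  rw [show (fun z : Fin d → ℝ => (c * mFourier n (proj z)).re) =
    Complex.reCLM ∘ fun z : Fin d → ℝ => c * mFourier n (proj z) from rfl, h]
  simp only [ContinuousLinearMap.comp_apply, _root_.smul_apply, smul_eq_mul,
    fderiv_mFourier_proj_single, Complex.reCLM_apply]
  ring_nf

lemma iterPartial_replicate_wave (n : Fin d → ℤ) (c : ℂ) (i : Fin d) (k : ℕ) :
    iterPartial (List.replicate k i) (wave n c) =
      wave n ((2 * Real.pi * n i * Complex.I) ^ k * c) := by
  induction k with
  | zero => simp [iterPartial]
  | succ k ih =>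
    rw [List.replicate_succ, iterPartial_cons, ih, dpartial_wave]
    congr 1
    ring

lemma integrable_mul_mFourier {f : Torus d → ℝ} (hf : Integrable f) (n : Fin d → ℤ) :
    Integrable fun x => (f x : ℂ) * mFourier n x :=
  hf.ofReal.mul_bdd (mFourier n).continuous.aestronglyMeasurable
    (.of_forall fun x => (norm_mFourier_apply n x).le)

lemma integral_mul_wave {f : Torus d → ℝ} (hf : Integrable f) (n : Fin d → ℤ) (c : ℂ) :
    ∫ x, f x * wave n c x = (c * ∫ x, (f x : ℂ) * mFourier n x).re := by
  rw [← integral_const_mul]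
  refine Eq.trans ?_ (integral_re ((integrable_mul_mFourier hf n).const_mul c))
  exact integral_congr_ae (.of_forall fun x => by
    simp only [wave_apply]
    rw [mul_left_comm]
    exact (Complex.re_ofReal_mul _ _).symm)

lemma integral_mul_mFourier_of_isWeakDeriv {f w : Torus d → ℝ} {i : Fin d} {k : ℕ}
    (hf : Integrable f) (hw : Integrable w) (h : IsWeakDeriv (List.replicate k i) f w)
    (n : Fin d → ℤ) :
    (2 * Real.pi * n i * Complex.I) ^ k * ∫ x, (f x : ℂ) * mFourier n x =
      (-1) ^ k * ∫ x, (w x : ℂ) * mFourier n x := by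
  have hre (c : ℂ) : (c * ((2 * Real.pi * n i * Complex.I) ^ k * ∫ x, (f x : ℂ) * mFourier n x)).re
      = (c * ((-1) ^ k * ∫ x, (w x : ℂ) * mFourier n x)).re := by
    have hc := h (wave n c)
    rw [iterPartial_replicate_wave, integral_mul_wave hf, integral_mul_wave hw,
      List.length_replicate, ← Complex.re_ofReal_mul] at hc
    push_cast at hc
    rwa [mul_left_comm, ← mul_assoc, mul_left_comm c]
  exact Complex.ext (by simpa using hre 1) (by simpa using hre (-Complex.I))

/-- The Fourier coefficients of a real function on the torus. -/
def fcoeff (f : Torus d → ℝ) (n : Fin d → ℤ) : ℂ := ∫ x, (f x : ℂ) * mFourier (-n) x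

lemma norm_integral_mul_mFourier_le {f : Torus d → ℝ} (n : Fin d → ℤ) :
    ‖∫ x, (f x : ℂ) * mFourier n x‖ ≤ ∫ x, |f x| :=
  (norm_integral_le_integral_norm _).trans_eq (by simp [norm_mFourier_apply])

lemma norm_fcoeff_le {f : C(Torus d, ℝ)} {r : ℕ} {w : Fin d → Torus d → ℝ} {W : ℝ}
    (hw : ∀ i, Integrable (w i)) (h : ∀ i, IsWeakDeriv (List.replicate r i) f (w i))
    (hwW : ∀ i, ∫ x, |w i x| ≤ W) (hfW : ∫ x, |f x| ≤ W) (n : Fin d → ℤ) :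
    ‖fcoeff f n‖ ≤ W * (max 1 (‖n‖ ^ r))⁻¹ := by
  have hcoeff : ‖fcoeff f n‖ ≤ W := (norm_integral_mul_mFourier_le _).trans hfW
  rw [← div_eq_mul_inv, le_div_iff₀' (by positivity), max_mul_of_nonneg _ _ (norm_nonneg _)]
  refine max_le (by rwa [one_mul]) ?_
  rcases isEmpty_or_nonempty (Fin d) with _ | _
  · have hn : ‖n‖ ^ r ≤ 1 := pow_le_one₀ (norm_nonneg n) (by simp [Subsingleton.elim n 0])
    exact (mul_le_of_le_one_left (norm_nonneg _) hn).trans hcoeff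
  obtain ⟨i, hi⟩ := Finite.exists_max fun i => ‖n i‖
  have hn : ‖n‖ ≤ ‖(2 * Real.pi * (-n) i * Complex.I : ℂ)‖ := by
    have hni : ‖n‖ ≤ |(n i : ℝ)| := (pi_norm_le_iff_of_nonneg (norm_nonneg _)).2 hi
    have hpi : |(n i : ℝ)| ≤ 2 * Real.pi * |(n i : ℝ)| :=
      le_mul_of_one_le_left (abs_nonneg _) (by linarith [Real.pi_gt_three])
    simpa [abs_of_pos Real.pi_pos] using hni.trans hpi
  have hderiv := congrArg norm (integral_mul_mFourier_of_isWeakDeriv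
    (integrable_of_continuous f.continuous) (hw i) (h i) (-n))
  simp only [norm_mul, norm_pow, norm_neg, norm_one, one_pow, one_mul] at hderiv hn
  calc ‖n‖ ^ r * ‖fcoeff f n‖ ≤ _ := mul_le_mul_of_nonneg_right
        (pow_le_pow_left₀ (norm_nonneg n) hn r) (norm_nonneg _)
    _ = ‖∫ x, (w i x : ℂ) * mFourier (-n) x‖ := hderiv
    _ ≤ W := (norm_integral_mul_mFourier_le _).trans (hwW i)

lemma summable_inv_norm_pow {r : ℕ} (hr : d < r) :
    Summable fun n : Fin d → ℤ => (‖n‖ ^ r)⁻¹ := by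
  let b := Pi.basisFun ℝ (Fin d)
  let L := Submodule.span ℤ (Set.range b)
  have hrank : Module.finrank ℤ L = d := by
    simpa using Module.finrank_eq_card_basis (b.restrictScalars ℤ)
  have cast_mem (n : Fin d → ℤ) : (fun i => (n i : ℝ)) ∈ L := by
    have hsum : (fun i => (n i : ℝ)) = ∑ i, n i • b i := by
      funext j
      simp [b, Pi.single_apply]
    rw [hsum]
    exact Submodule.sum_mem _ fun i _ =>
      Submodule.smul_mem _ _ (Submodule.subset_span (mem_range_self i))
  let toLattice : (Fin d → ℤ) → L := fun n => ⟨_, cast_mem n⟩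
  have hinj : Function.Injective toLattice := fun n m h =>
    funext fun i => Int.cast_injective (congrFun (congrArg Subtype.val h) i)
  have hnorm (n : Fin d → ℤ) : ‖toLattice n‖ = ‖n‖ := by
    simp only [toLattice, Pi.norm_def, Submodule.coe_norm]
    rfl
  simpa only [Function.comp_def, hnorm, inv_pow] using
    (ZLattice.summable_norm_pow_inv L r (by rwa [hrank])).comp_injective hinj

lemma summable_inv_max_one_norm_pow {r : ℕ} (hr : d < r) :
    Summable fun n : Fin d → ℤ => (max 1 (‖n‖ ^ r))⁻¹ := by
  refine (summable_inv_norm_pow hr).of_norm_bounded_eventually ?_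
  filter_upwards [eventually_cofinite_ne (0 : Fin d → ℤ)] with n hn
  have : 0 < ‖n‖ := norm_pos_iff.2 hn
  rw [Real.norm_of_nonneg (by positivity)]
  gcongr
  exact le_max_right _ _

lemma hasSum_fcoeff {f : C(Torus d, ℝ)} (hs : Summable (fcoeff f)) (x : Torus d) :
    HasSum (fun n => fcoeff f n • mFourier n x) (f x : ℂ) := by
  have hvol : (volume : Measure UnitAddCircle) = AddCircle.haarAddCircle := by
    simp [AddCircle.volume_eq_smul_haarAddCircle]
  let fc : C(Torus d, ℂ) := ⟨fun x => (f x : ℂ), by fun_prop⟩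
  have hcoeff : mFourierCoeff fc = fcoeff f := by
    funext n
    simp only [fcoeff, volume_pi, hvol, mul_comm (Complex.ofReal _)]
    rfl
  have h := UnitAddTorus.hasSum_mFourier_series_apply_of_summable (f := fc) (by rwa [hcoeff]) x
  rwa [hcoeff] at h

/-- The Sobolev embedding `W^{r,1} ⊂ C⁰` for `r > d`, with only pure derivatives in the norm. -/
lemma exists_abs_le_of_isWeakDeriv {r : ℕ} (hr : d < r) :
    ∃ C : ℝ, 0 ≤ C ∧ ∀ (f : C(Torus d, ℝ)) (w : Fin d → Torus d → ℝ) (W : ℝ),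
      (∀ i, Integrable (w i)) → (∀ i, IsWeakDeriv (List.replicate r i) f (w i)) →
      (∀ i, ∫ x, |w i x| ≤ W) → (∫ x, |f x| ≤ W) → ∀ x, |f x| ≤ C * W := by
  have hweight := summable_inv_max_one_norm_pow hr
  refine ⟨∑' n : Fin d → ℤ, (max 1 (‖n‖ ^ r))⁻¹, tsum_nonneg fun n => by positivity,
    fun f w W hw h hwW hfW x => ?_⟩
  have hcoeff := norm_fcoeff_le hw h hwW hfW
  have hsum := hweight.mul_left W
  rw [← Real.norm_eq_abs, ← Complex.norm_real, mul_comm, ← tsum_mul_left,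
    ← (hasSum_fcoeff (.of_norm_bounded hsum hcoeff) x).tsum_eq]
  exact tsum_of_norm_bounded hsum.hasSum fun n => by
    rw [norm_smul, norm_mFourier_apply, mul_one]
    exact hcoeff n

lemma iteratedDeriv_cexp_mul_ofReal (j : ℕ) (c : ℂ) :
    iteratedDeriv j (fun t : ℝ => Complex.exp (c * t)) =
      fun t : ℝ => c ^ j * Complex.exp (c * t) := by
  induction j with
  | zero => simp
  | succ j ih =>
    rw [iteratedDeriv_succ, ih]
    funext t
    have h : HasDerivAt (fun t : ℝ => c * (t : ℂ)) c t := by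
      simpa using (Complex.ofRealCLM.hasDerivAt (x := t)).const_mul c
    rw [(h.cexp.const_mul (c ^ j)).deriv, pow_succ]
    ring

lemma norm_iteratedFDeriv_mFourier_le (n : Fin d → ℤ) (j : ℕ) (y : Fin d → ℝ) :
    ‖iteratedFDeriv ℝ j (fun y : Fin d → ℝ => mFourier n (proj y)) y‖ ≤
      (2 * Real.pi * d * ‖n‖) ^ j := by
  have hexp : ContDiff ℝ j (fun t : ℝ => Complex.exp (2 * Real.pi * Complex.I * t)) :=
    (contDiff_const.mul Complex.ofRealCLM.contDiff).cexp
  have hcomp : (fun y : Fin d → ℝ => mFourier n (proj y)) =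
      (fun t : ℝ => Complex.exp (2 * Real.pi * Complex.I * t)) ∘ phase n :=
    funext fun y => mFourier_proj n y
  rw [hcomp, ContinuousLinearMap.iteratedFDeriv_comp_right (phase n) hexp y le_rfl]
  calc _ ≤ ‖iteratedFDeriv ℝ j (fun t : ℝ => Complex.exp (2 * Real.pi * Complex.I * t))
            (phase n y)‖ * ∏ _ : Fin j, ‖phase n‖ :=
        ContinuousMultilinearMap.norm_compContinuousLinearMap_le _ _
    _ = (2 * Real.pi) ^ j * ‖phase n‖ ^ j := by
        rw [norm_iteratedFDeriv_eq_norm_iteratedDeriv, iteratedDeriv_cexp_mul_ofReal]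
        simp [Complex.norm_exp, abs_of_pos Real.pi_pos]
    _ ≤ (2 * Real.pi * d * ‖n‖) ^ j := by
        rw [← mul_pow, mul_assoc (2 * Real.pi)]
        exact pow_le_pow_left₀ (by positivity)
          (mul_le_mul_of_nonneg_left (norm_phase_le n) Real.two_pi_pos.le) j

lemma inv_max_one_pow_mul_pow_le {a : ℝ} (ha : 0 ≤ a) (j r : ℕ) :
    (max 1 (a ^ (j + r)))⁻¹ * a ^ j ≤ (max 1 (a ^ r))⁻¹ := by
  rw [inv_mul_le_iff₀ (by positivity), ← div_eq_mul_inv, le_div_iff₀ (by positivity)]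
  rcases le_total a 1 with ha1 | ha1
  · rw [max_eq_left (pow_le_one₀ ha ha1), mul_one]
    exact (pow_le_one₀ ha ha1).trans (le_max_left _ _)
  · rw [max_eq_right (one_le_pow₀ ha1), ← pow_add]
    exact le_max_right _ _

lemma contDiff_tsum_mFourier {a : (Fin d → ℤ) → ℂ} {W : ℕ → ℝ} (hW : ∀ r, 0 ≤ W r)
    (ha : ∀ r n, ‖a n‖ ≤ W r * (max 1 (‖n‖ ^ r))⁻¹) :
    ContDiff ℝ ∞ (fun y : Fin d → ℝ => ∑' n, a n • mFourier n (proj y)) := by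
  refine contDiff_tsum (N := ⊤)
    (v := fun j n => W (j + (d + 1)) * (2 * Real.pi * d) ^ j * (max 1 (‖n‖ ^ (d + 1)))⁻¹)
    (fun n => (contDiff_mFourier_proj n).const_smul _)
    (fun j _ => (summable_inv_max_one_norm_pow (Nat.lt_succ_self d)).mul_left _) ?_
  intro j n y _
  have hmode : ContDiff ℝ j fun y : Fin d → ℝ => mFourier n (proj y) :=
    (contDiff_mFourier_proj n).of_le (by exact_mod_cast le_top)
  rw [iteratedFDeriv_const_smul_apply' hmode.contDiffAt, norm_smul]
  calc ‖a n‖ * ‖iteratedFDeriv ℝ j (fun y => mFourier n (proj y)) y‖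
      ≤ (W (j + (d + 1)) * (max 1 (‖n‖ ^ (j + (d + 1))))⁻¹) * (2 * Real.pi * d * ‖n‖) ^ j :=
        mul_le_mul (ha _ n) (norm_iteratedFDeriv_mFourier_le n j y) (norm_nonneg _)
          ((norm_nonneg _).trans (ha _ n))
    _ = W (j + (d + 1)) * (2 * Real.pi * d) ^ j *
        ((max 1 (‖n‖ ^ (j + (d + 1))))⁻¹ * ‖n‖ ^ j) := by ring
    _ ≤ W (j + (d + 1)) * (2 * Real.pi * d) ^ j * (max 1 (‖n‖ ^ (d + 1)))⁻¹ :=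
        mul_le_mul_of_nonneg_left (inv_max_one_pow_mul_pow_le (norm_nonneg n) j (d + 1))
          (mul_nonneg (hW _) (by positivity))

lemma contDiff_of_isWeakDeriv {f : C(Torus d, ℝ)}
    (h : ∀ (k : ℕ) (i : Fin d), ∃ w : Torus d → ℝ, Integrable w ∧
      IsWeakDeriv (List.replicate k i) f w) :
    ContDiff ℝ ∞ (fun y : Fin d → ℝ => f (proj y)) := by
  choose w hw hweak using h
  let W (k : ℕ) : ℝ := (∑ i, ∫ x, |w k i x|) + ∫ x, |f x|
  have integral_abs_nonneg (u : Torus d → ℝ) : 0 ≤ ∫ x, |u x| :=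
    integral_nonneg fun x => abs_nonneg _
  have hsum (k : ℕ) : 0 ≤ ∑ i, ∫ x, |w k i x| :=
    Finset.sum_nonneg fun i _ => integral_abs_nonneg _
  have hdecay (k : ℕ) (n : Fin d → ℤ) : ‖fcoeff f n‖ ≤ W k * (max 1 (‖n‖ ^ k))⁻¹ :=
    norm_fcoeff_le (hw k) (hweak k)
      (fun i => (Finset.single_le_sum (fun i _ => integral_abs_nonneg (w k i))
        (Finset.mem_univ i)).trans (le_add_of_nonneg_right (integral_abs_nonneg f)))
      (le_add_of_nonneg_left (hsum k)) n
  have hsummable : Summable (fcoeff f) := .of_norm_bounded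
    ((summable_inv_max_one_norm_pow (Nat.lt_succ_self d)).mul_left _) (hdecay (d + 1))
  have hseries :=
    contDiff_tsum_mFourier (fun k => add_nonneg (hsum k) (integral_abs_nonneg f)) hdecay
  simp_rw [(hasSum_fcoeff hsummable _).tsum_eq] at hseries
  exact Complex.reCLM.contDiff.comp hseries

/-! ### The nonlocal operator on smooth densities -/

/-- A smooth function as an element of `L²`. -/
def smoothToLp (f : SmoothFun d) : Lp ℝ 2 (volume : Measure (Torus d)) :=
  ContinuousMap.toLp 2 volume ℝ f.1

lemma smoothToLp_ae (f : SmoothFun d) : smoothToLp f =ᵐ[volume] f :=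
  ContinuousMap.coeFn_toLp volume f.1

lemma iterPartial_sobolevIndexZero (κ : ℕ) (f : SmoothFun d) :
    iterPartial (List.ofFn (SobolevIndex.zero d κ).2).reverse f = f := by
  simp [SobolevIndex.zero, iterPartial]

/-- A smooth function, with its derivatives, as an element of `W^{κ,2}`. -/
def smoothToSobolev (κ : ℕ) : SmoothFun d →ₗ[ℝ] Sobolev d κ where
  toFun f := ⟨WithLp.toLp 2 fun a => smoothToLp (iterPartial (List.ofFn a.2).reverse f), by
    intro a φ
    have integral_toLp (g ψ : SmoothFun d) : ∫ x, smoothToLp g x * ψ x = ∫ x, g x * ψ x :=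
      integral_congr_ae ((smoothToLp_ae g).mul (ae_eq_refl _))
    simp only [iterPartial_sobolevIndexZero, integral_toLp]
    exact isWeakDeriv_smooth (List.ofFn a.2) f φ⟩
  map_add' f g := by
    apply Subtype.ext
    ext a : 1
    simp only [iterPartial_add]
    exact map_add (ContinuousMap.toLp 2 volume ℝ) _ _
  map_smul' c f := by
    apply Subtype.ext
    ext a : 1
    simp only [iterPartial_smul]
    exact map_smul (ContinuousMap.toLp 2 volume ℝ) _ _

lemma sobolevFn_smoothToSobolev (κ : ℕ) (f : SmoothFun d) :
    sobolevFn (smoothToSobolev κ f) =ᵐ[volume] f :=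
  (smoothToLp_ae (iterPartial (List.ofFn (SobolevIndex.zero d κ).2).reverse f)).trans
    (by rw [iterPartial_sobolevIndexZero])

lemma sobolevFn_sub {κ : ℕ} (F G : Sobolev d κ) :
    sobolevFn (F - G) =ᵐ[volume] fun x => sobolevFn F x - sobolevFn G x :=
  Lp.coeFn_sub (F.1 (SobolevIndex.zero d κ)) (G.1 (SobolevIndex.zero d κ))

lemma Mac.ofDensity_congr {f g : Torus d → ℝ} (hf : Integrable f) (hg : Integrable g)
    (hfg : f =ᵐ[volume] g) : Mac.ofDensity f hf = Mac.ofDensity g hg :=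
  Subtype.ext (withDensity_congr_ae (hfg.fun_comp ENNReal.ofReal))

lemma integral_abs_le_norm (f : Lp ℝ 2 (volume : Measure (Torus d))) : ∫ x, |f x| ≤ ‖f‖ := by
  have hf : Integrable f := (Lp.memLp f).integrable (by norm_num)
  calc ∫ x, |f x| = (eLpNorm f 1 volume).toReal := by
        rw [eLpNorm_one_eq_lintegral_enorm, ← integral_norm_eq_lintegral_enorm hf.1]
        simp only [Real.norm_eq_abs]
    _ ≤ (eLpNorm f 2 volume).toReal := ENNReal.toReal_mono (Lp.eLpNorm_ne_top f)
        (eLpNorm_le_eLpNorm_of_exponent_le (by norm_num) hf.1)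
    _ = ‖f‖ := (Lp.norm_def f).symm

lemma isWeakDeriv_of_sobolev {κ k : ℕ} (hk : k ≤ κ) (F : Sobolev d κ) {f : Torus d → ℝ}
    (hf : sobolevFn F =ᵐ[volume] f) (i : Fin d) :
    IsWeakDeriv (List.replicate k i) f (F.1 ⟨⟨k, by omega⟩, fun _ => i⟩) := by
  intro φ
  have h := F.2 ⟨⟨k, by omega⟩, fun _ => i⟩ φ
  rw [List.ofFn_const] at h
  rw [← h]
  exact integral_congr_ae (hf.symm.mul (ae_eq_refl _))

lemma contDiff_of_sobolev {f : C(Torus d, ℝ)}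
    (h : ∀ κ : ℕ, (d : ℝ) / 2 + 1 < κ → ∃ F : Sobolev d κ, sobolevFn F =ᵐ[volume] f) :
    ContDiff ℝ ∞ (fun y : Fin d → ℝ => f (proj y)) := by
  refine contDiff_of_isWeakDeriv fun k i => ?_
  obtain ⟨F, hF⟩ := h (k + d + 2) (by
    push_cast
    linarith [Nat.cast_nonneg (α := ℝ) k, Nat.cast_nonneg (α := ℝ) d])
  exact ⟨_, (Lp.memLp _).integrable (by norm_num), isWeakDeriv_of_sobolev (by omega) F hF i⟩

lemma exists_abs_le_norm_sobolev {κ : ℕ} (hκ : d < κ) : ∃ C : ℝ, 0 ≤ C ∧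
    ∀ (F : Sobolev d κ) (f : C(Torus d, ℝ)), sobolevFn F =ᵐ[volume] f → ∀ x, |f x| ≤ C * ‖F‖ := by
  obtain ⟨C, hC, hbound⟩ := exists_abs_le_of_isWeakDeriv hκ
  refine ⟨C, hC, fun F f hF => hbound f (fun i => F.1 ⟨⟨κ, by omega⟩, fun _ => i⟩) ‖F‖
    (fun i => (Lp.memLp _).integrable (by norm_num)) (isWeakDeriv_of_sobolev le_rfl F hF)
    (fun i => (integral_abs_le_norm _).trans (PiLp.norm_apply_le F.1 _)) ?_⟩
  exact (integral_congr_ae (hF.fun_comp abs)).symm.trans_le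
    ((integral_abs_le_norm _).trans (PiLp.norm_apply_le F.1 _))

section Nonlocal

variable {h : Mac d → C(Torus d, ℝ)}

lemma nonlocal_ae {κ : ℕ} {hκ : Sobolev d κ → Sobolev d κ}
    (hh : ∀ F : Sobolev d κ, 0 ≤ᵐ[volume] sobolevFn F →
      sobolevFn (hκ F) =ᵐ[volume] h (Mac.ofDensity (sobolevFn F) (integrable_sobolevFn F)))
    {η : SmoothFun d} (hη : ∀ x, 0 ≤ η x) :
    sobolevFn (hκ (smoothToSobolev κ η)) =ᵐ[volume] h (smoothMeasure η) := by
  have hfn := sobolevFn_smoothToSobolev κ η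
  have h_ae := hh (smoothToSobolev κ η) (hfn.mono fun x hx => (hη x).trans_eq hx.symm)
  rwa [Mac.ofDensity_congr _ (integrable_smooth η) hfn] at h_ae

lemma contDiff_nonlocal (hyp : HypNonlocal h) {η : SmoothFun d} (hη : ∀ x, 0 ≤ η x) :
    ContDiff ℝ ∞ (fun y : Fin d → ℝ => h (smoothMeasure η) (proj y)) := by
  refine contDiff_of_sobolev fun κ hκ => ?_
  obtain ⟨k, hk, -⟩ := hyp κ hκ
  exact ⟨_, nonlocal_ae hk hη⟩

lemma continuous_nonlocal_segment (hyp : HypNonlocal h) (η δ : SmoothFun d) (S : Set ℝ)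
    (hS : ∀ t ∈ S, ∀ x, 0 ≤ (η + t • δ) x) :
    Continuous fun t : S => h (smoothMeasure (η + (t : ℝ) • δ)) := by
  obtain ⟨C, hC, hsup⟩ := exists_abs_le_norm_sobolev (show d < d + 2 by omega)
  obtain ⟨hκ, hk, hdiff⟩ := hyp (d + 2) (by push_cast; linarith [Nat.cast_nonneg (α := ℝ) d])
  let Φ (t : S) : Sobolev d (d + 2) := hκ (smoothToSobolev _ (η + (t : ℝ) • δ))
  have hΦ : Continuous Φ := by
    refine hdiff.continuousOn.comp_continuous ?_ fun t =>
      (sobolevFn_smoothToSobolev (d + 2) (η + (t : ℝ) • δ)).mono fun x hx =>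
        (hS t t.2 x).trans_eq hx.symm
    simp only [map_add, map_smul]
    exact continuous_const.add (continuous_subtype_val.smul continuous_const)
  have hdist (s t : S) : ‖h (smoothMeasure (η + (s : ℝ) • δ)) -
      h (smoothMeasure (η + (t : ℝ) • δ))‖ ≤ C * ‖Φ s - Φ t‖ := by
    rw [ContinuousMap.norm_le _ (by positivity)]
    refine hsup _ _ ?_
    filter_upwards [sobolevFn_sub (Φ s) (Φ t), nonlocal_ae hk (hS s s.2),
      nonlocal_ae hk (hS t t.2)] with x hsub hs ht
    rw [hsub, ContinuousMap.sub_apply, ← hs, ← ht]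
  refine continuous_iff_continuousAt.2 fun t => tendsto_iff_norm_sub_tendsto_zero.2 ?_
  have hlim : Tendsto (fun s => C * ‖Φ s - Φ t‖) (𝓝 t) (𝓝 0) := by
    simpa using (tendsto_iff_norm_sub_tendsto_zero.1 (hΦ.tendsto t)).const_mul C
  exact squeeze_zero (fun _ => norm_nonneg _) (fun s => hdist s t) hlim

end Nonlocal

/-! ### The operator on smooth functions -/

/-- The space of tuples `(y, p, M, m, θ)` on which a Hamiltonian is differentiated; the space
variable is lifted to `ℝ^d`. -/
abbrev JetSpace (d : ℕ) : Type :=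
  (Fin d → ℝ) × EuclideanSpace ℝ (Fin d) × Mat d × ℝ × ℝ

/-- A Hamiltonian as a function on `JetSpace d`. -/
def liftH (K : Hamiltonian d) (z : JetSpace d) : ℝ :=
  K (proj z.1) z.2.1 z.2.2.1 z.2.2.2.1 z.2.2.2.2

/-- The tuples `(y, p, M, m, θ)` with `m ∈ E`. -/
def jetDomain (d : ℕ) (E : Set ℝ) : Set (JetSpace d) := {z | z.2.2.2.1 ∈ E}

/-- The set `E` of admissible density values is one of the half-lines `(0, ∞)` and `[0, ∞)`. -/
def IsHalfLine (E : Set ℝ) : Prop := E = Ioi 0 ∨ E = Ici 0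

section HalfLine

variable {E : Set ℝ}

lemma IsHalfLine.convex (hE : IsHalfLine E) : Convex ℝ E := by
  rcases hE with rfl | rfl
  · exact convex_Ioi 0
  · exact convex_Ici 0

lemma IsHalfLine.Ioi_subset (hE : IsHalfLine E) : Ioi 0 ⊆ E := by
  rcases hE with rfl | rfl
  · exact Subset.rfl
  · exact Ioi_subset_Ici_self

lemma IsHalfLine.nonneg (hE : IsHalfLine E) {r : ℝ} (hr : r ∈ E) : 0 ≤ r := by
  rcases hE with rfl | rfl
  · exact le_of_lt hr
  · exact hr

lemma uniqueDiffOn_jetDomain (hE : IsHalfLine E) : UniqueDiffOn ℝ (jetDomain d E) := by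
  refine uniqueDiffOn_convex
    (fun z hz w hw a b ha hb hab => hE.convex hz hw ha hb hab) ⟨(0, 0, 0, 1, 0), ?_⟩
  have hopen : IsOpen {z : JetSpace d | z.2.2.2.1 ∈ Ioi (0 : ℝ)} :=
    isOpen_Ioi.preimage (by fun_prop)
  have hsub : {z : JetSpace d | z.2.2.2.1 ∈ Ioi (0 : ℝ)} ⊆ jetDomain d E :=
    fun z hz => hE.Ioi_subset hz
  exact interior_maximal hsub hopen (by simp)

end HalfLine

lemma fderiv_comp_of_forall_mem {V W G : Type*} [NormedAddCommGroup V] [NormedSpace ℝ V]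
    [NormedAddCommGroup W] [NormedSpace ℝ W] [NormedAddCommGroup G] [NormedSpace ℝ G]
    {f : W → G} {s : Set W} {φ : V → W} {L : V →L[ℝ] W} {q : V} (hf : DifferentiableOn ℝ f s)
    (hφ : HasFDerivAt φ L q) (hmem : ∀ q, φ q ∈ s) (e : V) :
    fderiv ℝ (f ∘ φ) q e = fderivWithin ℝ f s (φ q) (L e) := by
  rw [((hf _ (hmem q)).hasFDerivWithinAt.comp_hasFDerivAt q hφ (.of_forall hmem)).fderiv]
  rfl

section Smoothness

variable {E : Set ℝ} {K : Hamiltonian d}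

lemma HypSmooth.contDiffOn (hK : HypSmooth E K) : ContDiffOn ℝ ∞ (liftH K) (jetDomain d E) := hK

lemma HypSmooth.fderivWithin_apply (hE : IsHalfLine E) (hK : HypSmooth E K) (e : JetSpace d) :
    ContDiffOn ℝ ∞ (fun z => fderivWithin ℝ (liftH K) (jetDomain d E) z e) (jetDomain d E) :=
  (hK.contDiffOn.fderivWithin (uniqueDiffOn_jetDomain hE) (m := ∞) (by simp)).clm_apply
    contDiffOn_const

lemma HypSmooth.dpH (hE : IsHalfLine E) (hK : HypSmooth E K) (i : Fin d) :
    HypSmooth E (DpH K i) := by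
  refine (hK.fderivWithin_apply hE (0, EuclideanSpace.single i 1, 0, 0, 0)).congr fun z hz => ?_
  have hslice : HasFDerivAt (fun q => ((z.1, q, z.2.2) : JetSpace d))
      (.inr ℝ _ _ ∘L .inl ℝ _ _) z.2.1 :=
    (hasFDerivAt_prodMk_right z.1 (z.2.1, z.2.2)).comp z.2.1 (hasFDerivAt_prodMk_left z.2.1 z.2.2)
  exact fderiv_comp_of_forall_mem (hK.contDiffOn.differentiableOn (by simp)) hslice
    (fun _ => hz) (EuclideanSpace.single i 1)

lemma HypSmooth.dmH (hE : IsHalfLine E) (hK : HypSmooth E K) (i j : Fin d) :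
    HypSmooth E (DMH K i j) := by
  refine (hK.fderivWithin_apply hE (0, 0, Pi.single i (Pi.single j 1), 0, 0)).congr
    fun z hz => ?_
  have hslice : HasFDerivAt (fun N => ((z.1, z.2.1, N, z.2.2.2) : JetSpace d))
      (.inr ℝ _ _ ∘L .inr ℝ _ _ ∘L .inl ℝ _ _) z.2.2.1 :=
    (hasFDerivAt_prodMk_right z.1 z.2).comp z.2.2.1
      ((hasFDerivAt_prodMk_right z.2.1 z.2.2).comp z.2.2.1
        (hasFDerivAt_prodMk_left z.2.2.1 z.2.2.2))
  exact fderiv_comp_of_forall_mem (hK.contDiffOn.differentiableOn (by simp)) hslice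
    (fun _ => hz) (Pi.single i (Pi.single j 1))

lemma contDiff_grad (v : SmoothFun d) : ContDiff ℝ ∞ (fun y : Fin d → ℝ => grad v (proj y)) := by
  rw [contDiff_piLp]
  exact fun i => contDiff_pderiv i v

lemma contDiff_hess (v : SmoothFun d) : ContDiff ℝ ∞ (fun y : Fin d → ℝ => hess v (proj y)) :=
  contDiff_pi.2 fun i => contDiff_pi.2 fun j => contDiff_pderiv i (dpartial j v)

/-- The Hamiltonian `K` along the jet of `v`: the function `x ↦ K(x, Dv, D²v, η, θ)`. -/
def alongJet (K : Hamiltonian d) (η v : SmoothFun d) (θ : C(Torus d, ℝ)) (x : Torus d) : ℝ :=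
  K x (grad v x) (hess v x) (η x) (θ x)

lemma HypSmooth.contDiff_alongJet (hK : HypSmooth E K) {η v : SmoothFun d} {θ : C(Torus d, ℝ)}
    (hη : ∀ x, η x ∈ E) (hθ : ContDiff ℝ ∞ (fun y : Fin d → ℝ => θ (proj y))) :
    ContDiff ℝ ∞ (fun y : Fin d → ℝ => alongJet K η v θ (proj y)) :=
  hK.contDiffOn.comp_contDiff (f := fun y : Fin d → ℝ =>
      ((y, grad v (proj y), hess v (proj y), η (proj y), θ (proj y)) : JetSpace d))
    (contDiff_id.prodMk ((contDiff_grad v).prodMk ((contDiff_hess v).prodMk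
      ((contDiff_lift η).prodMk hθ)))) fun y => hη (proj y)

end Smoothness

/-- The integral over the torus, as a linear form on `C^∞(𝕋^d)`. -/
def integralₗ (d : ℕ) : SmoothFun d →ₗ[ℝ] ℝ where
  toFun f := ∫ x, f x
  map_add' f g := integral_add (integrable_smooth f) (integrable_smooth g)
  map_smul' c f := integral_const_mul c (f : Torus d → ℝ)

/-- The `L²` inner product `∫ φ a`, as a bilinear form on `C^∞(𝕋^d)`. -/
def pairing (d : ℕ) : SmoothFun d →ₗ[ℝ] SmoothFun d →ₗ[ℝ] ℝ :=
  LinearMap.mk₂ ℝ (fun φ a => integralₗ d (mul φ a))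
    (fun φ ψ a => by rw [← map_add]; congr 1; ext x; exact add_mul (φ x) (ψ x) (a x))
    (fun c φ a => by rw [← map_smul]; congr 1; ext x; exact mul_assoc c (φ x) (a x))
    (fun φ a b => by rw [← map_add]; congr 1; ext x; exact mul_add (φ x) (a x) (b x))
    (fun c φ a => by rw [← map_smul]; congr 1; ext x; exact mul_left_comm (φ x) c (a x))

lemma pairing_apply (φ a : SmoothFun d) : pairing d φ a = ∫ x, φ x * a x := rfl

lemma pairing_dpartial (i : Fin d) (ψ f : SmoothFun d) :
    pairing d ψ (dpartial i f) = -pairing d (dpartial i ψ) f :=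
  integral_mul_pderiv i ψ f

/-- The data for which the operator `A` maps smooth pairs `(η, v)`, with `η` valued in `E`, to
smooth pairs. -/
structure Regular (E : Set ℝ) (H : Hamiltonian d) (h : Mac d → C(Torus d, ℝ)) : Prop where
  half : IsHalfLine E
  smooth : HypSmooth E H
  nonlocal : HypNonlocal h

namespace Regular

variable {E : Set ℝ} {H K : Hamiltonian d} {h : Mac d → C(Torus d, ℝ)} {η η' : SmoothFun d}

/-- `K(x, Dv, D²v, η, h(η))` as a smooth function. -/
def jet (R : Regular E H h) (hK : HypSmooth E K) (hη : ∀ x, η x ∈ E) (v : SmoothFun d) :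
    SmoothFun d :=
  ofLift (alongJet K η v (h (smoothMeasure η)))
    (hK.contDiff_alongJet hη (contDiff_nonlocal R.nonlocal fun x => R.half.nonneg (hη x)))

lemma jet_apply (R : Regular E H h) (hK : HypSmooth E K) (hη : ∀ x, η x ∈ E) (v : SmoothFun d)
    (x : Torus d) : R.jet hK hη v x = K x (grad v x) (hess v x) (η x) (h (smoothMeasure η) x) :=
  rfl

/-- `A₁(η, v)` as a smooth function. -/
def smoothA₁ (R : Regular E H h) (hη : ∀ x, η x ∈ E) (v : SmoothFun d) : SmoothFun d :=
  -v - R.jet R.smooth hη v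

lemma smoothA₁_apply (R : Regular E H h) (hη : ∀ x, η x ∈ E) (v : SmoothFun d) (x : Torus d) :
    R.smoothA₁ hη v x = A₁ H h η v x := rfl

/-- The first-order flux `η D_{p_i}H`. -/
def fluxP (R : Regular E H h) (hη : ∀ x, η x ∈ E) (v : SmoothFun d) (i : Fin d) : SmoothFun d :=
  mul η (R.jet (R.smooth.dpH R.half i) hη v)

/-- The second-order flux `η D_{M_ij}H`. -/
def fluxM (R : Regular E H h) (hη : ∀ x, η x ∈ E) (v : SmoothFun d) (i j : Fin d) : SmoothFun d :=
  mul η (R.jet (R.smooth.dmH R.half i j) hη v)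

/-- `A₂(η, v)` as a smooth function. -/
def smoothA₂ (R : Regular E H h) (hη : ∀ x, η x ∈ E) (v : SmoothFun d) : SmoothFun d :=
  η - ∑ i, dpartial i (R.fluxP hη v i) + ∑ i, ∑ j, dpartial i (dpartial j (R.fluxM hη v i j))
    - const d 1

lemma smoothA₂_apply (R : Regular E H h) (hη : ∀ x, η x ∈ E) (v : SmoothFun d) (x : Torus d) :
    R.smoothA₂ hη v x = A₂ H h η v x := by
  simp only [smoothA₂, sub_apply, add_apply, sum_apply, const_apply, A₂]
  rfl

end Regular

/-- The integrand of the weak form of `⟨(φ, ψ), A(η, v)⟩`, in which the derivatives of the fluxes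
have been moved to `ψ`. -/
def weakIntegrand (H : Hamiltonian d) (h : Mac d → C(Torus d, ℝ)) (η v φ ψ : SmoothFun d)
    (x : Torus d) : ℝ :=
  φ x * (-v x - alongJet H η v (h (smoothMeasure η)) x) + ψ x * (η x - 1)
    + ∑ i, pderiv i ψ x * (η x * alongJet (DpH H i) η v (h (smoothMeasure η)) x)
    + ∑ i, ∑ j, hess ψ x i j * (η x * alongJet (DMH H i j) η v (h (smoothMeasure η)) x)

namespace Regular

variable {E : Set ℝ} {H K : Hamiltonian d} {h : Mac d → C(Torus d, ℝ)} {η η' : SmoothFun d}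

lemma pairing_smoothA₂ (R : Regular E H h) (hη : ∀ x, η x ∈ E) (v ψ : SmoothFun d) :
    pairing d ψ (R.smoothA₂ hη v) = pairing d ψ (η - const d 1)
      + ∑ i, pairing d (dpartial i ψ) (R.fluxP hη v i)
      + ∑ i, ∑ j, pairing d (dpartial i (dpartial j ψ)) (R.fluxM hη v i j) := by
  simp only [smoothA₂, map_add, map_sub, map_sum, pairing_dpartial, neg_neg,
    Finset.sum_neg_distrib, fun i j => dpartial_comm (d := d) j i ψ]
  ring

lemma integral_weakIntegrand (R : Regular E H h) (hη : ∀ x, η x ∈ E) (v φ ψ : SmoothFun d) :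
    ∫ x, weakIntegrand H h η v φ ψ x =
      pairing d φ (R.smoothA₁ hη v) + pairing d ψ (R.smoothA₂ hη v) := by
  calc ∫ x, weakIntegrand H h η v φ ψ x
      = integralₗ d (mul φ (R.smoothA₁ hη v) + mul ψ (η - const d 1)
          + ∑ i, mul (dpartial i ψ) (R.fluxP hη v i)
          + ∑ i, ∑ j, mul (dpartial i (dpartial j ψ)) (R.fluxM hη v i j)) := by
        refine integral_congr_ae (.of_forall fun x => ?_)
        simp only [add_apply, sum_apply]
        rfl
    _ = pairing d φ (R.smoothA₁ hη v) + pairing d ψ (R.smoothA₂ hη v) := by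
        simp only [map_add, map_sum, R.pairing_smoothA₂, ← add_assoc]
        rfl

lemma segment_mem (R : Regular E H h) (hη : ∀ x, η x ∈ E) (hη' : ∀ x, η' x ∈ E) {t : ℝ}
    (ht : t ∈ Icc (0 : ℝ) 1) (x : Torus d) : (η + t • (η' - η)) x ∈ E :=
  R.half.convex.add_smul_sub_mem (hη x) (hη' x) ht

lemma continuous_alongJet_segment (R : Regular E H h) (hK : HypSmooth E K) (hη : ∀ x, η x ∈ E)
    (hη' : ∀ x, η' x ∈ E) (v δ : SmoothFun d) :
    Continuous fun p : Icc (0 : ℝ) 1 × Torus d =>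
      alongJet K (η + (p.1 : ℝ) • (η' - η)) (v + (p.1 : ℝ) • δ)
        (h (smoothMeasure (η + (p.1 : ℝ) • (η' - η)))) p.2 := by
  rw [← (IsOpenQuotientMap.id.prodMap (isOpenQuotientMap_proj d)).continuous_comp_iff]
  have hproj : Continuous fun p : Icc (0 : ℝ) 1 × (Fin d → ℝ) => proj p.2 :=
    continuous_proj.comp continuous_snd
  have ht : Continuous fun p : Icc (0 : ℝ) 1 × (Fin d → ℝ) => (p.1 : ℝ) :=
    continuous_subtype_val.comp continuous_fst
  have hgrad : Continuous fun p : Icc (0 : ℝ) 1 × (Fin d → ℝ) =>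
      grad (v + (p.1 : ℝ) • δ) (proj p.2) := by
    simp_rw [grad_add_smul]
    exact ((continuous_grad v).comp hproj).add (ht.smul ((continuous_grad δ).comp hproj))
  have hhess : Continuous fun p : Icc (0 : ℝ) 1 × (Fin d → ℝ) =>
      hess (v + (p.1 : ℝ) • δ) (proj p.2) := by
    simp_rw [hess_add_smul]
    exact ((continuous_hess v).comp hproj).add (ht.smul ((continuous_hess δ).comp hproj))
  have hdens : Continuous fun p : Icc (0 : ℝ) 1 × (Fin d → ℝ) =>
      (η + (p.1 : ℝ) • (η' - η)) (proj p.2) :=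
    (η.1.continuous.comp hproj).add (ht.mul ((η' - η).1.continuous.comp hproj))
  have hnonlocal := (continuous_nonlocal_segment R.nonlocal η (η' - η) (Icc 0 1)
    fun t ht x => R.half.nonneg (R.segment_mem hη hη' ht x)).comp continuous_fst |>.eval hproj
  exact hK.contDiffOn.continuousOn.comp_continuous
    (continuous_snd.prodMk (hgrad.prodMk (hhess.prodMk (hdens.prodMk hnonlocal))))
    fun p => R.segment_mem hη hη' p.1.2 (proj p.2)

lemma continuous_integral_weakIntegrand (R : Regular E H h) (hη : ∀ x, η x ∈ E)
    (hη' : ∀ x, η' x ∈ E) (v δ φ ψ : SmoothFun d) :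
    Continuous fun t : Icc (0 : ℝ) 1 =>
      ∫ x, weakIntegrand H h (η + (t : ℝ) • (η' - η)) (v + (t : ℝ) • δ) φ ψ x := by
  have hsnd (f : SmoothFun d) : Continuous fun p : Icc (0 : ℝ) 1 × Torus d => f p.2 :=
    f.1.continuous.comp continuous_snd
  have hseg (f g : SmoothFun d) : Continuous fun p : Icc (0 : ℝ) 1 × Torus d =>
      (f + (p.1 : ℝ) • g) p.2 :=
    (hsnd f).add ((continuous_subtype_val.comp continuous_fst).mul (hsnd g))
  have hflux {K : Hamiltonian d} (hK : HypSmooth E K) :=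
    (hseg η (η' - η)).mul (R.continuous_alongJet_segment hK hη hη' v δ)
  have hcont : Continuous (Function.uncurry fun (t : Icc (0 : ℝ) 1) (x : Torus d) =>
      weakIntegrand H h (η + (t : ℝ) • (η' - η)) (v + (t : ℝ) • δ) φ ψ x) := by
    refine Continuous.add (Continuous.add (Continuous.add ?_ ?_) ?_) ?_
    · exact (hsnd φ).mul
        ((hseg v δ).neg.sub (R.continuous_alongJet_segment R.smooth hη hη' v δ))
    · exact (hsnd ψ).mul ((hseg η (η' - η)).sub continuous_const)
    · exact continuous_finsetSum _ fun i _ =>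
        (hsnd (dpartial i ψ)).mul (hflux (R.smooth.dpH R.half i))
    · exact continuous_finsetSum _ fun i _ => continuous_finsetSum _ fun j _ =>
        (hsnd (dpartial i (dpartial j ψ))).mul (hflux (R.smooth.dmH R.half i j))
  simpa only [Measure.restrict_univ] using
    continuous_parametric_integral_of_continuous (μ := (volume : Measure (Torus d))) hcont
      isCompact_univ

open Classical in
/-- `A(z)` as a linear form `w ↦ ⟨w, A(z)⟩`, set to zero when the density `z.1` takes values
outside `E`. -/
def op (R : Regular E H h) (z : SmoothFun d × SmoothFun d) : SmoothFun d × SmoothFun d →ₗ[ℝ] ℝ :=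
  if hz : ∀ x, z.1 x ∈ E then
    ((pairing d).flip (R.smoothA₁ hz z.2)).coprod ((pairing d).flip (R.smoothA₂ hz z.2))
  else 0

variable {z w : SmoothFun d × SmoothFun d}

lemma op_apply (R : Regular E H h) (hz : ∀ x, z.1 x ∈ E) (w : SmoothFun d × SmoothFun d) :
    R.op z w = pairing d w.1 (R.smoothA₁ hz z.2) + pairing d w.2 (R.smoothA₂ hz z.2) := by
  rw [op, dif_pos hz]
  rfl

lemma op_eq_integral_weakIntegrand (R : Regular E H h) (hz : ∀ x, z.1 x ∈ E)
    (w : SmoothFun d × SmoothFun d) :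
    R.op z w = ∫ x, weakIntegrand H h z.1 z.2 w.1 w.2 x := by
  rw [R.op_apply hz, R.integral_weakIntegrand hz]

lemma op_hemicontinuous (R : Regular E H h) (hz : ∀ x, z.1 x ∈ E) (hw : ∀ x, w.1 x ∈ E)
    (y : SmoothFun d × SmoothFun d) :
    Tendsto (fun t : ℝ => R.op (z + t • (w - z)) y) (𝓝[>] 0) (𝓝 (R.op z y)) := by
  have hcont : ContinuousOn (fun t : ℝ => R.op (z + t • (w - z)) y) (Icc 0 1) := by
    have hweak : ContinuousOn (fun t : ℝ => ∫ x, weakIntegrand H h (z.1 + t • (w.1 - z.1))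
        (z.2 + t • (w.2 - z.2)) y.1 y.2 x) (Icc 0 1) :=
      continuousOn_iff_continuous_domRestrict.2
        (R.continuous_integral_weakIntegrand hz hw z.2 (w.2 - z.2) y.1 y.2)
    exact hweak.congr fun t ht =>
      R.op_eq_integral_weakIntegrand (z := z + t • (w - z)) (R.segment_mem hz hw ht) y
  have hlim := hcont.continuousWithinAt (left_mem_Icc.2 zero_le_one)
  rw [ContinuousWithinAt, zero_smul, add_zero] at hlim
  exact hlim.mono_left ((nhdsWithin_Ioc_eq_nhdsGT (zero_lt_one' ℝ)).symm.trans_le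
    (nhdsWithin_mono _ Ioc_subset_Icc_self))

lemma op_monotone (R : Regular E H h) (hmono : HypMonotone E H h) (hz : ∀ x, z.1 x ∈ E)
    (hw : ∀ x, w.1 x ∈ E) : 0 ≤ R.op z (z - w) - R.op w (z - w) := by
  have integral_sub_mul (a b φ : SmoothFun d) :
      ∫ x, (a x - b x) * φ x = pairing d φ a - pairing d φ b := by
    simp_rw [← map_sub, pairing_apply, mul_comm (φ _), sub_apply]
  have h := hmono z.1 z.2 w.1 w.2 hz hw
  simp only [← R.smoothA₁_apply hz, ← R.smoothA₁_apply hw, ← R.smoothA₂_apply hz,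
    ← R.smoothA₂_apply hw, ← sub_apply z.1 w.1, ← sub_apply z.2 w.2, integral_sub_mul] at h
  rw [R.op_apply hz, R.op_apply hw, Prod.fst_sub, Prod.snd_sub]
  linarith

end Regular

/-! ### Monotone variational inequalities -/

lemma exists_mem_forall_nonneg {V : Type*} [NormedAddCommGroup V] [NormedSpace ℝ V]
    [FiniteDimensional ℝ V] {K : Set V} (hne : K.Nonempty) (hconv : Convex ℝ K)
    (hcomp : IsCompact K) (B : V →ₗ[ℝ] V →ₗ[ℝ] ℝ) (hB : ∀ c ∈ K, 0 ≤ B c c) :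
    ∃ c ∈ K, ∀ y ∈ K, 0 ≤ B y c := by
  have hcont (f : V →ₗ[ℝ] ℝ) : Continuous f := f.continuous_of_finiteDimensional
  obtain ⟨a, ha, b, hb, hsaddle⟩ := Sion.exists_isSaddlePointOn (f := fun y c => B y c)
    hne hconv hcomp
    (fun c _ => (hcont (B.flip c)).continuousOn.lowerSemicontinuousOn)
    (fun c _ => ((B.flip c).convexOn hconv).quasiconvexOn) hconv hne hcomp
    (fun y _ => (hcont (B y)).continuousOn.upperSemicontinuousOn)
    (fun y _ => ((B y).concaveOn hconv).quasiconcaveOn)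
  exact ⟨b, hb, fun y hy => (hB a ha).trans (hsaddle y hy a ha)⟩

lemma sum_mul_mul_nonneg {ι : Type*} [Fintype ι] {c : ι → ℝ} (hc : ∀ k, 0 ≤ c k)
    {a : ι → ι → ℝ} (ha : ∀ k l, 0 ≤ a k l + a l k) : 0 ≤ ∑ k, ∑ l, c k * c l * a k l := by
  have hswap : ∑ k, ∑ l, c k * c l * a k l = ∑ k, ∑ l, c k * c l * a l k := by
    rw [Finset.sum_comm]
    simp only [mul_comm]
  have hsymm : 0 ≤ ∑ k, ∑ l, c k * c l * (a k l + a l k) :=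
    Finset.sum_nonneg fun k _ => Finset.sum_nonneg fun l _ =>
      mul_nonneg (mul_nonneg (hc k) (hc l)) (ha k l)
  simp only [mul_add, Finset.sum_add_distrib, ← hswap] at hsymm
  linarith

section Minty

variable {ι X : Type*} [Finite ι] [AddCommGroup X] [Module ℝ X]

/-- Monotonicity on `K` of an operator from a vector space to its algebraic dual. -/
def IsMonotoneOn (A : X → X →ₗ[ℝ] ℝ) (K : Set X) : Prop :=
  ∀ x ∈ K, ∀ y ∈ K, 0 ≤ A x (x - y) - A y (x - y)

variable {A : X → X →ₗ[ℝ] ℝ} {w : ι → X}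

omit [Finite ι] in
lemma convexHull_range_eq_image_stdSimplex [Fintype ι] (w : ι → X) :
    convexHull ℝ (range w) = Fintype.linearCombination ℝ w '' stdSimplex ℝ ι := by
  classical
  rw [← convexHull_rangle_single_eq_stdSimplex, LinearMap.image_convexHull, ← Set.range_comp]
  congr 2
  funext k
  simp

lemma exists_minty_family [Nonempty ι] (hA : IsMonotoneOn A (range w)) :
    ∃ x ∈ convexHull ℝ (range w), ∀ k, 0 ≤ A (w k) (w k - x) := by
  classical
  have := Fintype.ofFinite ι
  let z := Fintype.linearCombination ℝ w
  let B : (ι → ℝ) →ₗ[ℝ] (ι → ℝ) →ₗ[ℝ] ℝ := ∑ k, (LinearMap.proj k).smulRight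
    ((∑ l, (LinearMap.proj l).smulRight (A (w k) (w k))) - (A (w k)) ∘ₗ z)
  have B_apply {y c : ι → ℝ} (hc : c ∈ stdSimplex ℝ ι) :
      B y c = ∑ k, y k * A (w k) (w k - z c) := by
    simp [B, ← Finset.sum_mul, hc.2]
  have hBnonneg : ∀ c ∈ stdSimplex ℝ ι, 0 ≤ B c c := by
    intro c hc
    have hexpand : B c c = ∑ k, ∑ l, c k * c l * A (w k) (w k - w l) := by
      rw [B_apply hc]
      refine Finset.sum_congr rfl fun k _ => ?_
      simp only [mul_assoc, ← Finset.mul_sum]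
      simp [z, Fintype.linearCombination_apply, mul_sub, ← Finset.sum_mul, hc.2]
    rw [hexpand]
    refine sum_mul_mul_nonneg hc.1 fun k l => ?_
    have hkl := hA _ (mem_range_self k) _ (mem_range_self l)
    rwa [← neg_sub (w k) (w l), map_neg, ← sub_eq_add_neg]
  obtain ⟨c, hc, hBc⟩ := exists_mem_forall_nonneg
    ⟨_, single_mem_stdSimplex ℝ (Classical.arbitrary ι)⟩ (convex_stdSimplex ℝ ι)
    (isCompact_stdSimplex ℝ ι) B hBnonneg
  refine ⟨z c, convexHull_range_eq_image_stdSimplex w ▸ mem_image_of_mem z hc, fun k => ?_⟩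
  have h := hBc _ (single_mem_stdSimplex ℝ k)
  rw [B_apply hc] at h
  simpa [Pi.single_apply] using h

/-- The conditions `0 ≤ A y (y - x)` are closed in `x`, so by compactness of the hull it suffices
to satisfy finitely many of them at a time. -/
lemma exists_minty [Nonempty ι] (hA : IsMonotoneOn A (convexHull ℝ (range w))) :
    ∃ x ∈ convexHull ℝ (range w), ∀ y ∈ convexHull ℝ (range w), 0 ≤ A y (y - x) := by
  classical
  have := Fintype.ofFinite ι
  set K := convexHull ℝ (range w)
  let z := Fintype.linearCombination ℝ w
  have hKz : K = z '' stdSimplex ℝ ι := convexHull_range_eq_image_stdSimplex w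
  have hclosed (y : K) : IsClosed {c : ι → ℝ | 0 ≤ A y (y - z c)} := by
    simp only [map_sub]
    exact isClosed_le continuous_const
      (continuous_const.sub (A y ∘ₗ z).continuous_of_finiteDimensional)
  obtain ⟨c, hc, hc'⟩ := (isCompact_stdSimplex ℝ ι).inter_iInter_nonempty
    (fun y : K => {c : ι → ℝ | 0 ≤ A y (y - z c)}) hclosed fun s => by
      rcases s.eq_empty_or_nonempty with rfl | hs
      · exact ⟨_, single_mem_stdSimplex ℝ (Classical.arbitrary ι), by simp⟩
      have : Nonempty s := hs.to_subtype
      have hsK : range (fun y : s => (y : X)) ⊆ K := by rintro _ ⟨y, rfl⟩; exact y.1.2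
      obtain ⟨x, hx, hxs⟩ := exists_minty_family (w := fun y : s => (y : X))
        fun x hx y hy => hA x (hsK hx) y (hsK hy)
      obtain ⟨c, hc, rfl⟩ := hKz.subset (convexHull_min hsK (convex_convexHull ℝ _) hx)
      exact ⟨c, hc, mem_iInter₂.2 fun y hy => hxs ⟨y, hy⟩⟩
  exact ⟨z c, hKz ▸ mem_image_of_mem z hc, fun y hy => mem_iInter.1 hc' ⟨y, hy⟩⟩

lemma exists_stampacchia [Nonempty ι] (hA : IsMonotoneOn A (convexHull ℝ (range w)))
    (hhemi : ∀ x ∈ convexHull ℝ (range w), ∀ y ∈ convexHull ℝ (range w),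
      Tendsto (fun t : ℝ => A (x + t • (y - x)) (y - x)) (𝓝[>] 0) (𝓝 (A x (y - x)))) :
    ∃ x ∈ convexHull ℝ (range w), ∀ y ∈ convexHull ℝ (range w), 0 ≤ A x (y - x) := by
  obtain ⟨x, hx, hminty⟩ := exists_minty hA
  refine ⟨x, hx, fun y hy => ge_of_tendsto (hhemi x hx y hy) ?_⟩
  filter_upwards [Ioo_mem_nhdsGT (zero_lt_one' ℝ)] with t ht
  have h := hminty _ ((convex_convexHull ℝ _).add_smul_sub_mem hx hy ⟨ht.1.le, ht.2.le⟩)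
  rw [add_sub_cancel_left, map_smul, smul_eq_mul] at h
  exact nonneg_of_mul_nonneg_right h ht.1

end Minty

namespace Regular

variable {E : Set ℝ} {H : Hamiltonian d} {h : Mac d → C(Torus d, ℝ)}

lemma convex_domain (R : Regular E H h) :
    Convex ℝ {z : SmoothFun d × SmoothFun d | ∀ x, z.1 x ∈ E} :=
  fun _ hz _ hw _ _ ha hb hab x => R.half.convex (hz x) (hw x) ha hb hab

lemma exists_solution (R : Regular E H h) (hmono : HypMonotone E H h) {ι : Type*} [Finite ι]
    [Nonempty ι] {p : ι → SmoothFun d × SmoothFun d} (hp : ∀ k x, (p k).1 x ∈ E) :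
    ∃ z : SmoothFun d × SmoothFun d, (∀ x, z.1 x ∈ E) ∧ ∀ k, 0 ≤ R.op z (p k - z) ∧
      0 ≤ R.op (p k) (p k - z) := by
  have hK : convexHull ℝ (range p) ⊆ {z | ∀ x, z.1 x ∈ E} :=
    convexHull_min (range_subset_iff.2 hp) R.convex_domain
  obtain ⟨z, hz, hzp⟩ := exists_stampacchia (A := R.op) (w := p)
    (fun x hx y hy => R.op_monotone hmono (hK hx) (hK hy))
    (fun x hx y hy => R.op_hemicontinuous (hK hx) (hK hy) _)
  refine ⟨z, hK hz, fun k => ?_⟩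
  have hk := hzp (p k) (subset_convexHull ℝ _ (mem_range_self k))
  exact ⟨hk, by linarith [R.op_monotone hmono (hp k) (hK hz)]⟩

end Regular

/-! ### Strong convergence of convex combinations -/

/-- Deficit in the midpoint inequality of the strictly convex function `t ↦ √(1 + t²)`. -/
def midDeficit (a b : ℝ) : ℝ :=
  √(1 + a ^ 2) + √(1 + b ^ 2) - 2 * √(1 + (2⁻¹ * (a + b)) ^ 2)

section MidDeficit

variable {a b K ε : ℝ}

lemma midDeficit_mul (a b : ℝ) :
    midDeficit a b * (√(1 + a ^ 2) + √(1 + b ^ 2) + 2 * √(1 + (2⁻¹ * (a + b)) ^ 2))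
      = 2 * (√(1 + a ^ 2) * √(1 + b ^ 2) - (1 + a * b)) := by
  have hsq (t : ℝ) : √(1 + t ^ 2) ^ 2 = 1 + t ^ 2 := Real.sq_sqrt (by positivity)
  rw [midDeficit]
  linear_combination hsq a + hsq b - 4 * hsq (2⁻¹ * (a + b))

lemma abs_one_add_mul_le (a b : ℝ) : |1 + a * b| ≤ √(1 + a ^ 2) * √(1 + b ^ 2) := by
  rw [← Real.sqrt_mul (by positivity)]
  exact Real.abs_le_sqrt (by linarith [sq_nonneg (a - b)])

lemma midDeficit_nonneg (a b : ℝ) : 0 ≤ midDeficit a b := by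
  refine nonneg_of_mul_nonneg_left (b := √(1 + a ^ 2) + √(1 + b ^ 2)
    + 2 * √(1 + (2⁻¹ * (a + b)) ^ 2)) ?_ (by positivity)
  rw [midDeficit_mul]
  linarith [le_of_abs_le (abs_one_add_mul_le a b)]

lemma sq_sub_le_midDeficit (a b : ℝ) : (a - b) ^ 2 ≤
    2 * √(1 + a ^ 2) * √(1 + b ^ 2) * (√(1 + a ^ 2) + √(1 + b ^ 2)) * midDeficit a b := by
  set p := √(1 + a ^ 2)
  set q := √(1 + b ^ 2)
  set r := 2 * √(1 + (2⁻¹ * (a + b)) ^ 2)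
  have hp_sq : p ^ 2 = 1 + a ^ 2 := Real.sq_sqrt (by positivity)
  have hq_sq : q ^ 2 = 1 + b ^ 2 := Real.sq_sqrt (by positivity)
  have hmul : midDeficit a b * (p + q + r) = 2 * (p * q - (1 + a * b)) := midDeficit_mul a b
  have hle : 1 + a * b ≤ p * q := le_of_abs_le (abs_one_add_mul_le a b)
  have hr_le : r ≤ p + q := sub_nonneg.1 (midDeficit_nonneg a b)
  calc (a - b) ^ 2 = (p * q - (1 + a * b)) * (p * q + (1 + a * b)) := by
        linear_combination -q ^ 2 * hp_sq - (1 + a ^ 2) * hq_sq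
    _ ≤ (p * q - (1 + a * b)) * (p * q + p * q) := by gcongr
    _ = p * q * (p + q + r) * midDeficit a b := by linear_combination -(p * q) * hmul
    _ ≤ p * q * (p + q + (p + q)) * midDeficit a b := by
        have := midDeficit_nonneg a b
        gcongr
    _ = 2 * p * q * (p + q) * midDeficit a b := by ring

lemma sqrt_one_add_sq_le (t : ℝ) : √(1 + t ^ 2) ≤ 1 + |t| := by
  rw [Real.sqrt_le_left (by positivity)]
  nlinarith [sq_abs t, abs_nonneg t]

lemma abs_sub_le_of_abs_le (hε : 0 < ε) (ha : |a| ≤ K) (hb : |b| ≤ K) :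
    |a - b| ≤ ε + 4 * (1 + K) ^ 3 / ε * midDeficit a b := by
  have hD := midDeficit_nonneg a b
  have hK : 0 ≤ K := (abs_nonneg a).trans ha
  have hp : √(1 + a ^ 2) ≤ 1 + K := (sqrt_one_add_sq_le a).trans (by gcongr)
  have hq : √(1 + b ^ 2) ≤ 1 + K := (sqrt_one_add_sq_le b).trans (by gcongr)
  have hsq : (a - b) ^ 2 ≤ 4 * (1 + K) ^ 3 * midDeficit a b := calc
    (a - b) ^ 2
      ≤ 2 * √(1 + a ^ 2) * √(1 + b ^ 2) * (√(1 + a ^ 2) + √(1 + b ^ 2)) * midDeficit a b :=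
        sq_sub_le_midDeficit a b
    _ ≤ 2 * (1 + K) * (1 + K) * ((1 + K) + (1 + K)) * midDeficit a b := by gcongr
    _ = 4 * (1 + K) ^ 3 * midDeficit a b := by ring
  calc |a - b| ≤ ε + (a - b) ^ 2 / ε := by
        rw [← sub_le_iff_le_add', le_div_iff₀ hε, ← sq_abs (a - b)]
        nlinarith [sq_nonneg (|a - b| - ε), abs_nonneg (a - b)]
    _ ≤ ε + 4 * (1 + K) ^ 3 / ε * midDeficit a b := by
        rw [div_mul_eq_mul_div]
        gcongr

lemma le_rpow_mul_rpow {s : ℝ} (hγ : 1 ≤ γ) (hK : 0 < K) (hs : K ≤ s) :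
    s ≤ K ^ (1 - γ) * s ^ γ := calc
  s = s ^ (1 - γ) * s ^ γ := by rw [← Real.rpow_add (hK.trans_le hs)]; simp
  _ ≤ K ^ (1 - γ) * s ^ γ := by
    gcongr ?_ * _
    · exact Real.rpow_nonneg (hK.le.trans hs) _
    · exact Real.rpow_le_rpow_of_nonpos hK hs (by linarith)

lemma abs_sub_le_midDeficit (hγ : 1 ≤ γ) (hε : 0 < ε) (hK : 0 < K) (a b : ℝ) :
    |a - b| ≤ ε + 4 * (1 + K) ^ 3 / ε * midDeficit a b
      + 2 * K ^ (1 - γ) * (|a| ^ γ + |b| ^ γ) := by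
  have hD := midDeficit_nonneg a b
  have ha : 0 ≤ |a| ^ γ := by positivity
  have hb : 0 ≤ |b| ^ γ := by positivity
  rcases le_total (max |a| |b|) K with hle | hge
  · refine (abs_sub_le_of_abs_le hε ((le_max_left _ _).trans hle)
      ((le_max_right _ _).trans hle)).trans (le_add_of_nonneg_right (by positivity))
  · have hmax : max |a| |b| ^ γ ≤ |a| ^ γ + |b| ^ γ := by
      rcases max_choice |a| |b| with h | h <;> rw [h] <;> linarith
    calc |a - b| ≤ 2 * max |a| |b| := by
          linarith [abs_sub a b, le_max_left |a| |b|, le_max_right |a| |b|]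
      _ ≤ 2 * (K ^ (1 - γ) * max |a| |b| ^ γ) := by gcongr; exact le_rpow_mul_rpow hγ hK hge
      _ ≤ 2 * (K ^ (1 - γ) * (|a| ^ γ + |b| ^ γ)) := by gcongr
      _ = 2 * K ^ (1 - γ) * (|a| ^ γ + |b| ^ γ) := by ring
      _ ≤ _ := le_add_of_nonneg_left (by positivity)

end MidDeficit

section Energy

variable {X : Type*} [TopologicalSpace X]

lemma continuous_abs_rpow (hγ : 0 ≤ γ) (f : C(X, ℝ)) : Continuous fun x => |f x| ^ γ :=
  f.continuous.abs.rpow_const fun _ => Or.inr hγ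

lemma continuous_midDeficit (f g : C(X, ℝ)) : Continuous fun x => midDeficit (f x) (g x) := by
  unfold midDeficit
  fun_prop

variable [MeasurableSpace X] {μ : Measure X}

/-- The strictly convex functional `f ↦ ∫ √(1 + f²)`. -/
def sqrtEnergy (μ : Measure X) (f : C(X, ℝ)) : ℝ := ∫ x, √(1 + f x ^ 2) ∂μ

lemma sqrtEnergy_nonneg (f : C(X, ℝ)) : 0 ≤ sqrtEnergy μ f :=
  integral_nonneg fun _ => Real.sqrt_nonneg _

variable [CompactSpace X] [BorelSpace X] [IsProbabilityMeasure μ]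

lemma integrable_sqrt_one_add_sq (f : C(X, ℝ)) : Integrable (fun x => √(1 + f x ^ 2)) μ :=
  integrable_of_continuous (by fun_prop)

lemma integral_midDeficit (f g : C(X, ℝ)) : ∫ x, midDeficit (f x) (g x) ∂μ =
    sqrtEnergy μ f + sqrtEnergy μ g - 2 * sqrtEnergy μ ((2⁻¹ : ℝ) • (f + g)) := by
  have hf := integrable_sqrt_one_add_sq (μ := μ) f
  have hg := integrable_sqrt_one_add_sq (μ := μ) g
  have hmid := (integrable_sqrt_one_add_sq (μ := μ) ((2⁻¹ : ℝ) • (f + g))).const_mul 2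
  refine (integral_sub (hf.add hg) hmid).trans ?_
  rw [integral_const_mul]
  exact congrArg (· - _) (integral_add hf hg)

lemma sqrtEnergy_le {B : ℝ} (hγ : 1 ≤ γ) {f : C(X, ℝ)} (hf : ∫ x, |f x| ^ γ ∂μ ≤ B) :
    sqrtEnergy μ f ≤ 2 + B := by
  have hint : Integrable (fun x => |f x| ^ γ) μ :=
    integrable_of_continuous (continuous_abs_rpow (by linarith) f)
  have hpoint (t : ℝ) : √(1 + t ^ 2) ≤ 2 + |t| ^ γ := by
    have ht : |t| ≤ 1 + |t| ^ γ := by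
      rcases le_total |t| 1 with h | h
      · linarith [Real.rpow_nonneg (abs_nonneg t) γ]
      · linarith [Real.self_le_rpow_of_one_le h hγ]
    linarith [sqrt_one_add_sq_le t]
  calc sqrtEnergy μ f ≤ ∫ x, (2 + |f x| ^ γ) ∂μ :=
        integral_mono (integrable_sqrt_one_add_sq f) ((integrable_const _).add hint)
          fun x => hpoint _
    _ = 2 + ∫ x, |f x| ^ γ ∂μ := by rw [integral_add (integrable_const _) hint]; simp
    _ ≤ 2 + B := by gcongr

lemma integral_abs_sub_le_midDeficit {ε K B : ℝ} (hγ : 1 ≤ γ) (hε : 0 < ε) (hK : 0 < K)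
    {f g : C(X, ℝ)} (hf : ∫ x, |f x| ^ γ ∂μ ≤ B) (hg : ∫ x, |g x| ^ γ ∂μ ≤ B) :
    ∫ x, |f x - g x| ∂μ ≤
      ε + 4 * (1 + K) ^ 3 / ε * (∫ x, midDeficit (f x) (g x) ∂μ) + 4 * K ^ (1 - γ) * B := by
  have hint (u : C(X, ℝ)) : Integrable (fun x => |u x| ^ γ) μ :=
    integrable_of_continuous (continuous_abs_rpow (by linarith) u)
  have hsum : Integrable (fun x => |f x| ^ γ + |g x| ^ γ) μ := (hint f).add (hint g)
  have hdef := (integrable_of_continuous (μ := μ) (continuous_midDeficit f g)).const_mul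
    (4 * (1 + K) ^ 3 / ε)
  have hε_def : Integrable (fun x => ε + 4 * (1 + K) ^ 3 / ε * midDeficit (f x) (g x)) μ :=
    (integrable_const _).add hdef
  calc ∫ x, |f x - g x| ∂μ
      ≤ ∫ x, (ε + 4 * (1 + K) ^ 3 / ε * midDeficit (f x) (g x)
          + 2 * K ^ (1 - γ) * (|f x| ^ γ + |g x| ^ γ)) ∂μ :=
        integral_mono (integrable_of_continuous (by fun_prop)) (hε_def.add (hsum.const_mul _))
          fun x => abs_sub_le_midDeficit hγ hε hK (f x) (g x)
    _ = ε + 4 * (1 + K) ^ 3 / ε * (∫ x, midDeficit (f x) (g x) ∂μ)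
          + 2 * K ^ (1 - γ) * ((∫ x, |f x| ^ γ ∂μ) + ∫ x, |g x| ^ γ ∂μ) := by
        rw [integral_add hε_def (hsum.const_mul _), integral_add (integrable_const _) hdef,
          integral_const_mul, integral_const_mul, integral_add (hint f) (hint g)]
        simp
    _ ≤ ε + 4 * (1 + K) ^ 3 / ε * (∫ x, midDeficit (f x) (g x) ∂μ)
          + 2 * K ^ (1 - γ) * (B + B) := by gcongr
    _ = _ := by ring

lemma exists_integral_abs_sub_lt (hγ : 1 < γ) (B : ℝ) {ε : ℝ} (hε : 0 < ε) :
    ∃ δ > 0, ∀ f g : C(X, ℝ), ∫ x, |f x| ^ γ ∂μ ≤ B → ∫ x, |g x| ^ γ ∂μ ≤ B →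
      ∫ x, midDeficit (f x) (g x) ∂μ < δ → ∫ x, |f x - g x| ∂μ < ε := by
  have htail : Tendsto (fun K : ℝ => 4 * K ^ (1 - γ) * B) atTop (𝓝 0) := by
    have h := tendsto_rpow_neg_atTop (y := γ - 1) (by linarith)
    simpa using (h.const_mul 4).mul_const B
  obtain ⟨K, hK_tail, hK⟩ := ((htail.eventually (gt_mem_nhds (by positivity : 0 < ε / 3))).and
    (eventually_gt_atTop 0)).exists
  set c := 4 * (1 + K) ^ 3 / (ε / 3) with hc
  have hc_pos : 0 < c := by positivity
  refine ⟨ε / 3 / c, by positivity, fun f g hf hg hdef => ?_⟩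
  have hle := integral_abs_sub_le_midDeficit hγ.le (by positivity : 0 < ε / 3) hK hf hg
  rw [lt_div_iff₀ hc_pos, mul_comm] at hdef
  rw [← hc] at hle
  linarith

lemma exists_tendsto_integral_abs_sub {f : ℕ → C(X, ℝ)}
    (hf : ∀ ε > 0, ∃ N, ∀ n ≥ N, ∫ x, |f N x - f n x| ∂μ < ε) :
    ∃ F : X → ℝ, Integrable F μ ∧ Tendsto (fun n => ∫ x, |f n x - F x| ∂μ) atTop (𝓝 0) := by
  let T : C(X, ℝ) →L[ℝ] Lp ℝ 1 μ := ContinuousMap.toLp 1 μ ℝ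
  have hT (g : C(X, ℝ)) : T g =ᵐ[μ] g := ContinuousMap.coeFn_toLp μ g
  have hdist (g : C(X, ℝ)) (G : Lp ℝ 1 μ) : dist (T g) G = ∫ x, |g x - G x| ∂μ := by
    rw [dist_eq_norm, L1.norm_eq_integral_norm]
    refine integral_congr_ae ?_
    filter_upwards [Lp.coeFn_sub (T g) G, hT g] with x hsub hx
    rw [hsub, Pi.sub_apply, hx, Real.norm_eq_abs]
  have hcauchy : CauchySeq fun n => T (f n) := by
    refine Metric.cauchySeq_iff'.2 fun ε hε => (hf ε hε).imp fun N hN n hn => ?_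
    rw [dist_comm, hdist]
    refine (integral_congr_ae ?_).trans_lt (hN n hn)
    filter_upwards [hT (f n)] with x hx
    rw [hx]
  obtain ⟨G, hG⟩ := cauchySeq_tendsto_of_complete hcauchy
  refine ⟨G, L1.integrable_coeFn G, ?_⟩
  simpa only [hdist] using tendsto_iff_dist_tendsto_zero.1 hG

lemma memLp_of_tendsto_integral_abs_sub {B : ℝ} (hγ : 0 < γ) {f : ℕ → C(X, ℝ)} {F : X → ℝ}
    (hF : Integrable F μ) (hB : ∀ n, ∫ x, |f n x| ^ γ ∂μ ≤ B)
    (hlim : Tendsto (fun n => ∫ x, |f n x - F x| ∂μ) atTop (𝓝 0)) :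
    MemLp F (ENNReal.ofReal γ) μ := by
  have hf (n : ℕ) (p : ℝ≥0∞) : MemLp (f n) p μ :=
    (f n).continuous.memLp_of_hasCompactSupport (.of_compactSpace _)
  have hmeasure : TendstoInMeasure μ (fun n => f n) atTop F := by
    refine tendstoInMeasure_of_tendsto_eLpNorm one_ne_zero (fun n => (hf n 1).1) hF.1 ?_
    rw [← ENNReal.ofReal_zero]
    refine ((ENNReal.continuous_ofReal.tendsto _).comp hlim).congr fun n => ?_
    rw [eLpNorm_one_eq_lintegral_enorm, ← ofReal_integral_norm_eq_lintegral_enorm]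
    · rfl
    · exact (memLp_one_iff_integrable.1 (hf n 1)).sub hF
  refine ⟨hF.1, (eLpNorm_le_of_tendstoInMeasure (C := ENNReal.ofReal (B ^ γ⁻¹))
    (.of_forall fun n => ?_) hmeasure fun n => (hf n 1).1).trans_lt ENNReal.ofReal_lt_top⟩
  rw [(hf n _).eLpNorm_eq_integral_rpow_norm (by simpa using hγ) ENNReal.ofReal_ne_top,
    ENNReal.toReal_ofReal hγ.le]
  gcongr
  exact hB n

end Energy

lemma exists_convexHull_tail_midpoint_lt {V : Type*} [AddCommGroup V] [Module ℝ V] {J : V → ℝ}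
    {a b : ℝ} (hJ : ∀ v, a ≤ J v) {u : ℕ → V} (hu : ∀ n, J (u n) ≤ b) :
    ∃ w : ℕ → V, (∀ n, w n ∈ convexHull ℝ (u '' Ici n)) ∧
      ∀ ε > 0, ∃ N, ∀ n ≥ N, J (w N) + J (w n) - 2 * J ((2⁻¹ : ℝ) • (w N + w n)) < ε := by
  set K : ℕ → Set V := fun n => convexHull ℝ (u '' Ici n)
  have hK_anti : Antitone K := fun n m hnm => convexHull_mono (image_mono (Ici_subset_Ici.2 hnm))
  have huK (n : ℕ) : u n ∈ K n := subset_convexHull ℝ _ (mem_image_of_mem u self_mem_Ici)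
  have hbdd (n : ℕ) : BddBelow (J '' K n) := ⟨a, by rintro _ ⟨v, -, rfl⟩; exact hJ v⟩
  set j : ℕ → ℝ := fun n => sInf (J '' K n)
  have hj_le {n : ℕ} {v : V} (hv : v ∈ K n) : j n ≤ J v := csInf_le (hbdd n) (mem_image_of_mem J hv)
  have hj_mono : Monotone j := fun n m hnm =>
    csInf_le_csInf (hbdd n) ⟨_, mem_image_of_mem J (huK m)⟩ (image_mono (hK_anti hnm))
  have hj_bdd : BddAbove (range j) := ⟨b, by rintro _ ⟨n, rfl⟩; exact (hj_le (huK n)).trans (hu n)⟩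
  have hnear (n : ℕ) : ∃ v ∈ K n, J v < j n + 1 / ((n : ℝ) + 1) := by
    obtain ⟨_, ⟨v, hv, rfl⟩, hlt⟩ := Real.lt_sInf_add_pos (s := J '' K n)
      ⟨_, mem_image_of_mem J (huK n)⟩ (by positivity : (0 : ℝ) < 1 / ((n : ℝ) + 1))
    exact ⟨v, hv, hlt⟩
  choose w hwK hwJ using hnear
  refine ⟨w, hwK, fun ε hε => ?_⟩
  have hlim : Tendsto (fun n : ℕ => (⨆ k, j k) - j n + 2 * (1 / ((n : ℝ) + 1))) atTop (𝓝 0) := by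
    simpa using ((tendsto_atTop_ciSup hj_mono hj_bdd).const_sub (⨆ k, j k)).add
      (tendsto_one_div_add_atTop_nhds_zero_nat.const_mul 2)
  obtain ⟨N, hN⟩ := (hlim.eventually (gt_mem_nhds hε)).exists
  refine ⟨N, fun n hn => ?_⟩
  have hmid : (2⁻¹ : ℝ) • (w N + w n) ∈ K N := by
    rw [smul_add]
    exact convex_convexHull ℝ _ (hwK N) (hK_anti hn (hwK n)) (by norm_num) (by norm_num)
      (by norm_num)
  have hinv : 1 / ((n : ℝ) + 1) ≤ 1 / ((N : ℝ) + 1) := by gcongr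
  linarith [hj_le hmid, hwJ N, hwJ n, le_ciSup hj_bdd n]

lemma convex_setOf_integral_rpow_le {V X : Type*} [AddCommGroup V] [Module ℝ V]
    [TopologicalSpace X] [CompactSpace X] [MeasurableSpace X] [BorelSpace X] {μ : Measure X}
    [IsProbabilityMeasure μ] (T : V →ₗ[ℝ] C(X, ℝ)) (hγ : 1 ≤ γ) (B : ℝ) :
    Convex ℝ {v : V | ∫ x, |T v x| ^ γ ∂μ ≤ B} := by
  have hint (v : V) : Integrable (fun x => |T v x| ^ γ) μ :=
    integrable_of_continuous (continuous_abs_rpow (by linarith) (T v))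
  intro v hv w hw a b ha hb hab
  simp only [mem_ofPred_eq] at hv hw ⊢
  calc ∫ x, |T (a • v + b • w) x| ^ γ ∂μ
      ≤ ∫ x, (a * |T v x| ^ γ + b * |T w x| ^ γ) ∂μ := by
        refine integral_mono (hint _) (((hint v).const_mul a).add ((hint w).const_mul b))
          fun x => ?_
        simpa using (convexOn_norm_rpow (F := ℝ) hγ).2 (mem_univ (T v x)) (mem_univ (T w x))
          ha hb hab
    _ = a * (∫ x, |T v x| ^ γ ∂μ) + b * ∫ x, |T w x| ^ γ ∂μ := by
        rw [integral_add ((hint v).const_mul a) ((hint w).const_mul b), integral_const_mul,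
          integral_const_mul]
    _ ≤ a * B + b * B := by gcongr
    _ = B := by rw [← add_mul, hab, one_mul]

/-- Near-minimizers of a strictly convex energy over the convex hulls of the tails form a Cauchy
sequence in `L¹`, which replaces weak compactness of bounded sets in `L^γ`. -/
lemma exists_convexHull_tail_tendsto {V X ι : Type*} [AddCommGroup V] [Module ℝ V]
    [TopologicalSpace X] [CompactSpace X] [MeasurableSpace X] [BorelSpace X] {μ : Measure X}
    [IsProbabilityMeasure μ] [Finite ι] (T : ι → V →ₗ[ℝ] C(X, ℝ)) (hγ : 1 < γ) {B : ℝ} {u : ℕ → V}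
    (hB : ∀ i n, ∫ x, |T i (u n) x| ^ γ ∂μ ≤ B) :
    ∃ w : ℕ → V, (∀ n, w n ∈ convexHull ℝ (u '' Ici n)) ∧
      ∃ F : ι → X → ℝ, ∀ i, MemLp (F i) (ENNReal.ofReal γ) μ ∧
        Tendsto (fun n => ∫ x, |T i (w n) x - F i x| ∂μ) atTop (𝓝 0) := by
  have := Fintype.ofFinite ι
  let J : V → ℝ := fun v => ∑ i, sqrtEnergy μ (T i v)
  have hJ_mid (v w : V) : J v + J w - 2 * J ((2⁻¹ : ℝ) • (v + w))
      = ∑ i, ∫ x, midDeficit (T i v x) (T i w x) ∂μ := by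
    simp only [J, integral_midDeficit, map_add, map_smul, Finset.mul_sum,
      ← Finset.sum_add_distrib, ← Finset.sum_sub_distrib]
  obtain ⟨w, hw, hw_mid⟩ := exists_convexHull_tail_midpoint_lt (J := J) (a := 0) (u := u)
    (fun v => Finset.sum_nonneg fun i _ => sqrtEnergy_nonneg _)
    (fun n => Finset.sum_le_sum fun i _ => sqrtEnergy_le hγ.le (hB i n))
  have hwB (i : ι) (n : ℕ) : ∫ x, |T i (w n) x| ^ γ ∂μ ≤ B :=
    convexHull_min (by rintro _ ⟨k, -, rfl⟩; exact hB i k)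
      (convex_setOf_integral_rpow_le (T i) hγ.le B) (hw n)
  have hcauchy (i : ι) (ε : ℝ) (hε : ε > 0) :
      ∃ N, ∀ n ≥ N, ∫ x, |T i (w N) x - T i (w n) x| ∂μ < ε := by
    obtain ⟨δ, hδ, hsmall⟩ := exists_integral_abs_sub_lt (μ := μ) hγ B hε
    refine (hw_mid δ hδ).imp fun N hN n hn => hsmall _ _ (hwB i N) (hwB i n) ?_
    refine (Finset.single_le_sum (fun i _ => integral_nonneg fun x => midDeficit_nonneg _ _)
      (Finset.mem_univ i)).trans_lt ((hJ_mid _ _).symm.trans_lt (hN n hn))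
  choose F hF hlim using fun i => exists_tendsto_integral_abs_sub (hcauchy i)
  exact ⟨w, hw, F, fun i => ⟨memLp_of_tendsto_integral_abs_sub (by linarith) (hF i) (hwB i)
    (hlim i), hlim i⟩⟩

/-! ### A priori estimates -/

lemma Mac.dens_ofDensity {f : Torus d → ℝ} (hf : Integrable f) (hf₀ : 0 ≤ᵐ[volume] f) :
    (Mac.ofDensity f hf).dens =ᵐ[volume] f := by
  filter_upwards [Measure.rnDeriv_withDensity₀ volume hf.1.aemeasurable.ennreal_ofReal, hf₀]
    with x hx hx₀
  exact (congrArg ENNReal.toReal hx).trans (ENNReal.toReal_ofReal hx₀)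

section SmoothMeasure

variable {η : SmoothFun d}

lemma comp_dens_smoothMeasure (hη : ∀ x, 0 ≤ η x) {β : Type*} (F : Torus d → ℝ → β) :
    (fun x => F x ((smoothMeasure η).dens x)) =ᵐ[volume] fun x => F x (η x) :=
  (Mac.dens_ofDensity (integrable_smooth η) (.of_forall hη)).mono fun x hx => congrArg (F x) hx

lemma extIntegral_congr {f g : Torus d → ℝ} (hfg : f =ᵐ[volume] g) :
    extIntegral f = extIntegral g := by
  have hcongr (φ : ℝ → ℝ≥0∞) : ∫⁻ x, φ (f x) = ∫⁻ x, φ (g x) :=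
    lintegral_congr_ae (hfg.fun_comp φ)
  rw [extIntegral, extIntegral, hcongr ENNReal.ofReal, hcongr fun r => ENNReal.ofReal (-r)]

lemma extIntegral_eq_integral {f : Torus d → ℝ} (hf : Integrable f) :
    extIntegral f = ((∫ x, f x : ℝ) : EReal) := by
  have hneg : ∫⁻ x, ENNReal.ofReal (-f x) ≠ ⊤ := hf.neg.lintegral_lt_top.ne
  rw [integral_eq_lintegral_pos_part_sub_lintegral_neg_part hf, extIntegral, EReal.coe_sub,
    EReal.coe_ennreal_toReal hf.lintegral_lt_top.ne, EReal.coe_ennreal_toReal hneg]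

lemma extIntegral_smoothMeasure (hη : ∀ x, 0 ≤ η x) {F : Torus d → ℝ → ℝ}
    (hF : Integrable fun x => F x (η x)) :
    (extIntegral fun x => F x ((smoothMeasure η).dens x)) = ((∫ x, F x (η x) : ℝ) : EReal) :=
  (extIntegral_congr (comp_dens_smoothMeasure hη F)).trans (extIntegral_eq_integral hF)

lemma integral_smoothMeasure (hη : ∀ x, 0 ≤ η x) (F : Torus d → ℝ → ℝ) :
    ∫ x, F x ((smoothMeasure η).dens x) = ∫ x, F x (η x) :=
  integral_congr_ae (comp_dens_smoothMeasure hη F)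

lemma valuedIn_smoothMeasure {E : Set ℝ} (hE : IsHalfLine E) (hη : ∀ x, η x ∈ E) :
    (smoothMeasure η).ValuedIn E :=
  (comp_dens_smoothMeasure (fun x => hE.nonneg (hη x)) fun _ s => s ∈ E).mono
    fun x hx => hx.mpr (hη x)

end SmoothMeasure

lemma isSobolevOne_smooth (u : SmoothFun d) : IsSobolevOne γ u (grad u) where
  memLp := u.1.continuous.memLp_of_hasCompactSupport (.of_compactSpace _)
  memLp_grad i := (dpartial i u).1.continuous.memLp_of_hasCompactSupport (.of_compactSpace _)
  weak i := isWeakDeriv_smooth [i] u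

section Coupling

variable {E : Set ℝ} {H : Hamiltonian d} {h : Mac d → C(Torus d, ℝ)}
  {f g g₁ g₂ : Torus d → ℝ → ℝ → ℝ} {m : SmoothFun d}

/-- The function `x ↦ f(x, m, h(m))` of a coupling `f`. -/
def coupling (h : Mac d → C(Torus d, ℝ)) (f : Torus d → ℝ → ℝ → ℝ) (m : SmoothFun d)
    (x : Torus d) : ℝ :=
  f x (m x) (h (smoothMeasure m) x)

lemma integrable_mul_coupling (m : SmoothFun d) (hf : Integrable (coupling h f m)) :
    Integrable fun x => m x * coupling h f m x := by
  obtain ⟨K, hK⟩ := isCompact_univ.exists_bound_of_continuousOn m.1.continuous.continuousOn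
  exact hf.bdd_mul m.1.continuous.aestronglyMeasurable (.of_forall fun x => hK x (mem_univ x))

namespace HypG

lemma coupling_eq_add (hyp : HypG E h g g₁ g₂) (hm : ∀ x, m x ∈ E) (x : Torus d) :
    coupling h g m x = coupling h g₁ m x + coupling h g₂ m x :=
  hyp.sum x (m x) (hm x) _

lemma continuous_coupling (hyp : HypG E h g g₁ g₂) (hm : ∀ x, m x ∈ E) :
    Continuous (coupling h g m) :=
  hyp.continuousOn.comp_continuous
    (continuous_id.prodMk (m.1.continuous.prodMk (h (smoothMeasure m)).continuous)) hm

lemma coupling₂_nonneg (hyp : HypG E h g g₁ g₂) (hE : IsHalfLine E) (hm : ∀ x, m x ∈ E) :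
    0 ≤ᵐ[volume] coupling h g₂ m := by
  have hdens := comp_dens_smoothMeasure (fun x => hE.nonneg (hm x))
    fun x s => g₂ x s (h (smoothMeasure m) x)
  filter_upwards [hdens, hyp.nonneg _ (valuedIn_smoothMeasure hE hm)] with x hx hpos
  exact hpos.trans_eq hx

lemma exists_integral_coupling₂_le (hyp : HypG E h g g₁ g₂) (hE : IsHalfLine E) :
    ∃ c, 0 < c ∧ ∀ m : SmoothFun d, (∀ x, m x ∈ E) →
      Integrable (coupling h g₂ m) ∧ ∫ x, coupling h g₂ m x ≤ c * (1 + ∫ x, m x) := by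
  obtain ⟨c, hc, hbound⟩ := hyp.bound₂
  refine ⟨c, hc, fun m hm => ?_⟩
  have hm₀ (x) : 0 ≤ m x := hE.nonneg (hm x)
  have hnonneg := hyp.coupling₂_nonneg hE hm
  have hmeas : Measurable (coupling h g₂ m) := hyp.measurable₂.comp
    (f := fun x => ((x, ⟨m x, hm x⟩, h (smoothMeasure m) x) : Torus d × E × ℝ))
    (measurable_id.prodMk (m.1.continuous.measurable.subtype_mk.prodMk
      (h (smoothMeasure m)).continuous.measurable))
  have hlintegral :
      ∫⁻ x, ENNReal.ofReal (coupling h g₂ m x) ≤ ENNReal.ofReal (c * (1 + ∫ x, m x)) := by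
    have hle := hbound _ (valuedIn_smoothMeasure hE hm)
    rwa [integral_smoothMeasure hm₀ fun _ s => s, lintegral_congr_ae (comp_dens_smoothMeasure hm₀
      fun x s => ENNReal.ofReal (g₂ x s (h (smoothMeasure m) x)))] at hle
  refine ⟨⟨hmeas.aestronglyMeasurable, (hasFiniteIntegral_iff_ofReal hnonneg).2
    (hlintegral.trans_lt ENNReal.ofReal_lt_top)⟩, ?_⟩
  rw [integral_eq_lintegral_of_nonneg_ae hnonneg hmeas.aestronglyMeasurable]
  have hmass : 0 ≤ ∫ x, m x := integral_nonneg hm₀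
  exact ENNReal.toReal_le_of_le_ofReal (by positivity) hlintegral

lemma integrable_coupling₁ (hyp : HypG E h g g₁ g₂) (hE : IsHalfLine E) (hm : ∀ x, m x ∈ E) :
    Integrable (coupling h g₁ m) := by
  obtain ⟨c, -, hg₂⟩ := hyp.exists_integral_coupling₂_le hE
  refine ((integrable_of_continuous (hyp.continuous_coupling hm)).sub (hg₂ m hm).1).congr
    (.of_forall fun x => ?_)
  simp only [Pi.sub_apply, hyp.coupling_eq_add hm, add_sub_cancel_right]

lemma extIntegral_energy (hyp : HypG E h g g₁ g₂) (hE : IsHalfLine E) (hm : ∀ x, m x ∈ E) :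
    (extIntegral fun x => (smoothMeasure m).dens x *
      g₁ x ((smoothMeasure m).dens x) (h (smoothMeasure m) x)) =
        ((∫ x, m x * coupling h g₁ m x : ℝ) : EReal) :=
  extIntegral_smoothMeasure (fun x => hE.nonneg (hm x))
    (F := fun x s => s * g₁ x s (h (smoothMeasure m) x))
    (integrable_mul_coupling m (hyp.integrable_coupling₁ hE hm))

lemma exists_neg_le_energy (hyp : HypG E h g g₁ g₂) (hE : IsHalfLine E) :
    ∃ r, ∀ m : SmoothFun d, (∀ x, m x ∈ E) → -r ≤ ∫ x, m x * coupling h g₁ m x := by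
  obtain ⟨r, -, hlower⟩ := hyp.lower
  refine ⟨r, fun m hm => EReal.coe_le_coe_iff.1 ?_⟩
  exact (hlower _ (valuedIn_smoothMeasure hE hm)).trans_eq (hyp.extIntegral_energy hE hm)

lemma exists_le_energy (hyp : HypG E h g g₁ g₂) (hE : IsHalfLine E) {δ : ℝ} (hδ : 0 < δ) :
    ∃ C, ∀ m : SmoothFun d, (∀ x, m x ∈ E) →
      ∫ x, coupling h g₁ m x ≤ δ * (∫ x, m x * coupling h g₁ m x) + C ∧
        ∫ x, m x ≤ δ * (∫ x, m x * coupling h g₁ m x) + C := by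
  obtain ⟨C, -, hupper⟩ := hyp.upper δ hδ
  refine ⟨C, fun m hm => ?_⟩
  have hm₀ (x) : 0 ≤ m x := hE.nonneg (hm x)
  have hle := hupper _ (valuedIn_smoothMeasure hE hm)
  rwa [hyp.extIntegral_energy hE hm,
    extIntegral_smoothMeasure hm₀ (F := fun x s => g₁ x s (h (smoothMeasure m) x))
      (hyp.integrable_coupling₁ hE hm),
    integral_smoothMeasure hm₀ fun _ s => s, max_le_iff, ← EReal.coe_mul, ← EReal.coe_add,
    EReal.coe_le_coe_iff, EReal.coe_le_coe_iff] at hle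

lemma energy_le (hyp : HypG E h g g₁ g₂) (hE : IsHalfLine E) (hm : ∀ x, m x ∈ E) :
    ∫ x, m x * coupling h g₁ m x ≤ ∫ x, m x * coupling h g m x := by
  refine integral_mono_ae (integrable_mul_coupling m (hyp.integrable_coupling₁ hE hm))
    (integrable_mul_coupling m (integrable_of_continuous (hyp.continuous_coupling hm))) ?_
  filter_upwards [hyp.coupling₂_nonneg hE hm] with x hx
  rw [hyp.coupling_eq_add hm]
  exact mul_le_mul_of_nonneg_left (le_add_of_nonneg_right hx) (hE.nonneg (hm x))

lemma exists_integral_coupling_le (hyp : HypG E h g g₁ g₂) (hE : IsHalfLine E) {δ : ℝ}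
    (hδ : 0 < δ) :
    ∃ C, ∀ m : SmoothFun d, (∀ x, m x ∈ E) →
      ∫ x, coupling h g m x ≤ δ * (∫ x, m x * coupling h g₁ m x) + C ∧
        ∫ x, m x ≤ δ * (∫ x, m x * coupling h g₁ m x) + C := by
  obtain ⟨c, hc, hg₂⟩ := hyp.exists_integral_coupling₂_le hE
  obtain ⟨C, hC⟩ := hyp.exists_le_energy hE (δ := δ / (1 + c)) (by positivity)
  obtain ⟨C', hC'⟩ := hyp.exists_le_energy hE hδ
  refine ⟨max ((1 + c) * C + c) C', fun m hm => ⟨?_, ?_⟩⟩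
  · have hadd : ∫ x, coupling h g m x =
        (∫ x, coupling h g₁ m x) + ∫ x, coupling h g₂ m x := by
      simp_rw [hyp.coupling_eq_add hm]
      exact integral_add (hyp.integrable_coupling₁ hE hm) (hg₂ m hm).1
    calc ∫ x, coupling h g m x
        ≤ (∫ x, coupling h g₁ m x) + c * (1 + ∫ x, m x) :=
          hadd.trans_le (add_le_add_right (hg₂ m hm).2 _)
      _ ≤ (1 + c) * (δ / (1 + c) * (∫ x, m x * coupling h g₁ m x) + C) + c := by
          linarith [(hC m hm).1, mul_le_mul_of_nonneg_left (hC m hm).2 hc.le]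
      _ = δ * (∫ x, m x * coupling h g₁ m x) + ((1 + c) * C + c) := by field_simp; ring
      _ ≤ _ := by gcongr; exact le_max_left _ _
  · exact (hC' m hm).2.trans (by gcongr; exact le_max_right _ _)

end HypG

end Coupling

section Lagrangian

variable {E : Set ℝ} {H : Hamiltonian d} {h : Mac d → C(Torus d, ℝ)}
  {g : Torus d → ℝ → ℝ → ℝ} {m : SmoothFun d}

/-- The Lagrangian `-H + D_pH · p + D_MH : M`. -/
def lagrangian (H : Hamiltonian d) : Hamiltonian d := fun x p M m θ =>
  -H x p M m θ + ∑ i, DpH H i x p M m θ * p i + ∑ i, ∑ j, DMH H i j x p M m θ * M i j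

lemma HypSmooth.lagrangian (hE : IsHalfLine E) (hH : HypSmooth E H) :
    HypSmooth E (lagrangian H) := by
  have hp (i : Fin d) : ContDiff ℝ ∞ fun z : JetSpace d => z.2.1 i := by fun_prop
  have hM (i j : Fin d) : ContDiff ℝ ∞ fun z : JetSpace d => z.2.2.1 i j :=
    contDiff_pi.1 (contDiff_pi.1 (by fun_prop : ContDiff ℝ ∞ fun z : JetSpace d => z.2.2.1) i) j
  exact (hH.contDiffOn.neg.add <|
      .sum fun i _ => (hH.dpH hE i).contDiffOn.mul (hp i).contDiffOn).add
    (.sum fun i _ => .sum fun j _ => (hH.dmH hE i j).contDiffOn.mul (hM i j).contDiffOn)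

lemma Regular.continuous_alongJet {K : Hamiltonian d} (R : Regular E H h) (hK : HypSmooth E K)
    (hm : ∀ x, m x ∈ E) (u : SmoothFun d) :
    Continuous (alongJet K m u (h (smoothMeasure m))) :=
  (R.jet hK hm u).1.continuous

lemma weakIntegrand_const_sub (m u : SmoothFun d) (c : ℝ) (x : Torus d) :
    weakIntegrand H h m u (const d c - m) (-u) x =
      (1 - c) * u x - c * alongJet H m u (h (smoothMeasure m)) x
        - m x * alongJet (lagrangian H) m u (h (smoothMeasure m)) x := by
  have hneg (i : Fin d) (f : SmoothFun d) : dpartial i (-f) = -dpartial i f :=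
    (dpartialₗ i).map_neg f
  have hgrad (i : Fin d) : pderiv i (-u : SmoothFun d) x = -grad u x i :=
    congrArg (fun f : SmoothFun d => f x) (hneg i u)
  have hhess (i j : Fin d) : hess (-u : SmoothFun d) x i j = -hess u x i j :=
    congrArg (fun f : SmoothFun d => f x)
      ((congrArg (dpartial i) (hneg j u)).trans (hneg i (dpartial j u)))
  have hval : (-u : SmoothFun d) x = -u x := rfl
  simp only [weakIntegrand, hgrad, hhess, hval, SmoothFun.sub_apply, const_apply, alongJet,
    lagrangian, mul_add, Finset.mul_sum, neg_mul, Finset.sum_neg_distrib, mul_left_comm, mul_comm]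
  ring

/-- Testing with constants recovers the energy identity: `(c, 0) - (m, u)` has no derivatives of
its own, so `D_pH` and `D_MH` enter only through the Lagrangian. -/
lemma Regular.op_const_sub (R : Regular E H h) (hm : ∀ x, m x ∈ E) (u : SmoothFun d) (c : ℝ) :
    R.op (m, u) ((const d c, 0) - (m, u)) =
      (1 - c) * (∫ x, u x) - c * (∫ x, alongJet H m u (h (smoothMeasure m)) x)
        - ∫ x, m x * alongJet (lagrangian H) m u (h (smoothMeasure m)) x := by
  calc R.op (m, u) ((const d c, 0) - (m, u))
      = ∫ x, weakIntegrand H h m u (const d c - m) (-u) x := by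
        rw [R.op_eq_integral_weakIntegrand hm, Prod.fst_sub, Prod.snd_sub, zero_sub]
    _ = integralₗ d ((1 - c) • u - c • R.jet R.smooth hm u
          - mul m (R.jet (R.smooth.lagrangian R.half) hm u)) := by
        simp_rw [weakIntegrand_const_sub]
        rfl
    _ = _ := by
        simp only [map_sub, map_smul]
        rfl

end Lagrangian

section Growth

variable {E : Set ℝ} {H : Hamiltonian d} {h : Mac d → C(Torus d, ℝ)}
  {g g₁ g₂ : Torus d → ℝ → ℝ → ℝ} {m : SmoothFun d} {τ C₁ C₂ C₃ : ℝ}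

lemma one_le_rpow_neg_add {s : ℝ} (hs : 0 ≤ s) (hτ₀ : 0 ≤ τ) (hτ₁ : τ ≤ 1)
    (h : s ≠ 0 ∨ τ = 0) : 1 ≤ s ^ (-τ) + s * s ^ (-τ) := by
  rcases eq_or_ne τ 0 with rfl | hτ
  · simpa using hs
  have hpos : 0 < s := hs.lt_of_ne' (h.resolve_right hτ)
  rcases le_total s 1 with hs₁ | hs₁
  · exact (Real.one_le_rpow_of_pos_of_le_one_of_nonpos hpos hs₁ (neg_nonpos.2 hτ₀)).trans
      (le_add_of_nonneg_right (by positivity))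
  · have hmul : s * s ^ (-τ) = s ^ (1 - τ) := by
      rw [sub_eq_add_neg, Real.rpow_add hpos, Real.rpow_one]
    rw [hmul]
    exact (Real.one_le_rpow hs₁ (sub_nonneg.2 hτ₁)).trans
      (le_add_of_nonneg_left (by positivity))

lemma eq_zero_of_rpow_neg_le {f : ℝ → ℝ} (hτ : 0 ≤ τ) (hf : ContinuousWithinAt f (Ioi 0) 0)
    (hle : ∀ s, 0 < s → s ^ (-τ) ≤ f s) : τ = 0 := by
  by_contra hne
  have hinf : Tendsto (fun s : ℝ => s ^ (-τ)) (𝓝[>] 0) atTop := by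
    refine ((tendsto_rpow_atTop (hτ.lt_of_ne' hne)).comp tendsto_inv_nhdsGT_zero).congr' ?_
    filter_upwards [self_mem_nhdsWithin] with s hs
    rw [Function.comp_apply, Real.inv_rpow (le_of_lt hs), Real.rpow_neg (le_of_lt hs)]
  have hdom : ∀ᶠ s in 𝓝[>] (0 : ℝ), s ^ (-τ) ≤ f s := by
    filter_upwards [self_mem_nhdsWithin] with s hs using hle s hs
  exact not_tendsto_nhds_of_tendsto_atTop (tendsto_atTop_mono' _ hdom hinf) _ hf

-- At a unit momentum the Lagrangian, which is continuous up to `m = 0`, dominates `m ^ (-τ)`.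
lemma growth_exponent_eq_zero (hd : 0 < d) (hE : IsHalfLine E) (h₀ : (0 : ℝ) ∈ E)
    (hH : HypSmooth E H)
    (hg : ContinuousOn (fun z : Torus d × ℝ × ℝ => g z.1 z.2.1 z.2.2) {z | z.2.1 ∈ E})
    (hτ : 0 ≤ τ) (hC₁ : 0 < C₁)
    (hgrowth : ∀ x p M, ∀ m ∈ E, ∀ θ,
      1 / C₁ * (m ^ (-τ) * ‖p‖ ^ γ) + C₂ * g x m θ - C₁ ≤ lagrangian H x p M m θ) :
    τ = 0 := by
  let p : EuclideanSpace ℝ (Fin d) := EuclideanSpace.single ⟨0, hd⟩ 1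
  have hp : ‖p‖ = 1 := by simp [p]
  have hL : ContinuousOn (fun s => lagrangian H (proj 0) p 0 s 0) E :=
    (hH.lagrangian hE).contDiffOn.continuousOn.comp
      (f := fun s : ℝ => ((0, p, 0, s, 0) : JetSpace d)) (by fun_prop) fun _ hs => hs
  have hg' : ContinuousOn (fun s => g (proj 0) s 0) E :=
    hg.comp (f := fun s : ℝ => ((proj 0, s, 0) : Torus d × ℝ × ℝ)) (by fun_prop) fun _ hs => hs
  have hf : ContinuousOn
      (fun s => C₁ * (lagrangian H (proj 0) p 0 s 0 - C₂ * g (proj 0) s 0 + C₁)) E := by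
    fun_prop
  refine eq_zero_of_rpow_neg_le hτ ((hf 0 h₀).mono hE.Ioi_subset) fun s hs => ?_
  have hle := hgrowth (proj 0) p 0 s (hE.Ioi_subset hs) 0
  rw [hp, Real.one_rpow, mul_one, one_div_mul_eq_div] at hle
  rw [← div_le_iff₀' hC₁]
  linarith

lemma integral_norm_grad_rpow_le (hγ : 0 ≤ γ) (hτ₀ : 0 ≤ τ) (hτ₁ : τ ≤ 1) (hm : ∀ x, 0 ≤ m x)
    (hmτ : Continuous fun x => m x ^ (-τ)) (hτm : ∀ x, m x ≠ 0 ∨ τ = 0) (u : SmoothFun d) :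
    ∫ x, ‖grad u x‖ ^ γ ≤ (∫ x, ‖grad u x‖ ^ γ * m x ^ (-τ)) +
      ∫ x, m x * (m x ^ (-τ) * ‖grad u x‖ ^ γ) := by
  have hD := continuous_norm_grad_rpow hγ u
  have hD₁ := integrable_of_continuous (μ := volume) (hD.mul hmτ)
  have hD₂ := integrable_of_continuous (μ := volume) (m.1.continuous.mul (hmτ.mul hD))
  refine (integral_mono (integrable_of_continuous hD) (hD₁.add hD₂) fun x => ?_).trans_eq
    (integral_add hD₁ hD₂)
  calc ‖grad u x‖ ^ γ ≤ ‖grad u x‖ ^ γ * (m x ^ (-τ) + m x * m x ^ (-τ)) :=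
        le_mul_of_one_le_right (by positivity) (one_le_rpow_neg_add (hm x) hτ₀ hτ₁ (hτm x))
    _ = ‖grad u x‖ ^ γ * m x ^ (-τ) + m x * (m x ^ (-τ) * ‖grad u x‖ ^ γ) := by ring

lemma le_integral_mul_lagrangian (R : Regular E H h) (hγ : 0 ≤ γ)
    (hg : Continuous (coupling h g m))
    (hgrowth : ∀ x p M, ∀ m ∈ E, ∀ θ,
      1 / C₁ * (m ^ (-τ) * ‖p‖ ^ γ) + C₂ * g x m θ - C₁ ≤ lagrangian H x p M m θ)
    (hm : ∀ x, m x ∈ E) (hmτ : Continuous fun x => m x ^ (-τ)) (u : SmoothFun d) :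
    1 / C₁ * (∫ x, m x * (m x ^ (-τ) * ‖grad u x‖ ^ γ)) +
        C₂ * (∫ x, m x * coupling h g m x) - C₁ * (∫ x, m x) ≤
      ∫ x, m x * alongJet (lagrangian H) m u (h (smoothMeasure m)) x := by
  have hD := (integrable_of_continuous (μ := volume)
    (m.1.continuous.mul (hmτ.mul (continuous_norm_grad_rpow hγ u)))).const_mul (1 / C₁)
  have hG := (integrable_of_continuous (μ := volume) (m.1.continuous.mul hg)).const_mul C₂
  have hM := (integrable_smooth m).const_mul C₁
  have hL := integrable_of_continuous (μ := volume) <|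
    m.1.continuous.mul (R.continuous_alongJet (R.smooth.lagrangian R.half) hm u)
  simp_rw [← integral_const_mul]
  refine le_of_eq_of_le ?_ (integral_mono ((hD.add hG).sub hM) hL fun x => ?_)
  · exact ((integral_sub (hD.add hG) hM).trans (congrArg (· - _) (integral_add hD hG))).symm
  · have hle := mul_le_mul_of_nonneg_left
      (hgrowth x (grad u x) (hess u x) (m x) (hm x) (h (smoothMeasure m) x))
      (R.half.nonneg (hm x))
    refine le_of_eq_of_le ?_ hle
    simp only [Pi.sub_apply, Pi.add_apply, Pi.mul_apply, coupling]
    ring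

/-- (H1) for smooth `(m, u)`: the singular weight is absorbed by splitting `∫ |Du|^γ` into the
contributions `D₁` and `D₂` that the two parts of (H1) control. -/
lemma HypGrowth.exists_smooth_bounds (hyp : HypGrowth E H h g γ) (hd : 0 < d)
    (R : Regular E H h) (hyp_g : HypG E h g g₁ g₂) :
    ∃ C₁ C₂ C₃ : ℝ, 0 < C₁ ∧ 0 < C₂ ∧ 0 < C₃ ∧ ∀ m u : SmoothFun d, (∀ x, m x ∈ E) →
      ∃ D₁ D₂ : ℝ, ∫ x, ‖grad u x‖ ^ γ ≤ D₁ + D₂ ∧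
        0 ≤ D₁ ∧ 0 ≤ D₂ ∧
        -C₃ * (∫ x, coupling h g m x) + 1 / C₁ * D₁ - C₁ ≤
          ∫ x, alongJet H m u (h (smoothMeasure m)) x ∧
        1 / C₁ * D₂ + C₂ * (∫ x, m x * coupling h g m x) - C₁ * (∫ x, m x) ≤
          ∫ x, m x * alongJet (lagrangian H) m u (h (smoothMeasure m)) x := by
  obtain ⟨hγ, τ, C₁, C₂, C₃, C₄, hτ₀, hτ₁, hC₁, hC₂, hC₃, -, hgrowth, hint⟩ := hyp
  refine ⟨C₁, C₂, C₃, hC₁, hC₂, hC₃, fun m u hm => ?_⟩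
  have hγ₀ : 0 ≤ γ := by linarith
  have hm₀ (x) : 0 ≤ m x := R.half.nonneg (hm x)
  have hτm (x) : m x ≠ 0 ∨ τ = 0 := or_iff_not_imp_left.2 fun hx =>
    growth_exponent_eq_zero hd R.half (not_not.1 hx ▸ hm x) R.smooth hyp_g.continuousOn hτ₀ hC₁
      hgrowth
  have hmτ : Continuous fun x => m x ^ (-τ) :=
    m.1.continuous.rpow_const fun x => (hτm x).imp_right fun hτ => (neg_eq_zero.2 hτ).ge
  have hg := hyp_g.continuous_coupling hm
  refine ⟨∫ x, ‖grad u x‖ ^ γ * m x ^ (-τ), ∫ x, m x * (m x ^ (-τ) * ‖grad u x‖ ^ γ),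
    integral_norm_grad_rpow_le hγ₀ hτ₀ hτ₁.le hm₀ hmτ hτm u,
    integral_nonneg fun x => mul_nonneg (by positivity) (Real.rpow_nonneg (hm₀ x) _),
    integral_nonneg fun x => mul_nonneg (hm₀ x)
      (mul_nonneg (Real.rpow_nonneg (hm₀ x) _) (by positivity)), ?_,
    le_integral_mul_lagrangian R hγ₀ hg hgrowth hm hmτ u⟩
  have hcongr (F : Torus d → ℝ → ℝ) := comp_dens_smoothMeasure hm₀ F
  have hH := R.continuous_alongJet R.smooth hm u
  have hlower := (hint (smoothMeasure m) u (grad u) (hess u) (valuedIn_smoothMeasure R.half hm)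
    (isSobolevOne_smooth u)
    (fun i j => ⟨integrable_smooth (dpartial i (dpartial j u)),
      isWeakDeriv_smooth [i] (dpartial j u)⟩)
    ((integrable_of_continuous hg).congr
      (hcongr fun x s => g x s (h (smoothMeasure m) x)).symm)
    ((integrable_of_continuous ((continuous_norm_grad_rpow hγ₀ u).mul hmτ)).congr
      (hcongr fun x s => ‖grad u x‖ ^ γ * s ^ (-τ)).symm)
    ((integrable_of_continuous hH).congr
      (hcongr fun x s => H x (grad u x) (hess u x) s (h (smoothMeasure m) x)).symm)).1
  rwa [integral_smoothMeasure hm₀ fun x s => g x s (h (smoothMeasure m) x),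
    integral_smoothMeasure hm₀ fun x s => ‖grad u x‖ ^ γ * s ^ (-τ),
    integral_smoothMeasure hm₀ fun x s => H x (grad u x) (hess u x) s (h (smoothMeasure m) x)]
    at hlower

-- The test `c = 1` eliminates `∫ u`.
lemma HypGrowth.exists_energy_le (hyp : HypGrowth E H h g γ) (hd : 0 < d)
    (R : Regular E H h) (hyp_g : HypG E h g g₁ g₂) :
    ∃ B, ∀ m u : SmoothFun d, (∀ x, m x ∈ E) → 0 ≤ R.op (m, u) ((const d 1, 0) - (m, u)) →
      ∫ x, m x * coupling h g₁ m x ≤ B ∧ ∫ x, ‖grad u x‖ ^ γ ≤ B := by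
  obtain ⟨C₁, C₂, C₃, hC₁, hC₂, hC₃, hbounds⟩ := hyp.exists_smooth_bounds hd R hyp_g
  obtain ⟨r, hr⟩ := hyp_g.exists_neg_le_energy R.half
  obtain ⟨C, hC⟩ := hyp_g.exists_integral_coupling_le R.half
    (δ := C₂ / 2 / (C₃ + C₁)) (by positivity)
  set κ := (C₃ + C₁) * C + C₁
  refine ⟨max (κ / (C₂ / 2)) (C₁ * (κ + C₂ / 2 * r)), fun m u hm htest => ?_⟩
  obtain ⟨D₁, D₂, hD, hD₁, hD₂, hH, hL⟩ := hbounds m u hm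
  have hdiv : 0 ≤ (D₁ + D₂) / C₁ := by positivity
  have henergy := mul_le_mul_of_nonneg_left (hyp_g.energy_le R.half hm) hC₂.le
  have hlow := mul_le_mul_of_nonneg_left (hr m hm) (half_pos hC₂).le
  have habsorb : C₃ * (∫ x, coupling h g m x) + C₁ * (∫ x, m x) ≤
      C₂ / 2 * (∫ x, m x * coupling h g₁ m x) + (C₃ + C₁) * C := by
    have hle := add_le_add (mul_le_mul_of_nonneg_left (hC m hm).1 hC₃.le)
      (mul_le_mul_of_nonneg_left (hC m hm).2 hC₁.le)
    refine hle.trans_eq ?_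
    field_simp
  rw [R.op_const_sub hm] at htest
  have hsum : C₂ / 2 * (∫ x, m x * coupling h g₁ m x) + (D₁ + D₂) / C₁ ≤ κ := by
    rw [one_div_mul_eq_div] at hH hL
    rw [add_div]
    linarith
  constructor
  · refine le_max_of_le_left ((le_div_iff₀' (half_pos hC₂)).2 ?_)
    linarith
  · refine le_max_of_le_right (hD.trans ((div_le_iff₀' hC₁).1 ?_))
    linarith

lemma HypGrowth.exists_neg_integral_le (hyp : HypGrowth E H h g γ) (hd : 0 < d)
    (R : Regular E H h) (hyp_g : HypG E h g g₁ g₂) (B : ℝ) :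
    ∃ A, ∀ m u : SmoothFun d, (∀ x, m x ∈ E) → ∫ x, m x * coupling h g₁ m x ≤ B →
      -(∫ x, alongJet H m u (h (smoothMeasure m)) x) ≤ A ∧
        -(∫ x, m x * alongJet (lagrangian H) m u (h (smoothMeasure m)) x) ≤ A := by
  obtain ⟨C₁, C₂, C₃, hC₁, hC₂, hC₃, hbounds⟩ := hyp.exists_smooth_bounds hd R hyp_g
  obtain ⟨r, hr⟩ := hyp_g.exists_neg_le_energy R.half
  obtain ⟨C, hC⟩ := hyp_g.exists_integral_coupling_le R.half one_pos
  refine ⟨max (C₃ * (B + C) + C₁) (C₁ * (B + C) + C₂ * r), fun m u hm hB => ?_⟩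
  obtain ⟨D₁, D₂, -, hD₁, hD₂, hH, hL⟩ := hbounds m u hm
  obtain ⟨hg, hmass⟩ := hC m hm
  rw [one_mul] at hg hmass
  have hD₁' : 0 ≤ 1 / C₁ * D₁ := by positivity
  have hD₂' : 0 ≤ 1 / C₁ * D₂ := by positivity
  have hgB := mul_le_mul_of_nonneg_left (hg.trans (add_le_add_left hB C)) hC₃.le
  have hmB := mul_le_mul_of_nonneg_left (hmass.trans (add_le_add_left hB C)) hC₁.le
  have hlow := mul_le_mul_of_nonneg_left ((hr m hm).trans (hyp_g.energy_le R.half hm)) hC₂.le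
  constructor
  · refine le_max_of_le_left ?_
    linarith
  · refine le_max_of_le_right ?_
    linarith

-- The tests `c = 2` and `c = 1 / 2` give `∫ u` with opposite signs.
lemma HypGrowth.exists_apriori_bound (hyp : HypGrowth E H h g γ) (hd : 0 < d)
    (R : Regular E H h) (hyp_g : HypG E h g g₁ g₂) :
    ∃ B, ∀ m u : SmoothFun d, (∀ x, m x ∈ E) →
      (∀ c ∈ ({1, 2, 1 / 2} : Set ℝ), 0 ≤ R.op (m, u) ((const d c, 0) - (m, u))) →
      ∫ x, m x * coupling h g₁ m x ≤ B ∧ ∫ x, ‖grad u x‖ ^ γ ≤ B ∧ |∫ x, u x| ≤ B := by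
  obtain ⟨B, hB⟩ := hyp.exists_energy_le hd R hyp_g
  obtain ⟨A, hA⟩ := hyp.exists_neg_integral_le hd R hyp_g B
  refine ⟨max B (3 * A), fun m u hm htest => ?_⟩
  obtain ⟨henergy, hgrad⟩ := hB m u hm (htest 1 (by simp))
  obtain ⟨hH, hL⟩ := hA m u hm henergy
  have htwo := htest 2 (by simp)
  have hhalf := htest (1 / 2) (by simp)
  rw [R.op_const_sub hm] at htwo hhalf
  refine ⟨le_max_of_le_left henergy, le_max_of_le_left hgrad,
    le_max_of_le_right (abs_le.2 ⟨?_, ?_⟩)⟩ <;> linarith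

end Growth

/-! ### Integrable functions as functionals -/

section IntegralCLM

variable {X : Type*} [TopologicalSpace X] [CompactSpace X] [MeasurableSpace X] [BorelSpace X]
  {μ : Measure X} {f : X → ℝ}

lemma integrable_mul_continuousMap (hf : Integrable f μ) (b : C(X, ℝ)) :
    Integrable (fun x => f x * b x) μ :=
  hf.mul_bdd b.continuous.aestronglyMeasurable (.of_forall b.norm_coe_le_norm)

lemma abs_integral_mul_le (hf : Integrable f μ) {b : C(X, ℝ)} {K : ℝ} (hb : ∀ x, |b x| ≤ K) :
    |∫ x, f x * b x ∂μ| ≤ (∫ x, |f x| ∂μ) * K := by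
  rw [← integral_mul_const]
  refine abs_integral_le_integral_abs.trans
    (integral_mono (integrable_mul_continuousMap hf b).abs (hf.abs.mul_const K) fun x => ?_)
  simpa only [abs_mul] using mul_le_mul_of_nonneg_left (hb x) (abs_nonneg (f x))

/-- The functional `b ↦ ∫ f b` on continuous functions given by an integrable function `f`. -/
def integralCLM (f : X → ℝ) (hf : Integrable f μ) : C(X, ℝ) →L[ℝ] ℝ :=
  LinearMap.mkContinuous
    { toFun := fun b => ∫ x, f x * b x ∂μ
      map_add' := fun b c => by
        simpa only [ContinuousMap.add_apply, mul_add] using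
          integral_add (integrable_mul_continuousMap hf b) (integrable_mul_continuousMap hf c)
      map_smul' := fun r b => by
        simpa only [ContinuousMap.smul_apply, smul_eq_mul, mul_left_comm, RingHom.id_apply] using
          integral_const_mul r fun x => f x * b x }
    (∫ x, |f x| ∂μ) fun b => abs_integral_mul_le hf b.norm_coe_le_norm

lemma tendsto_integral_mul_of_tendsto_L1 [IsFiniteMeasure μ] {u : ℕ → C(X, ℝ)}
    (hf : Integrable f μ) (hu : Tendsto (fun n => ∫ x, |u n x - f x| ∂μ) atTop (𝓝 0))
    (b : C(X, ℝ)) : Tendsto (fun n => ∫ x, u n x * b x ∂μ) atTop (𝓝 (∫ x, f x * b x ∂μ)) := by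
  rw [tendsto_iff_norm_sub_tendsto_zero]
  refine squeeze_zero (fun _ => norm_nonneg _) (fun n => ?_) (by simpa using hu.mul_const ‖b‖)
  have hun : Integrable (u n) μ := integrable_of_continuous (u n).continuous
  have hsub : (∫ x, u n x * b x ∂μ) - ∫ x, f x * b x ∂μ = ∫ x, (u n x - f x) * b x ∂μ := by
    simp_rw [sub_mul]
    exact (integral_sub (integrable_mul_continuousMap hun b)
      (integrable_mul_continuousMap hf b)).symm
  rw [hsub]
  exact abs_integral_mul_le (hun.sub hf) b.norm_coe_le_norm

end IntegralCLM

/-- The distribution given by an integrable function. -/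
def distOf (f : Torus d → ℝ) (hf : Integrable f) : TorusDistribution d where
  toFun := (integralCLM f hf).toLinearMap ∘ₗ (SmoothFun d).subtype
  cont := ⟨0, ∫ x, |f x|, fun _ _ hB => abs_integral_mul_le hf (hB [] (by simp))⟩

lemma isFun_distOf {f g : Torus d → ℝ} (hf : Integrable f) (hgf : g =ᵐ[volume] f) :
    (distOf f hf).IsFun g :=
  ⟨hf.congr hgf.symm, fun _ => integral_congr_ae (hgf.symm.mul ae_eq_rfl)⟩

lemma nonneg_distOf {f : Torus d → ℝ} (hf : Integrable f) (hf₀ : 0 ≤ᵐ[volume] f) :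
    (distOf f hf).Nonneg := fun _ hφ =>
  integral_nonneg_of_ae (hf₀.mono fun x hx => mul_nonneg hx (hφ x))

/-! ### Weak limits -/

lemma rpow_add_le_two_rpow_mul (hγ : 0 ≤ γ) {a b : ℝ} (ha : 0 ≤ a) (hb : 0 ≤ b) :
    (a + b) ^ γ ≤ 2 ^ γ * (a ^ γ + b ^ γ) := by
  wlog hab : a ≤ b generalizing a b
  · simpa only [add_comm] using this hb ha (le_of_not_ge hab)
  calc (a + b) ^ γ ≤ (2 * b) ^ γ := Real.rpow_le_rpow (by positivity) (by linarith) hγ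
    _ = 2 ^ γ * b ^ γ := Real.mul_rpow zero_le_two hb
    _ ≤ 2 ^ γ * (a ^ γ + b ^ γ) := by gcongr; exact le_add_of_nonneg_left (Real.rpow_nonneg ha γ)

lemma integral_abs_rpow_le (hγ : 1 ≤ γ) {B : ℝ} {u : SmoothFun d}
    (hgrad : ∫ x, ‖grad u x‖ ^ γ ≤ B) (hmean : |∫ x, u x| ≤ B) :
    ∫ x, |u x| ^ γ ≤ 2 ^ γ * ((d : ℝ) ^ γ * B + B ^ γ) := by
  have hγ₀ : 0 ≤ γ := zero_le_one.trans hγ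
  have hosc : Integrable fun x => |u x - ∫ y, u y| ^ γ :=
    integrable_of_continuous
      ((u.1.continuous.sub continuous_const).abs.rpow_const fun _ => Or.inr hγ₀)
  calc ∫ x, |u x| ^ γ ≤ ∫ x, 2 ^ γ * (|u x - ∫ y, u y| ^ γ + |∫ y, u y| ^ γ) := by
        refine integral_mono (integrable_of_continuous (continuous_abs_rpow hγ₀ u.1))
          ((hosc.add (integrable_const _)).const_mul _) fun x =>
          le_trans (Real.rpow_le_rpow (abs_nonneg _) ?_ hγ₀)
            (rpow_add_le_two_rpow_mul hγ₀ (abs_nonneg _) (abs_nonneg _))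
        simpa only [sub_add_cancel] using abs_add_le (u x - ∫ y, u y) (∫ y, u y)
    _ = 2 ^ γ * ((∫ x, |u x - ∫ y, u y| ^ γ) + |∫ y, u y| ^ γ) := by
        rw [integral_const_mul, integral_add hosc (integrable_const _)]
        simp
    _ ≤ 2 ^ γ * ((d : ℝ) ^ γ * B + B ^ γ) := by
        gcongr
        exact (integral_rpow_sub_mean_le hγ u).trans (by gcongr)

lemma exists_sobolev_limit (hγ : 1 < γ) {B : ℝ} {u : ℕ → SmoothFun d}
    (hgrad : ∀ n, ∫ x, ‖grad (u n) x‖ ^ γ ≤ B) (hmean : ∀ n, |∫ x, u n x| ≤ B) :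
    ∃ (w : Torus d → ℝ) (Dw : Torus d → EuclideanSpace ℝ (Fin d)), IsSobolevOne γ w Dw ∧
      ∃ v : ℕ → SmoothFun d, (∀ n, v n ∈ convexHull ℝ (u '' Ici n)) ∧
        ∀ b : C(Torus d, ℝ), Tendsto (fun n => ∫ x, v n x * b x) atTop (𝓝 (∫ x, w x * b x)) := by
  have hγ₀ : 0 ≤ γ := zero_le_one.trans hγ.le
  -- `none` stands for the function itself, `some i` for its `i`-th partial derivative.
  let T : Option (Fin d) → SmoothFun d →ₗ[ℝ] C(Torus d, ℝ) := fun o =>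
    o.elim (SmoothFun d).subtype fun i => (SmoothFun d).subtype ∘ₗ dpartialₗ i
  have hT : ∀ o n, ∫ x, |T o (u n) x| ^ γ ≤ max B (2 ^ γ * ((d : ℝ) ^ γ * B + B ^ γ)) := by
    rintro (_ | i) n
    · exact (integral_abs_rpow_le hγ.le (hgrad n) (hmean n)).trans (le_max_right _ _)
    · exact (integral_mono (integrable_of_continuous (continuous_abs_rpow hγ₀ _))
        (integrable_of_continuous (continuous_norm_grad_rpow hγ₀ (u n))) fun x =>
        Real.rpow_le_rpow (abs_nonneg _) (abs_pderiv_le_norm_grad i (u n) x) hγ₀).trans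
        ((hgrad n).trans (le_max_left _ _))
  obtain ⟨v, hv, F, hF⟩ := exists_convexHull_tail_tendsto T hγ hT
  have hlim (o : Option (Fin d)) (b : C(Torus d, ℝ)) :
      Tendsto (fun n => ∫ x, T o (v n) x * b x) atTop (𝓝 (∫ x, F o x * b x)) :=
    tendsto_integral_mul_of_tendsto_L1 ((hF o).1.integrable (by simpa using hγ.le)) (hF o).2 b
  refine ⟨F none, fun x => WithLp.toLp 2 fun i => F (some i) x,
    ⟨(hF none).1, fun i => (hF (some i)).1, fun i φ => ?_⟩, v, hv, hlim none⟩
  have hparts := tendsto_nhds_unique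
    ((hlim none (dpartial i φ).1).congr fun n => integral_mul_pderiv i (v n) φ)
    (hlim (some i) φ.1).neg
  simpa [iterPartial] using hparts

lemma le_of_tendsto_convexHull_tail {V : Type*} [AddCommGroup V] [Module ℝ V] {ℓ : V →ₗ[ℝ] ℝ}
    {u v : ℕ → V} {r : ℕ → ℝ} {a r₀ : ℝ} (hv : ∀ n, v n ∈ convexHull ℝ (u '' Ici n))
    (ha : Tendsto (fun n => ℓ (v n)) atTop (𝓝 a)) (hr : Tendsto r atTop (𝓝 r₀))
    (hur : ∀ᶠ n in atTop, ℓ (u n) ≤ r n) : a ≤ r₀ := by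
  refine le_of_forall_gt_imp_ge_of_dense fun s hs => ?_
  obtain ⟨N, hN⟩ := eventually_atTop.1 (hur.and (hr.eventually_lt_const hs))
  refine le_of_tendsto ha (eventually_atTop.2 ⟨N, fun n hn => ?_⟩)
  refine convexHull_min ?_ (convex_halfSpace_le ℓ.isLinear s) (hv n)
  rintro _ ⟨k, hk, rfl⟩
  obtain ⟨huk, hrk⟩ := hN k (hn.trans hk)
  exact huk.trans hrk.le

lemma ae_nonneg_of_tendsto_integral_mul {X : Type*} [MeasurableSpace X] {μ : Measure X}
    {f : ℕ → X → ℝ} {m : X → ℝ} (hf : ∀ n, 0 ≤ᵐ[μ] f n) (hm : Integrable m μ)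
    (hlim : ∀ φ : X → ℝ, Measurable φ → (∃ K : ℝ, ∀ x, |φ x| ≤ K) →
      Tendsto (fun n => ∫ x, f n x * φ x ∂μ) atTop (𝓝 (∫ x, m x * φ x ∂μ))) :
    0 ≤ᵐ[μ] m := by
  refine ae_nonneg_of_forall_setIntegral_nonneg hm fun s hs _ => ?_
  have hs_lim := hlim (s.indicator 1) (measurable_one.indicator hs) ⟨1, fun x => by
    by_cases hx : x ∈ s <;> simp [hx]⟩
  simp only [← indicator_mul_right, Pi.one_apply, mul_one, integral_indicator hs] at hs_lim
  exact ge_of_tendsto' hs_lim fun n => setIntegral_nonneg_of_ae (hf n)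

section Solution

variable {E : Set ℝ} {H : Hamiltonian d} {h : Mac d → C(Torus d, ℝ)}
  {g g₁ g₂ : Torus d → ℝ → ℝ → ℝ}

lemma HypCompact.exists_weak_limit (hyp : HypCompact E h g₁) (hyp_g : HypG E h g g₁ g₂)
    (hE : IsHalfLine E) {η : ℕ → SmoothFun d} (hη : ∀ n x, η n x ∈ E) {B : ℝ}
    (hB : ∀ n, ∫ x, η n x * coupling h g₁ (η n) x ≤ B) :
    ∃ s : ℕ → ℕ, StrictMono s ∧ ∃ m : Torus d → ℝ, Integrable m ∧ 0 ≤ᵐ[volume] m ∧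
      ∀ b : C(Torus d, ℝ),
        Tendsto (fun n => ∫ x, η (s n) x * b x) atTop (𝓝 (∫ x, m x * b x)) := by
  obtain ⟨s, hs, m, hm, hlim⟩ := hyp (fun n => smoothMeasure (η n))
    (fun n => valuedIn_smoothMeasure hE (hη n))
    ⟨B, fun n => (hyp_g.extIntegral_energy hE (hη n)).trans_le (EReal.coe_le_coe (hB n))⟩
  refine ⟨s, hs, m, hm, ae_nonneg_of_tendsto_integral_mul
    (fun n => .of_forall fun x => ENNReal.toReal_nonneg) hm hlim, fun b => ?_⟩
  refine (hlim b b.continuous.measurable ⟨‖b‖, b.norm_coe_le_norm⟩).congr fun n => ?_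
  exact integral_congr_ae (comp_dens_smoothMeasure (fun x => hE.nonneg (hη (s n) x))
    fun x t => t * b x)

/-! ### The weak formulation -/

namespace Regular

/-- The inequality `⟨z - (m, u), A z⟩ ≥ 0` of the weak formulation, at the test pair `z`. -/
def WeakIneqAt (R : Regular E H h) (m u : TorusDistribution d)
    (z : {z : SmoothFun d × SmoothFun d // ∀ x, z.1 x ∈ E}) : Prop :=
  m.toFun (R.smoothA₁ z.2 z.1.2) + u.toFun (R.smoothA₂ z.2 z.1.2) ≤ R.op z z

lemma isWeakSolution_iff (R : Regular E H h) {m u : TorusDistribution d} :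
    IsWeakSolution E H h m u ↔ m.Nonneg ∧ ∀ z, R.WeakIneqAt m u z := by
  refine and_congr_right fun _ => ⟨fun hsol z => ?_, fun hsol η v hη => ?_⟩
  · obtain ⟨a, b, ha, hb, hle⟩ := hsol z.1.1 z.1.2 z.2
    obtain rfl : a = R.smoothA₁ z.2 z.1.2 := SmoothFun.ext fun x => ha x
    obtain rfl : b = R.smoothA₂ z.2 z.1.2 :=
      SmoothFun.ext fun x => (hb x).trans (R.smoothA₂_apply z.2 z.1.2 x).symm
    rw [WeakIneqAt, R.op_apply z.2, pairing_apply, pairing_apply]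
    linarith
  · refine ⟨R.smoothA₁ hη v, R.smoothA₂ hη v, R.smoothA₁_apply hη v, R.smoothA₂_apply hη v, ?_⟩
    have hle := hsol ⟨(η, v), hη⟩
    rw [WeakIneqAt, R.op_apply hη, pairing_apply, pairing_apply] at hle
    linarith

lemma smoothA₁_const (R : Regular E H h) {η : SmoothFun d} (hη : ∀ x, η x ∈ E) (c : ℝ) :
    R.smoothA₁ hη (const d c) = R.smoothA₁ hη (const d 0) - c • const d 1 := by
  ext x
  simp [smoothA₁, jet_apply, grad_const, hess_const]
  ring

lemma smoothA₂_const (R : Regular E H h) {η : SmoothFun d} (hη : ∀ x, η x ∈ E) (c : ℝ) :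
    R.smoothA₂ hη (const d c) = R.smoothA₂ hη (const d 0) := by
  ext x
  simp only [smoothA₂_apply, A₂, grad_const, hess_const]

lemma pairing_const_smoothA₂ (R : Regular E H h) {η : SmoothFun d} (hη : ∀ x, η x ∈ E)
    (v : SmoothFun d) (c : ℝ) :
    pairing d (const d c) (R.smoothA₂ hη v) = pairing d (const d c) (η - const d 1) := by
  have dpartial_zero (i : Fin d) : dpartial i 0 = 0 := (dpartialₗ i).map_zero
  simp [pairing_smoothA₂, dpartial_const, dpartial_zero]

lemma eq_zero_of_forall_nonneg_mul_add {a b : ℝ} (hab : ∀ c, 0 ≤ c * a + b) : a = 0 := by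
  by_contra ha
  have := hab (-(b + 1) / a)
  rw [div_mul_cancel₀ _ ha] at this
  linarith

lemma mass_eq_one (R : Regular E H h) {m u : TorusDistribution d}
    (hsol : IsWeakSolution E H h m u) : m.toFun (const d 1) = 1 := by
  have hone : ∀ x : Torus d, const d 1 x ∈ E := fun _ => R.half.Ioi_subset (mem_Ioi.2 one_pos)
  have hone_one : pairing d (const d 1) (const d 1) = 1 := by simp [pairing_apply]
  have hmass (c : ℝ) : 0 ≤ c * (m.toFun (const d 1) - 1) +
      (pairing d (const d 1) (R.smoothA₁ hone (const d 0))
        - m.toFun (R.smoothA₁ hone (const d 0)) - u.toFun (R.smoothA₂ hone (const d 0))) := by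
    have htest := (R.isWeakSolution_iff.1 hsol).2 ⟨(const d 1, const d c), hone⟩
    rw [WeakIneqAt, R.op_apply hone] at htest
    simp only [R.smoothA₁_const _ c, R.smoothA₂_const _ c, pairing_const_smoothA₂, map_sub,
      map_smul, smul_eq_mul, sub_self, map_zero, hone_one] at htest
    linarith
  exact sub_eq_zero.1 (eq_zero_of_forall_nonneg_mul_add hmass)

end Regular

lemma exists_dense_subfamily {Y Z : Type*} [Nonempty Y] [TopologicalSpace Z]
    [SecondCountableTopology Z] (Θ : Y → Z) :
    ∃ W : ℕ → Y, ∀ y, Θ y ∈ closure (range (Θ ∘ W)) := by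
  have : Nonempty (range Θ) := (range_nonempty Θ).to_subtype
  choose W hW using fun n : ℕ => (TopologicalSpace.denseSeq (range Θ) n).2
  refine ⟨W, fun y => ?_⟩
  have hy := image_closure_subset_closure_image continuous_subtype_val
    ⟨_, TopologicalSpace.denseRange_denseSeq (range Θ) ⟨Θ y, mem_range_self y⟩, rfl⟩
  rw [← range_comp] at hy
  rwa [show Θ ∘ W = Subtype.val ∘ TopologicalSpace.denseSeq (range Θ) from funext hW]

namespace Regular

lemma exists_countable_tests (R : Regular E H h) :
    ∃ W : ℕ → {z : SmoothFun d × SmoothFun d // ∀ x, z.1 x ∈ E},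
      ∀ {m w : Torus d → ℝ} {hm : Integrable m} {hw : Integrable w},
        (∀ k, R.WeakIneqAt (distOf m hm) (distOf w hw) (W k)) →
          ∀ z, R.WeakIneqAt (distOf m hm) (distOf w hw) z := by
  have : Nonempty {z : SmoothFun d × SmoothFun d // ∀ x, z.1 x ∈ E} :=
    ⟨(const d 1, 0), fun _ => R.half.Ioi_subset (mem_Ioi.2 one_pos)⟩
  -- The inequality at `z` is a closed condition on `Θ z`, and `C(𝕋^d)` is second countable.
  let Θ : {z : SmoothFun d × SmoothFun d // ∀ x, z.1 x ∈ E} →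
      ℝ × C(Torus d, ℝ) × C(Torus d, ℝ) := fun z =>
    (R.op z.1 z.1, (R.smoothA₁ z.2 z.1.2).1, (R.smoothA₂ z.2 z.1.2).1)
  obtain ⟨W, hW⟩ := exists_dense_subfamily Θ
  refine ⟨W, fun {m w hm hw} hWk z => ?_⟩
  have hclosed : IsClosed {t : ℝ × C(Torus d, ℝ) × C(Torus d, ℝ) |
      integralCLM m hm t.2.1 + integralCLM w hw t.2.2 ≤ t.1} :=
    isClosed_le (by fun_prop) (by fun_prop)
  exact closure_minimal (range_subset_iff.2 hWk) hclosed (hW z)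

lemma weakIneqAt_of_tendsto (R : Regular E H h) {η u v : ℕ → SmoothFun d} {m w : Torus d → ℝ}
    (hm : Integrable m) (hw : Integrable w)
    (hηm : ∀ b : C(Torus d, ℝ), Tendsto (fun n => ∫ x, η n x * b x) atTop (𝓝 (∫ x, m x * b x)))
    (hv : ∀ n, v n ∈ convexHull ℝ (u '' Ici n))
    (hvw : ∀ b : C(Torus d, ℝ), Tendsto (fun n => ∫ x, v n x * b x) atTop (𝓝 (∫ x, w x * b x)))
    {z : {z : SmoothFun d × SmoothFun d // ∀ x, z.1 x ∈ E}}
    (hz : ∀ᶠ n in atTop, 0 ≤ R.op z (z - (η n, u n))) :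
    R.WeakIneqAt (distOf m hm) (distOf w hw) z := by
  have hle : ∫ x, w x * R.smoothA₂ z.2 z.1.2 x ≤
      R.op z z - ∫ x, m x * R.smoothA₁ z.2 z.1.2 x := by
    refine le_of_tendsto_convexHull_tail (ℓ := (pairing d).flip (R.smoothA₂ z.2 z.1.2)) hv
      (hvw (R.smoothA₂ z.2 z.1.2).1) ((hηm (R.smoothA₁ z.2 z.1.2).1).const_sub _)
      (hz.mono fun n hn => ?_)
    rw [map_sub, R.op_apply z.2 (η n, u n)] at hn
    change pairing d (u n) _ ≤ _ - pairing d (η n) _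
    linarith
  exact le_sub_iff_add_le'.1 hle

lemma exists_approx (R : Regular E H h) (hd : 0 < d) (hyp_g : HypG E h g g₁ g₂)
    (hyp : HypGrowth E H h g γ) (hmono : HypMonotone E H h)
    (W : ℕ → {z : SmoothFun d × SmoothFun d // ∀ x, z.1 x ∈ E}) :
    ∃ (B : ℝ) (z : ℕ → SmoothFun d × SmoothFun d), (∀ n x, (z n).1 x ∈ E) ∧
      (∀ n, ∫ x, (z n).1 x * coupling h g₁ (z n).1 x ≤ B) ∧
      (∀ n, ∫ x, ‖grad (z n).2 x‖ ^ γ ≤ B) ∧ (∀ n, |∫ x, (z n).2 x| ≤ B) ∧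
      ∀ k n, k < n → 0 ≤ R.op (W k) (W k - z n) := by
  obtain ⟨B, hB⟩ := hyp.exists_apriori_bound hd R hyp_g
  have hconst (c : ({1, 2, 1 / 2} : Set ℝ)) : (c : ℝ) ∈ E := by
    obtain ⟨_, rfl | rfl | rfl⟩ := c <;> exact R.half.Ioi_subset (by norm_num [mem_Ioi])
  let p (n : ℕ) : ({1, 2, 1 / 2} : Set ℝ) ⊕ Fin n → SmoothFun d × SmoothFun d :=
    Sum.elim (fun c => (const d c, 0)) fun k => W k
  have hp (n : ℕ) : ∀ k x, (p n k).1 x ∈ E := Sum.rec (fun c _ => hconst c) fun k => (W k).2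
  have : Nonempty ({1, 2, 1 / 2} : Set ℝ) := ⟨1, by simp⟩
  choose z hzE hz using fun n => R.exists_solution hmono (hp n)
  have hbound (n : ℕ) := hB (z n).1 (z n).2 (hzE n) fun c hc => (hz n (.inl ⟨c, hc⟩)).1
  exact ⟨B, z, hzE, fun n => (hbound n).1, fun n => (hbound n).2.1, fun n => (hbound n).2.2,
    fun k n hk => (hz n (.inr ⟨k, hk⟩)).2⟩

lemma exists_isWeakSolution (R : Regular E H h) (hd : 0 < d) (hyp_g : HypG E h g g₁ g₂)
    (hyp_gei : HypCompact E h g₁) (hyp : HypGrowth E H h g γ) (hmono : HypMonotone E H h) :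
    ∃ (m w : Torus d → ℝ) (hm : Integrable m) (hw : Integrable w), 0 ≤ᵐ[volume] m ∧
      (∃ Dw, IsSobolevOne γ w Dw) ∧ IsWeakSolution E H h (distOf m hm) (distOf w hw) := by
  obtain ⟨W, hW⟩ := R.exists_countable_tests
  obtain ⟨B, z, hzE, henergy, hgrad, hmean, hz⟩ := R.exists_approx hd hyp_g hyp hmono W
  obtain ⟨s, hs, m, hm, hm₀, hηm⟩ := hyp_gei.exists_weak_limit hyp_g R.half hzE henergy
  obtain ⟨w, Dw, hwS, v, hv, hvw⟩ := exists_sobolev_limit hyp.1 (u := fun n => (z (s n)).2)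
    (fun n => hgrad (s n)) fun n => hmean (s n)
  have hw : Integrable w := hwS.memLp.integrable (by simpa using hyp.1.le)
  refine ⟨m, w, hm, hw, hm₀, ⟨Dw, hwS⟩,
    R.isWeakSolution_iff.2 ⟨nonneg_distOf hm hm₀, hW fun k => ?_⟩⟩
  refine R.weakIneqAt_of_tendsto hm hw hηm hv hvw ?_
  filter_upwards [eventually_gt_atTop k] with n hn
  exact hz k (s n) (hn.trans_le (hs.id_le n))

end Regular

end Solution

end MFG

end

theorem theorem1p1 {d : ℕ} (hd : 0 < d) (E : Set ℝ) (hE : E = Set.Ioi 0 ∨ E = Set.Ici 0)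
    (H : MFG.Hamiltonian d) (h : MFG.Mac d → C(MFG.Torus d, ℝ))
    (g g₁ g₂ : MFG.Torus d → ℝ → ℝ → ℝ) (γ : ℝ)
    (hyp_h : MFG.HypNonlocal h)
    (hyp_g : MFG.HypG E h g g₁ g₂)
    (hyp_gei : MFG.HypCompact E h g₁)
    (hyp_H1 : MFG.HypGrowth E H h g γ)
    (hyp_H2 : MFG.HypSmooth E H)
    (hyp_H3 : MFG.HypMonotone E H h) :
    ∃ m u : MFG.TorusDistribution d,
      MFG.IsWeakSolution E H h m u ∧
      (∃ μ : MFG.Mac d, m.IsFun μ.dens ∧ ∫ x, μ.dens x = 1) ∧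
      (∃ (w : MFG.Torus d → ℝ) (Dw : MFG.Torus d → EuclideanSpace ℝ (Fin d)),
        MFG.IsSobolevOne γ w Dw ∧ u.IsFun w) := by
  have R : MFG.Regular E H h := ⟨hE, hyp_H2, hyp_h⟩
  obtain ⟨m, w, hm, hw, hm₀, ⟨Dw, hwS⟩, hsol⟩ :=
    R.exists_isWeakSolution hd hyp_g hyp_gei hyp_H1 hyp_H3
  have hfun := MFG.isFun_distOf hm (MFG.Mac.dens_ofDensity hm hm₀)
  refine ⟨_, _, hsol, ⟨_, hfun, ?_⟩, w, Dw, hwS, MFG.isFun_distOf hw ae_eq_rfl⟩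
  have hmass := R.mass_eq_one hsol
  simpa [hfun.2] using hmass
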